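/- Fix an o-minimal structure on $\mathbb{R}$ containing the semialgebraic sets; its members are called definable. All topological groupoids $\mathcal{G}$ have Hausdorff spaces of objects $\mathcal{G}_0$ and arrows $\mathcal{G}_1$; $\pi:\mathcal{G}_0\to|\mathcal{G}|$ is the quotient map to the orbit space. A homomorphism $\Phi:\mathcal{K}\to\mathcal{G}$ is an essential equivalence if $\mathcal{G}_1\times_{s,\Phi_0}\mathcal{K}_0\to\mathcal{G}_0$, $(g,x)\mapsto t(g)$, is a surjection admitting local sections and $\mathcal{K}_1$ is the fibred product of $\mathcal{K}_0\times\mathcal{K}_0$ and $\mathcal{G}_1$ over $\mathcal{G}_0\times\mathcal{G}_0$; $\mathcal{G}$ and $\mathcal{H}$ are Morita equivalent if there are essential equivalences $\mathcal{G}\leftarrow\mathcal{K}\rightarrow\mathcal{H}$. An *orbit space definable groupoid* is a topological groupoid $\mathcal{G}$ together with a topological embedding $\iota:|\mathcal{G}|\to\mathbb{R}^n$ with definable image, such that every isotropy group is a compact Lie group and the partition of $\mathcal{G}_0$ into points with isomorphic isotropy groups is finite and induces a partition of $|\mathcal{G}|$ into definable sets $|\mathcal{G}|_{[G]}$ (the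 orbits with isotropy isomorphic to $G$). It is *isotropy locally trivial* if $|\mathcal{G}|$ has a finite decomposition into definable cells, each contained in some $|\mathcal{G}|_{[G]}$, such that for each cell $C\subseteq|\mathcal{G}|_{[G]}$ the restriction $\mathcal{G}_{|\pi^{-1}(C)}$ is Morita equivalent to the translation groupoid $G\ltimes C$ of the trivial action. Let $\mathscr{R}$ be the ring of integer polynomials in variables $T^{[G]}$, one for each isomorphism class of compact Lie groups, modulo the relations $T^{[G]}T^{[H]}=T^{[G\times H]}$ and $T^{[e]}=1$ for the trivial group $e$. The universal Euler characteristic is $\chi^{\mathrm{un}}(\mathcal{G})=\sum_{[G]}\chi(|\mathcal{G}|_{[G]})\,T^{[G]}\in\mathscr{R}$, where $\chi(X)=\sum_i(-1)^{\dim C_i}$ for a decomposition of the definable set $X$ into finitely many disjoint cells $C_i$. Let $R$ be a ring with unity and let $I$ be an $R$-valued topological invariant of orbit space definable groupoids, i.e. $I(\mathcal{G})=I(\mathcal{H})$ whenever $\mathcal{G}$ and $\mathcal{H}$ are Morita equivalent. Call $I$ *additive on isotropy locally trivial groupoids* if $I(\mathcal{G})=I(\mathcal{G}_{|\pi^{-1}(Y)})+I(\mathcal{G}_{|\pi^{-1}(|\mathcal{G}|\smallsetminus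 Y)})$ for every isotropy locally trivial $\mathcal{G}$ and every definable $Y\subseteq|\mathcal{G}|$, and *multiplicative on isotropy locally trivial groupoids* if $I(\mathcal{G}\times\mathcal{H})=I(\mathcal{G})I(\mathcal{H})$ for all isotropy locally trivial $\mathcal{G},\mathcal{H}$ for which the product of the embeddings is a topological embedding of $|\mathcal{G}\times\mathcal{H}|$ (so that $\mathcal{G}\times\mathcal{H}$ is orbit space definable). **Theorem.** $I$ is additive and multiplicative on isotropy locally trivial groupoids if and only if there is a unique additive and multiplicative (not necessarily unit-preserving) ring homomorphism $r:\mathscr{R}\to R$ such that $I(\mathcal{G})=r(\chi^{\mathrm{un}}(\mathcal{G}))$ for every isotropy locally trivial orbit space definable groupoid $\mathcal{G}$. Likewise, $I$ is additive and multiplicative on isotropy locally trivial groupoids and takes the value $1$ on the groupoid with one object and one arrow if and only if there is a unique unit-preserving ring homomorphism $r:\mathscr{R}\to R$ with this property. -/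

import Mathlib

open Set Topology
open scoped Manifold ContDiff

universe u v

/-! ### O-minimal structures on the real field -/

/-- A set of reals that is a finite union of points and open intervals (with endpoints in
`[-∞, ∞]`). -/
def IsTameSet (A : Set ℝ) : Prop :=
  ∃ F : Set (Set ℝ), F.Finite ∧
    (∀ J ∈ F, (∃ a : ℝ, J = {a}) ∨ ∃ a b : EReal, J = {t : ℝ | a < (t : EReal) ∧ (t : EReal) < b}) ∧
    ⋃₀ F = A

/-- Forget the last coordinate. -/
def dropLast {n : ℕ} (x : Fin (n + 1) → ℝ) : Fin n → ℝ := fun i => x i.castSucc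

/-- An o-minimal structure on `ℝ` that contains the semialgebraic sets: a family of Boolean
algebras of subsets of the spaces `ℝⁿ`, closed under substitution of coordinates (which covers
products with `ℝ`, permutations and diagonals) and under coordinate projections, containing the
sets `{p > 0}` for polynomials `p` (hence all semialgebraic sets), and whose members in `ℝ` are
finite unions of points and open intervals. -/
structure OMinimalStructure where
  IsDef : ∀ {n : ℕ}, Set (Fin n → ℝ) → Prop
  compl : ∀ {n : ℕ} {A : Set (Fin n → ℝ)}, IsDef A → IsDef Aᶜ
  union : ∀ {n : ℕ} {A B : Set (Fin n → ℝ)}, IsDef A → IsDef B → IsDef (A ∪ B)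
  reindex : ∀ {m n : ℕ} (f : Fin m → Fin n) {A : Set (Fin m → ℝ)}, IsDef A →
    IsDef {x : Fin n → ℝ | (fun i => x (f i)) ∈ A}
  proj : ∀ {n : ℕ} {A : Set (Fin (n + 1) → ℝ)}, IsDef A → IsDef (dropLast '' A)
  semialgebraic : ∀ {n : ℕ} (p : MvPolynomial (Fin n) ℝ), IsDef {x | 0 < MvPolynomial.eval x p}
  tame : ∀ {A : Set (Fin 1 → ℝ)}, IsDef A → IsTameSet {t : ℝ | (fun _ => t) ∈ A}

namespace OMinimalStructure

variable (S : OMinimalStructure)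

theorem inter {n : ℕ} {A B : Set (Fin n → ℝ)} (hA : S.IsDef A) (hB : S.IsDef B) :
    S.IsDef (A ∩ B) := by
  have := S.compl (S.union (S.compl hA) (S.compl hB))
  rwa [compl_union, compl_compl, compl_compl] at this

theorem diff {n : ℕ} {A B : Set (Fin n → ℝ)} (hA : S.IsDef A) (hB : S.IsDef B) :
    S.IsDef (A \ B) := S.inter hA (S.compl hB)

theorem empty (n : ℕ) : S.IsDef (∅ : Set (Fin n → ℝ)) := by
  simpa using S.semialgebraic (0 : MvPolynomial (Fin n) ℝ)

theorem biUnion {n : ℕ} {ι : Type*} {s : Set ι} (hs : s.Finite) {A : ι → Set (Fin n → ℝ)}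
    (hA : ∀ i ∈ s, S.IsDef (A i)) : S.IsDef (⋃ i ∈ s, A i) := by
  induction s, hs using Set.Finite.induction_on with
  | empty => simpa using S.empty n
  | insert _ _ ih =>
    rw [biUnion_insert]
    exact S.union (hA _ (mem_insert _ _)) (ih fun i hi => hA i (mem_insert_of_mem _ hi))

/-- The product `A × B` inside `ℝᵐ⁺ⁿ`. -/
def prodSet {m n : ℕ} (A : Set (Fin m → ℝ)) (B : Set (Fin n → ℝ)) : Set (Fin (m + n) → ℝ) :=
  {x | (fun i => x (Fin.castAdd n i)) ∈ A ∧ (fun j => x (Fin.natAdd m j)) ∈ B}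

theorem isDef_prodSet {m n : ℕ} {A : Set (Fin m → ℝ)} {B : Set (Fin n → ℝ)} (hA : S.IsDef A)
    (hB : S.IsDef B) : S.IsDef (prodSet A B) :=
  S.inter (S.reindex (Fin.castAdd n) hA) (S.reindex (Fin.natAdd m) hB)

/-! ### Cells and the Euler characteristic -/

/-- The graph of `f` over `Y`. -/
def graphOver {n : ℕ} (Y : Set (Fin n → ℝ)) (f : (Fin n → ℝ) → ℝ) : Set (Fin (n + 1) → ℝ) :=
  {x | dropLast x ∈ Y ∧ x (Fin.last n) = f (dropLast x)}

/-- The open band over `Y` between `f` and `g`. -/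
def bandOver {n : ℕ} (Y : Set (Fin n → ℝ)) (f g : (Fin n → ℝ) → EReal) :
    Set (Fin (n + 1) → ℝ) :=
  {x | dropLast x ∈ Y ∧ f (dropLast x) < (x (Fin.last n) : EReal) ∧
    (x (Fin.last n) : EReal) < g (dropLast x)}

/-- `f` restricts to a definable continuous function on `Y`. -/
def DefContOn {n : ℕ} (Y : Set (Fin n → ℝ)) (f : (Fin n → ℝ) → ℝ) : Prop :=
  ContinuousOn f Y ∧ S.IsDef (graphOver Y f)

/-- On `Y`, the function `f` is either real-valued, definable and continuous, or constantly equal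
to `c` (used with `c = ⊥` and `c = ⊤`). -/
def IsBound {n : ℕ} (c : EReal) (Y : Set (Fin n → ℝ)) (f : (Fin n → ℝ) → EReal) : Prop :=
  (∃ f' : (Fin n → ℝ) → ℝ, S.DefContOn Y f' ∧ ∀ y ∈ Y, f y = (f' y : EReal)) ∨ ∀ y ∈ Y, f y = c

/-- `S.IsCell d C`: the set `C ⊆ ℝⁿ` is an `(i₁, …, iₙ)`-cell with `i₁ + ⋯ + iₙ = d`. The
recursion starts from the one-point space `ℝ⁰`, so that the cells in `ℝ` are the points and the
open intervals. -/
inductive IsCell : {n : ℕ} → ℕ → Set (Fin n → ℝ) → Prop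
  | point : IsCell (n := 0) 0 univ
  | graph {n d : ℕ} {Y : Set (Fin n → ℝ)} {f : (Fin n → ℝ) → ℝ} (hY : IsCell d Y)
      (hf : S.DefContOn Y f) : IsCell d (graphOver Y f)
  | band {n d : ℕ} {Y : Set (Fin n → ℝ)} {f g : (Fin n → ℝ) → EReal} (hY : IsCell d Y)
      (hf : S.IsBound ⊥ Y f) (hg : S.IsBound ⊤ Y g) (hfg : ∀ y ∈ Y, f y < g y) :
      IsCell (d + 1) (bandOver Y f g)

/-- A decomposition of `A ⊆ ℝⁿ` into finitely many pairwise disjoint cells. -/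
structure CellDecomposition {n : ℕ} (A : Set (Fin n → ℝ)) where
  card : ℕ
  cell : Fin card → Set (Fin n → ℝ)
  dim : Fin card → ℕ
  isCell : ∀ i, S.IsCell (dim i) (cell i)
  disjoint : Pairwise fun i j => Disjoint (cell i) (cell j)
  iUnion_cell : ⋃ i, cell i = A

open Classical in
/-- The Euler characteristic `∑ (-1) ^ dim Cᵢ` of a set decomposed into cells `Cᵢ` (every
definable set has such a decomposition and the sum does not depend on it; the value `0` for sets
without cell decomposition is never used). -/
noncomputable def eulerChar {n : ℕ} (A : Set (Fin n → ℝ)) : ℤ :=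
  if h : Nonempty (S.CellDecomposition A) then
    ∑ i : Fin h.some.card, (-1) ^ h.some.dim i
  else 0

end OMinimalStructure

/-! ### Compact Lie groups and the ring of isomorphism classes -/

/-- A topological group is a Lie group if it carries a (finite-dimensional, real) smooth manifold
structure, inducing the given topology, for which the group operations are smooth. -/
def IsLieGroup (G : Type u) [Group G] [TopologicalSpace G] : Prop :=
  ∃ (E : Type) (_ : NormedAddCommGroup E) (_ : NormedSpace ℝ E) (_ : FiniteDimensional ℝ E)
    (_ : ChartedSpace E G), LieGroup 𝓘(ℝ, E) ∞ G

theorem IsLieGroup.prod {G : Type u} {H : Type v} [Group G] [TopologicalSpace G] [Group H]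
    [TopologicalSpace H] (hG : IsLieGroup G) (hH : IsLieGroup H) : IsLieGroup (G × H) := by
  obtain ⟨E, _, _, _, _, _⟩ := hG
  obtain ⟨F, _, _, _, _, _⟩ := hH
  refine ⟨E × F, inferInstance, inferInstance, inferInstance, prodChartedSpace E G F H, ?_⟩
  rw [modelWithCornersSelf_prod]
  exact Prod.instLieGroup

theorem IsLieGroup.congr {G : Type u} {H : Type v} [Group G] [TopologicalSpace G] [Group H]
    [TopologicalSpace H] (e : G ≃ₜ* H) (hG : IsLieGroup G) : IsLieGroup H := by
  obtain ⟨E, _, _, _, cG, hL⟩ := hG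
  let f : OpenPartialHomeomorph H G := e.toHomeomorph.symm.toOpenPartialHomeomorph
  let cH : ChartedSpace E H :=
    { atlas := (fun c => f.trans c) '' atlas E G
      chartAt := fun y => f.trans (chartAt E (e.symm y))
      mem_chart_source := fun y => by simp [f]; exact mem_chart_source E (e.symm y)
      chart_mem_atlas := fun y => ⟨_, chart_mem_atlas E (e.symm y), rfl⟩ }
  have hchart : ∀ y : H, chartAt E y = f.trans (chartAt E (e.symm y)) := fun _ => rfl
  have : IsManifold 𝓘(ℝ, E) ∞ H := by
    refine isManifold_of_contDiffOn _ _ _ ?_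
    rintro _ _ ⟨c, hc, rfl⟩ ⟨c', hc', rfl⟩
    have h := (contDiffGroupoid ∞ 𝓘(ℝ, E)).compatible hc hc'
    have h2 := (mem_groupoid_of_pregroupoid.mp h).1
    refine (h2.congr ?_).mono ?_
    · intro x _; simp [f]
    · intro x; simp [f]
  have h1 : ContMDiff 𝓘(ℝ, E) 𝓘(ℝ, E) ∞ (fun y : H => e.symm y) := by
    intro y
    rw [contMDiffAt_iff]
    refine ⟨e.symm.continuous.continuousAt, ?_⟩
    refine (contDiffWithinAt_id (s := range 𝓘(ℝ, E))).congr_of_eventuallyEq_of_mem ?_ (by simp)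
    have : (chartAt E (e.symm y)).target ∈ 𝓝 (extChartAt 𝓘(ℝ, E) y y) := by
      apply (chartAt E (e.symm y)).open_target.mem_nhds
      simp [extChartAt, hchart, f]
      exact (chartAt E (e.symm y)).map_source (mem_chart_source E (e.symm y))
    refine Filter.Eventually.filter_mono nhdsWithin_le_nhds ?_
    filter_upwards [this] with x hx
    simp [extChartAt, hchart, f]
    exact (congrArg (chartAt E (e.symm y)) (e.symm_apply_apply _)).trans
      ((chartAt E (e.symm y)).right_inv hx)
  have h2 : ContMDiff 𝓘(ℝ, E) 𝓘(ℝ, E) ∞ (fun x : G => e x) := by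
    intro x
    rw [contMDiffAt_iff]
    refine ⟨e.continuous.continuousAt, ?_⟩
    refine (contDiffWithinAt_id (s := range 𝓘(ℝ, E))).congr_of_eventuallyEq_of_mem ?_ (by simp)
    have : (chartAt E x).target ∈ 𝓝 (extChartAt 𝓘(ℝ, E) x x) := by
      apply (chartAt E x).open_target.mem_nhds
      simp [extChartAt]
    refine Filter.Eventually.filter_mono nhdsWithin_le_nhds ?_
    filter_upwards [this] with z hz
    simp [extChartAt, hchart, f]
    exact (chartAt E x).right_inv hz
  refine ⟨E, inferInstance, inferInstance, inferInstance, cH, ?_⟩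
  refine { contMDiff_mul := ?_, contMDiff_inv := ?_ }
  · have := h2.comp ((contMDiff_mul 𝓘(ℝ, E) ∞ (G := G)).comp
      ((h1.comp contMDiff_fst).prodMk (h1.comp (contMDiff_snd (M := H)))))
    refine this.congr fun p => ?_
    simp
  · have := h2.comp ((contMDiff_inv 𝓘(ℝ, E) ∞ (G := G)).comp h1)
    refine this.congr fun p => ?_
    simp

theorem isLieGroup_punit : IsLieGroup PUnit.{u + 1} := by
  have h : IsLieGroup PUnit.{1} :=
    ⟨PUnit, inferInstance, inferInstance, inferInstance, inferInstance,
      { contMDiff_mul := contMDiff_const (c := PUnit.unit)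
        contMDiff_inv := contMDiff_const (c := PUnit.unit) }⟩
  exact h.congr
    { (MulEquiv.ofUnique : PUnit.{1} ≃* PUnit.{u + 1}) with
      continuous_toFun := continuous_const
      continuous_invFun := continuous_const }

/-- The product of two isomorphisms of topological groups. -/
def continuousMulEquivProd {G G' H H' : Type*} [Group G] [Group G'] [Group H] [Group H']
    [TopologicalSpace G] [TopologicalSpace G'] [TopologicalSpace H] [TopologicalSpace H']
    (e : G ≃ₜ* G') (f : H ≃ₜ* H') : G × H ≃ₜ* G' × H' :=
  { MulEquiv.prodCongr e.toMulEquiv f.toMulEquiv with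
    continuous_toFun := (e.continuous.comp continuous_fst).prodMk
      (f.continuous.comp continuous_snd)
    continuous_invFun := (e.symm.continuous.comp continuous_fst).prodMk
      (f.symm.continuous.comp continuous_snd) }

/-- A compact Lie group. -/
structure CompactLieGrp : Type (u + 1) where
  carrier : Type u
  [group : Group carrier]
  [top : TopologicalSpace carrier]
  [topGroup : IsTopologicalGroup carrier]
  [t2 : T2Space carrier]
  [compact : CompactSpace carrier]
  lie : IsLieGroup carrier

attribute [instance] CompactLieGrp.group CompactLieGrp.top CompactLieGrp.topGroup
  CompactLieGrp.t2 CompactLieGrp.compact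

namespace CompactLieGrp

/-- The product of compact Lie groups. -/
def prod (G H : CompactLieGrp.{u}) : CompactLieGrp.{u} where
  carrier := G.carrier × H.carrier
  lie := G.lie.prod H.lie

/-- The trivial group. -/
def trivial : CompactLieGrp.{u} where
  carrier := PUnit.{u + 1}
  lie := isLieGroup_punit

/-- Isomorphism as topological groups. -/
instance setoid : Setoid CompactLieGrp.{u} where
  r G H := Nonempty (G.carrier ≃ₜ* H.carrier)
  iseqv := ⟨fun _ => ⟨ContinuousMulEquiv.refl _⟩, fun ⟨e⟩ => ⟨e.symm⟩,
    fun ⟨e⟩ ⟨f⟩ => ⟨e.trans f⟩⟩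

end CompactLieGrp

/-- The isomorphism classes `[G]` of compact Lie groups. -/
def LieClass : Type (u + 1) := Quotient CompactLieGrp.setoid.{u}

namespace LieClass

/-- The class `[G × H]`. -/
def prod : LieClass.{u} → LieClass.{u} → LieClass.{u} :=
  Quotient.map₂ CompactLieGrp.prod fun _ _ ⟨e⟩ _ _ ⟨f⟩ =>
    ⟨continuousMulEquivProd e f⟩

/-- The class of the trivial group. -/
def trivial : LieClass.{u} := Quotient.mk _ CompactLieGrp.trivial

end LieClass

/-- The ideal of `ℤ[T^[G] : [G]]` generated by the polynomials `T^[G] T^[H] - T^[G × H]` and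
`T^[e] - 1`. -/
noncomputable def univIdeal : Ideal (MvPolynomial LieClass.{u} ℤ) :=
  Ideal.span ({p | ∃ c d : LieClass.{u}, p = MvPolynomial.X c * MvPolynomial.X d -
    MvPolynomial.X (c.prod d)} ∪ {MvPolynomial.X LieClass.trivial - 1})

/-- The ring `𝓡` of integer polynomials in the variables `T^[G]` modulo
`T^[G] T^[H] = T^[G × H]` and `T^[e] = 1`. -/
abbrev UnivRing : Type (u + 1) := MvPolynomial LieClass.{u} ℤ ⧸ univIdeal.{u}

/-- The class of the variable `T^[G]` in `𝓡`. -/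
noncomputable def univT (c : LieClass.{u}) : UnivRing.{u} :=
  Ideal.Quotient.mk univIdeal (MvPolynomial.X c)

/-! ### Topological groupoids -/

/-- A topological groupoid with Hausdorff spaces of objects and arrows. The product `mul g h` is
defined when `src g = tgt h`. -/
structure TopGroupoid : Type (u + 1) where
  Obj : Type u
  Arr : Type u
  [topObj : TopologicalSpace Obj]
  [topArr : TopologicalSpace Arr]
  [t2Obj : T2Space Obj]
  [t2Arr : T2Space Arr]
  src : Arr → Obj
  tgt : Arr → Obj
  unit : Obj → Arr
  inv : Arr → Arr
  mul : (g h : Arr) → src g = tgt h → Arr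
  continuous_src : Continuous src
  continuous_tgt : Continuous tgt
  continuous_unit : Continuous unit
  continuous_inv : Continuous inv
  continuous_mul : Continuous fun p : {p : Arr × Arr // src p.1 = tgt p.2} => mul p.1.1 p.1.2 p.2
  src_unit : ∀ x, src (unit x) = x
  tgt_unit : ∀ x, tgt (unit x) = x
  src_inv : ∀ g, src (inv g) = tgt g
  tgt_inv : ∀ g, tgt (inv g) = src g
  src_mul : ∀ g h e, src (mul g h e) = src h
  tgt_mul : ∀ g h e, tgt (mul g h e) = tgt g
  assoc : ∀ g h k (e : src g = tgt h) (e' : src h = tgt k),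
    mul (mul g h e) k ((src_mul g h e).trans e') = mul g (mul h k e') (e.trans (tgt_mul h k e').symm)
  unit_mul : ∀ g, mul (unit (tgt g)) g (src_unit _) = g
  mul_unit : ∀ g, mul g (unit (src g)) (tgt_unit _).symm = g
  mul_inv : ∀ g, mul g (inv g) (tgt_inv g).symm = unit (tgt g)
  inv_mul : ∀ g, mul (inv g) g (src_inv g) = unit (src g)

attribute [instance] TopGroupoid.topObj TopGroupoid.topArr TopGroupoid.t2Obj TopGroupoid.t2Arr

namespace TopGroupoid

theorem mul_congr (G : TopGroupoid.{u}) {g g' h h' : G.Arr} (hg : g = g') (hh : h = h')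
    (e : G.src g = G.tgt h) (e' : G.src g' = G.tgt h') : G.mul g h e = G.mul g' h' e' := by
  subst hg; subst hh; rfl

/-- Two objects are related if an arrow joins them. -/
def orbitSetoid (G : TopGroupoid.{u}) : Setoid G.Obj where
  r x y := ∃ g, G.src g = x ∧ G.tgt g = y
  iseqv :=
    { refl := fun x => ⟨G.unit x, G.src_unit x, G.tgt_unit x⟩
      symm := by
        rintro _ _ ⟨g, rfl, rfl⟩
        exact ⟨G.inv g, G.src_inv g, G.tgt_inv g⟩
      trans := by
        rintro _ _ _ ⟨g, rfl, rfl⟩ ⟨h, hh, rfl⟩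
        exact ⟨G.mul h g hh, G.src_mul _ _ _, G.tgt_mul _ _ _⟩ }

/-- The orbit space `|G|`, with the quotient topology. -/
def OrbitSpace (G : TopGroupoid.{u}) : Type u := Quotient G.orbitSetoid

instance (G : TopGroupoid.{u}) : TopologicalSpace G.OrbitSpace :=
  inferInstanceAs (TopologicalSpace (Quotient G.orbitSetoid))

/-- The orbit map. -/
def orbitMap (G : TopGroupoid.{u}) : G.Obj → G.OrbitSpace := Quotient.mk G.orbitSetoid

theorem isQuotientMap_orbitMap (G : TopGroupoid.{u}) : IsQuotientMap G.orbitMap :=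
  isQuotientMap_quot_mk

theorem orbitMap_eq_iff (G : TopGroupoid.{u}) {x y : G.Obj} :
    G.orbitMap x = G.orbitMap y ↔ ∃ g, G.src g = x ∧ G.tgt g = y :=
  Quotient.eq (r := G.orbitSetoid)

/-- The isotropy group of `x`. -/
def Isotropy (G : TopGroupoid.{u}) (x : G.Obj) : Type u := {g : G.Arr // G.src g = x ∧ G.tgt g = x}

instance (G : TopGroupoid.{u}) (x : G.Obj) : TopologicalSpace (G.Isotropy x) :=
  inferInstanceAs (TopologicalSpace {g : G.Arr // G.src g = x ∧ G.tgt g = x})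

instance (G : TopGroupoid.{u}) (x : G.Obj) : T2Space (G.Isotropy x) :=
  inferInstanceAs (T2Space {g : G.Arr // G.src g = x ∧ G.tgt g = x})

instance (G : TopGroupoid.{u}) (x : G.Obj) : Group (G.Isotropy x) where
  mul g h := ⟨G.mul g.1 h.1 (g.2.1.trans h.2.2.symm), (G.src_mul _ _ _).trans h.2.1,
    (G.tgt_mul _ _ _).trans g.2.2⟩
  one := ⟨G.unit x, G.src_unit x, G.tgt_unit x⟩
  inv g := ⟨G.inv g.1, (G.src_inv _).trans g.2.2, (G.tgt_inv _).trans g.2.1⟩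
  mul_assoc g h k := Subtype.ext (G.assoc _ _ _ _ _)
  one_mul g := Subtype.ext <|
    (G.mul_congr (congrArg G.unit g.2.2.symm) rfl _ _).trans (G.unit_mul g.1)
  mul_one g := Subtype.ext <|
    (G.mul_congr rfl (congrArg G.unit g.2.1.symm) _ _).trans (G.mul_unit g.1)
  inv_mul_cancel g := Subtype.ext <| (G.inv_mul g.1).trans (congrArg G.unit g.2.1)

instance (G : TopGroupoid.{u}) (x : G.Obj) : IsTopologicalGroup (G.Isotropy x) where
  continuous_mul := by
    refine Continuous.subtype_mk (f := fun p : G.Isotropy x × G.Isotropy x =>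
      G.mul p.1.1 p.2.1 (p.1.2.1.trans p.2.2.2.symm)) ?_ _
    exact G.continuous_mul.comp (Continuous.subtype_mk
      ((continuous_subtype_val.comp continuous_fst).prodMk
        (continuous_subtype_val.comp continuous_snd))
      fun p => p.1.2.1.trans p.2.2.2.symm)
  continuous_inv := (G.continuous_inv.comp continuous_subtype_val).subtype_mk _

/-- The restriction `G|A` of a groupoid to a set `A` of objects. -/
def restrict (G : TopGroupoid.{u}) (A : Set G.Obj) : TopGroupoid.{u} where
  Obj := A
  Arr := {g : G.Arr // G.src g ∈ A ∧ G.tgt g ∈ A}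
  src g := ⟨G.src g.1, g.2.1⟩
  tgt g := ⟨G.tgt g.1, g.2.2⟩
  unit x := ⟨G.unit x.1, (G.src_unit x.1).symm ▸ x.2, (G.tgt_unit x.1).symm ▸ x.2⟩
  inv g := ⟨G.inv g.1, (G.src_inv g.1).symm ▸ g.2.2, (G.tgt_inv g.1).symm ▸ g.2.1⟩
  mul g h e := ⟨G.mul g.1 h.1 (congrArg Subtype.val e), (G.src_mul _ _ _).symm ▸ h.2.1,
    (G.tgt_mul _ _ _).symm ▸ g.2.2⟩
  continuous_src := (G.continuous_src.comp continuous_subtype_val).subtype_mk _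
  continuous_tgt := (G.continuous_tgt.comp continuous_subtype_val).subtype_mk _
  continuous_unit := (G.continuous_unit.comp continuous_subtype_val).subtype_mk _
  continuous_inv := (G.continuous_inv.comp continuous_subtype_val).subtype_mk _
  continuous_mul := by
    refine Continuous.subtype_mk ?_ _
    exact G.continuous_mul.comp (Continuous.subtype_mk
      ((continuous_subtype_val.comp (continuous_fst.comp continuous_subtype_val)).prodMk
        (continuous_subtype_val.comp (continuous_snd.comp continuous_subtype_val)))
      fun p => congrArg Subtype.val p.2)
  src_unit x := Subtype.ext (G.src_unit x.1)
  tgt_unit x := Subtype.ext (G.tgt_unit x.1)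
  src_inv g := Subtype.ext (G.src_inv g.1)
  tgt_inv g := Subtype.ext (G.tgt_inv g.1)
  src_mul g h e := Subtype.ext (G.src_mul g.1 h.1 _)
  tgt_mul g h e := Subtype.ext (G.tgt_mul g.1 h.1 _)
  assoc g h k e e' := Subtype.ext (G.assoc g.1 h.1 k.1 _ _)
  unit_mul g := Subtype.ext (G.unit_mul g.1)
  mul_unit g := Subtype.ext (G.mul_unit g.1)
  mul_inv g := Subtype.ext (G.mul_inv g.1)
  inv_mul g := Subtype.ext (G.inv_mul g.1)

/-- The product groupoid. -/
def prod (G H : TopGroupoid.{u}) : TopGroupoid.{u} where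
  Obj := G.Obj × H.Obj
  Arr := G.Arr × H.Arr
  src g := (G.src g.1, H.src g.2)
  tgt g := (G.tgt g.1, H.tgt g.2)
  unit x := (G.unit x.1, H.unit x.2)
  inv g := (G.inv g.1, H.inv g.2)
  mul g h e := (G.mul g.1 h.1 (congrArg Prod.fst e), H.mul g.2 h.2 (congrArg Prod.snd e))
  continuous_src := G.continuous_src.prodMap H.continuous_src
  continuous_tgt := G.continuous_tgt.prodMap H.continuous_tgt
  continuous_unit := G.continuous_unit.prodMap H.continuous_unit
  continuous_inv := G.continuous_inv.prodMap H.continuous_inv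
  continuous_mul := by
    refine Continuous.prodMk ?_ ?_
    · exact G.continuous_mul.comp (Continuous.subtype_mk
        ((continuous_fst.comp (continuous_fst.comp continuous_subtype_val)).prodMk
          (continuous_fst.comp (continuous_snd.comp continuous_subtype_val)))
        fun p => congrArg (Prod.fst : G.Obj × H.Obj → G.Obj) p.2)
    · exact H.continuous_mul.comp (Continuous.subtype_mk
        ((continuous_snd.comp (continuous_fst.comp continuous_subtype_val)).prodMk
          (continuous_snd.comp (continuous_snd.comp continuous_subtype_val)))
        fun p => congrArg (Prod.snd : G.Obj × H.Obj → H.Obj) p.2)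
  src_unit x := Prod.ext (G.src_unit _) (H.src_unit _)
  tgt_unit x := Prod.ext (G.tgt_unit _) (H.tgt_unit _)
  src_inv g := Prod.ext (G.src_inv _) (H.src_inv _)
  tgt_inv g := Prod.ext (G.tgt_inv _) (H.tgt_inv _)
  src_mul g h e := Prod.ext (G.src_mul _ _ _) (H.src_mul _ _ _)
  tgt_mul g h e := Prod.ext (G.tgt_mul _ _ _) (H.tgt_mul _ _ _)
  assoc g h k e e' := Prod.ext (G.assoc _ _ _ _ _) (H.assoc _ _ _ _ _)
  unit_mul g := Prod.ext (G.unit_mul _) (H.unit_mul _)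
  mul_unit g := Prod.ext (G.mul_unit _) (H.mul_unit _)
  mul_inv g := Prod.ext (G.mul_inv _) (H.mul_inv _)
  inv_mul g := Prod.ext (G.inv_mul _) (H.inv_mul _)

/-- The translation groupoid `K ⋉ X` of the trivial action of a topological group `K` on a
space `X`. -/
def trivialAction (K X : Type u) [Group K] [TopologicalSpace K] [IsTopologicalGroup K] [T2Space K]
    [TopologicalSpace X] [T2Space X] : TopGroupoid.{u} where
  Obj := X
  Arr := K × X
  src g := g.2
  tgt g := g.2
  unit x := (1, x)
  inv g := (g.1⁻¹, g.2)
  mul g h _ := (g.1 * h.1, h.2)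
  continuous_src := continuous_snd
  continuous_tgt := continuous_snd
  continuous_unit := by fun_prop
  continuous_inv := by fun_prop
  continuous_mul := by fun_prop
  src_unit _ := rfl
  tgt_unit _ := rfl
  src_inv _ := rfl
  tgt_inv _ := rfl
  src_mul _ _ _ := rfl
  tgt_mul _ _ e := e.symm
  assoc _ _ _ _ _ := Prod.ext (mul_assoc _ _ _) rfl
  unit_mul _ := Prod.ext (one_mul _) rfl
  mul_unit _ := Prod.ext (mul_one _) rfl
  mul_inv _ := Prod.ext (mul_inv_cancel _) rfl
  inv_mul _ := Prod.ext (inv_mul_cancel _) rfl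

/-! ### Morita equivalence -/

/-- Homomorphisms of topological groupoids. -/
structure Hom (G H : TopGroupoid.{u}) where
  obj : G.Obj → H.Obj
  arr : G.Arr → H.Arr
  continuous_obj : Continuous obj
  continuous_arr : Continuous arr
  map_src : ∀ g, H.src (arr g) = obj (G.src g)
  map_tgt : ∀ g, H.tgt (arr g) = obj (G.tgt g)
  map_unit : ∀ x, arr (G.unit x) = H.unit (obj x)
  map_inv : ∀ g, arr (G.inv g) = H.inv (arr g)
  map_mul : ∀ g h (e : G.src g = G.tgt h), arr (G.mul g h e) =
    H.mul (arr g) (arr h) ((map_src g).trans ((congrArg obj e).trans (map_tgt h).symm))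

/-- Topological essential equivalences: the map `(h, x) ↦ tgt h` from the fibred product of `H.Arr`
and `G.Obj` over `H.Obj` to `H.Obj` admits local sections near every point (so it is surjective),
and the space of arrows of `G` is the fibred product of `G.Obj × G.Obj` and `H.Arr` over
`H.Obj × H.Obj`. -/
structure Hom.IsEssentialEquiv {G H : TopGroupoid.{u}} (Φ : Hom G H) : Prop where
  local_sections : ∀ y : H.Obj, ∃ U : Set H.Obj, IsOpen U ∧ y ∈ U ∧
    ∃ σ : U → {p : H.Arr × G.Obj // H.src p.1 = Φ.obj p.2},
      Continuous σ ∧ ∀ z : U, H.tgt (σ z).1.1 = z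
  isEmbedding : IsEmbedding fun g : G.Arr => ((G.src g, G.tgt g), Φ.arr g)
  range_eq : (range fun g : G.Arr => ((G.src g, G.tgt g), Φ.arr g)) =
    {p | H.src p.2 = Φ.obj p.1.1 ∧ H.tgt p.2 = Φ.obj p.1.2}

/-- Topological Morita equivalence. -/
def MoritaEquiv (G H : TopGroupoid.{u}) : Prop :=
  ∃ (K : TopGroupoid.{u}) (Φ : Hom K G) (Ψ : Hom K H), Φ.IsEssentialEquiv ∧ Ψ.IsEssentialEquiv

end TopGroupoid

/-! ### Orbit space definable groupoids -/

/-- An orbit space definable groupoid: a topological groupoid with a topological embedding of its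
orbit space onto a definable subset of some `ℝⁿ`, whose isotropy groups are compact Lie groups, and
such that the partition into points with isomorphic isotropy groups is finite and induces a
partition of the orbit space into definable sets. -/
structure OrbitDefGroupoid (S : OMinimalStructure) : Type (u + 1) extends TopGroupoid.{u} where
  dim : ℕ
  emb : toTopGroupoid.OrbitSpace → Fin dim → ℝ
  isEmbedding_emb : IsEmbedding emb
  isDef_range : S.IsDef (range emb)
  compact_isotropy : ∀ x, CompactSpace (toTopGroupoid.Isotropy x)
  lie_isotropy : ∀ x, IsLieGroup (toTopGroupoid.Isotropy x)
  finite_types : ∃ F : Set Obj, F.Finite ∧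
    ∀ x, ∃ y ∈ F, Nonempty (toTopGroupoid.Isotropy x ≃ₜ* toTopGroupoid.Isotropy y)
  isDef_type : ∀ x, S.IsDef (emb '' (toTopGroupoid.orbitMap ''
    {y | Nonempty (toTopGroupoid.Isotropy y ≃ₜ* toTopGroupoid.Isotropy x)}))

namespace TopGroupoid

/-- Passing to a restriction does not change isotropy groups. -/
def restrictIsotropy (G : TopGroupoid.{u}) (A : Set G.Obj) (x : (G.restrict A).Obj) :
    (G.restrict A).Isotropy x ≃ₜ* G.Isotropy x.1 where
  toFun g := ⟨g.1.1, congrArg Subtype.val g.2.1, congrArg Subtype.val g.2.2⟩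
  invFun g := ⟨⟨g.1, g.2.1.symm ▸ x.2, g.2.2.symm ▸ x.2⟩, Subtype.ext g.2.1, Subtype.ext g.2.2⟩
  left_inv _ := rfl
  right_inv _ := rfl
  map_mul' _ _ := rfl
  continuous_toFun := by
    refine Continuous.subtype_mk (f := fun g : (G.restrict A).Isotropy x => g.1.1) ?_ _
    exact continuous_subtype_val.comp (continuous_subtype_val (p := fun g : (G.restrict A).Arr =>
      (G.restrict A).src g = x ∧ (G.restrict A).tgt g = x))
  continuous_invFun := by
    refine Continuous.subtype_mk (p := fun g : (G.restrict A).Arr =>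
      (G.restrict A).src g = x ∧ (G.restrict A).tgt g = x) ?_ _
    exact Continuous.subtype_mk continuous_subtype_val _

/-- The isotropy groups of a product groupoid are the products of isotropy groups. -/
def prodIsotropy (G H : TopGroupoid.{u}) (x : (G.prod H).Obj) :
    (G.prod H).Isotropy x ≃ₜ* G.Isotropy x.1 × H.Isotropy x.2 where
  toFun g := (⟨g.1.1, congrArg Prod.fst g.2.1, congrArg Prod.fst g.2.2⟩,
    ⟨g.1.2, congrArg Prod.snd g.2.1, congrArg Prod.snd g.2.2⟩)
  invFun g := ⟨(g.1.1, g.2.1), Prod.ext g.1.2.1 g.2.2.1, Prod.ext g.1.2.2 g.2.2.2⟩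
  left_inv _ := rfl
  right_inv _ := rfl
  map_mul' _ _ := rfl
  continuous_toFun := by
    have h := continuous_subtype_val (p := fun g : (G.prod H).Arr =>
      (G.prod H).src g = x ∧ (G.prod H).tgt g = x)
    exact ((continuous_fst.comp h).subtype_mk _).prodMk ((continuous_snd.comp h).subtype_mk _)
  continuous_invFun := by
    refine Continuous.subtype_mk (p := fun g : (G.prod H).Arr =>
      (G.prod H).src g = x ∧ (G.prod H).tgt g = x) ?_ _
    exact (continuous_subtype_val.comp continuous_fst).prodMk
      (continuous_subtype_val.comp continuous_snd)

/-- The inclusion of the orbit space of `G|π⁻¹(Y)` into that of `G`. -/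
def restrictOrbit (G : TopGroupoid.{u}) (Y : Set G.OrbitSpace) :
    (G.restrict (G.orbitMap ⁻¹' Y)).OrbitSpace → G.OrbitSpace :=
  Quotient.lift (fun x => G.orbitMap x.1) fun _ _ ⟨g, hg, hg'⟩ =>
    G.orbitMap_eq_iff.2 ⟨g.1, congrArg Subtype.val hg, congrArg Subtype.val hg'⟩

theorem restrictOrbit_mk (G : TopGroupoid.{u}) (Y : Set G.OrbitSpace)
    (x : (G.restrict (G.orbitMap ⁻¹' Y)).Obj) :
    G.restrictOrbit Y ((G.restrict (G.orbitMap ⁻¹' Y)).orbitMap x) = G.orbitMap x.1 := rfl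

theorem surjective_orbitMap (G : TopGroupoid.{u}) : Function.Surjective G.orbitMap :=
  Quotient.mk_surjective

theorem range_restrictOrbit (G : TopGroupoid.{u}) (Y : Set G.OrbitSpace) :
    range (G.restrictOrbit Y) = Y := by
  ext y
  constructor
  · rintro ⟨z, rfl⟩
    obtain ⟨x, rfl⟩ := surjective_orbitMap _ z
    exact x.2
  · intro hy
    obtain ⟨x, rfl⟩ := surjective_orbitMap _ y
    exact ⟨(G.restrict (G.orbitMap ⁻¹' Y)).orbitMap ⟨x, hy⟩, rfl⟩

theorem injective_restrictOrbit (G : TopGroupoid.{u}) (Y : Set G.OrbitSpace) :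
    Function.Injective (G.restrictOrbit Y) := by
  intro a b h
  obtain ⟨x, rfl⟩ := surjective_orbitMap _ a
  obtain ⟨y, rfl⟩ := surjective_orbitMap _ b
  obtain ⟨g, hg, hg'⟩ := G.orbitMap_eq_iff.1 h
  exact (orbitMap_eq_iff _).2
    ⟨⟨g, by rw [hg]; exact x.2, by rw [hg']; exact y.2⟩, Subtype.ext hg, Subtype.ext hg'⟩

/-- If the orbit space is Hausdorff and first countable, then `|G|π⁻¹(Y)|` carries the subspace
topology of `Y ⊆ |G|`. -/
theorem isEmbedding_restrictOrbit (G : TopGroupoid.{u}) [T2Space G.OrbitSpace]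
    [FirstCountableTopology G.OrbitSpace] (Y : Set G.OrbitSpace) :
    IsEmbedding (G.restrictOrbit Y) := by
  have hcont : Continuous (G.restrictOrbit Y) :=
    Continuous.quotient_lift
      (G.isQuotientMap_orbitMap.continuous.comp continuous_subtype_val) _
  refine ⟨⟨le_antisymm hcont.le_induced ?_⟩, G.injective_restrictOrbit Y⟩
  intro W hW
  set j := G.restrictOrbit Y with hj
  set p := (G.restrict (G.orbitMap ⁻¹' Y)).orbitMap with hp
  refine isOpen_induced_iff.2 ⟨(closure (j '' Wᶜ))ᶜ, isClosed_closure.isOpen_compl, ?_⟩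
  ext a
  constructor
  · intro ha
    by_contra haW
    exact ha (subset_closure ⟨a, haW, rfl⟩)
  · intro ha hcl
    obtain ⟨y, hyW, hy⟩ := mem_closure_iff_seq_limit.1 hcl
    have hne : j a ∉ range y := by
      rintro ⟨n, hn⟩
      obtain ⟨z, hz, hz'⟩ := hyW n
      exact hz (G.injective_restrictOrbit Y (hz'.trans hn) ▸ ha)
    have hclosed : IsClosed (insert (j a) (range y)) := hy.isCompact_insert_range.isClosed
    have hnot : ¬ IsClosed (G.orbitMap ⁻¹' range y) := by
      intro h
      have h2 : IsClosed (range y) := G.isQuotientMap_orbitMap.isClosed_preimage.1 h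
      exact hne (h2.mem_of_tendsto hy (Filter.Eventually.of_forall fun n => ⟨n, rfl⟩))
    obtain ⟨x, hx, hxn⟩ : ∃ x ∈ closure (G.orbitMap ⁻¹' range y), x ∉ G.orbitMap ⁻¹' range y := by
      by_contra hcon
      push Not at hcon
      exact hnot (isClosed_of_closure_subset hcon)
    have hxa : G.orbitMap x = j a := by
      have hmem : x ∈ G.orbitMap ⁻¹' insert (j a) (range y) :=
        closure_minimal (preimage_mono (subset_insert _ _))
          (hclosed.preimage G.isQuotientMap_orbitMap.continuous) hx
      exact hmem.resolve_right hxn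
    have hYx : G.orbitMap x ∈ Y := by
      rw [hxa, ← G.range_restrictOrbit Y]
      exact ⟨a, rfl⟩
    have hWo : IsOpen (p ⁻¹' W) :=
      IsOpen.preimage (isQuotientMap_orbitMap _).continuous hW
    obtain ⟨O, hO, hOW⟩ := isOpen_induced_iff.1 hWo
    have hcls : ∀ (z : G.Obj) (hz : G.orbitMap z ∈ Y), p ⟨z, hz⟩ ∈ W ↔ z ∈ O := fun z hz => by
      have := Set.ext_iff.1 hOW ⟨z, hz⟩
      exact this.symm
    have hxO : x ∈ O := by
      refine (hcls x hYx).1 ?_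
      have : p ⟨x, hYx⟩ = a := G.injective_restrictOrbit Y hxa
      rw [this]
      exact ha
    obtain ⟨x', hx'O, n, hn⟩ := mem_closure_iff.1 hx O hO hxO
    obtain ⟨z, hz, hz'⟩ := hyW n
    have hYx' : G.orbitMap x' ∈ Y := by
      rw [← hn, ← hz', ← G.range_restrictOrbit Y]
      exact ⟨z, rfl⟩
    have hzz : p ⟨x', hYx'⟩ = z := G.injective_restrictOrbit Y (hn.symm.trans hz'.symm)
    exact hz (hzz ▸ (hcls x' hYx').2 hx'O)

end TopGroupoid

namespace OrbitDefGroupoid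

variable {S : OMinimalStructure}

/-- The isotropy group of an object as a compact Lie group. -/
def isotropyGrp (G : OrbitDefGroupoid.{u} S) (x : G.Obj) : CompactLieGrp.{u} :=
  haveI := G.compact_isotropy x
  { carrier := G.Isotropy x
    lie := G.lie_isotropy x }

/-- The isomorphism class of the isotropy group of an object. -/
def isoClass (G : OrbitDefGroupoid.{u} S) (x : G.Obj) : LieClass.{u} :=
  Quotient.mk _ (G.isotropyGrp x)

theorem isoClass_eq_iff (G : OrbitDefGroupoid.{u} S) {x y : G.Obj} :
    G.isoClass x = G.isoClass y ↔ Nonempty (G.Isotropy x ≃ₜ* G.Isotropy y) :=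
  Quotient.eq (r := CompactLieGrp.setoid)

theorem finite_range_isoClass (G : OrbitDefGroupoid.{u} S) : (range G.isoClass).Finite := by
  obtain ⟨F, hF, h⟩ := G.finite_types
  refine (hF.image G.isoClass).subset ?_
  rintro _ ⟨x, rfl⟩
  obtain ⟨y, hy, e⟩ := h x
  exact ⟨y, hy, (G.isoClass_eq_iff.2 e).symm⟩

/-- The weak orbit type `|G|_c`: the orbits of the points whose isotropy group has class `c`. -/
def orbitType (G : OrbitDefGroupoid.{u} S) (c : LieClass.{u}) : Set G.OrbitSpace :=
  G.orbitMap '' {x | G.isoClass x = c}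

/-- The universal Euler characteristic `∑ χ(|G|_c) T^c`; the sum runs over the finitely many
classes `c` of isotropy groups of `G`. -/
noncomputable def univEuler (G : OrbitDefGroupoid.{u} S) : UnivRing.{u} :=
  ∑ c ∈ G.finite_range_isoClass.toFinset, S.eulerChar (G.emb '' G.orbitType c) • univT c

theorem isDef_compl (G : OrbitDefGroupoid.{u} S) {Y : Set G.OrbitSpace} (hY : S.IsDef (G.emb '' Y)) :
    S.IsDef (G.emb '' Yᶜ) := by
  rw [image_compl_eq_range_sdiff_image G.isEmbedding_emb.injective]
  exact S.diff G.isDef_range hY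

/-- The restriction of `G` to the preimage of a definable subset `Y` of the orbit space, with the
restricted embedding. -/
def restrict (G : OrbitDefGroupoid.{u} S) (Y : Set G.OrbitSpace) (hY : S.IsDef (G.emb '' Y)) :
    OrbitDefGroupoid.{u} S where
  toTopGroupoid := G.toTopGroupoid.restrict (G.orbitMap ⁻¹' Y)
  dim := G.dim
  emb := G.emb ∘ G.restrictOrbit Y
  isEmbedding_emb :=
    haveI := G.isEmbedding_emb.t2Space
    haveI := G.isEmbedding_emb.isInducing.firstCountableTopology
    G.isEmbedding_emb.comp (G.isEmbedding_restrictOrbit Y)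
  isDef_range := by rwa [range_comp, G.range_restrictOrbit]
  compact_isotropy x :=
    haveI := G.compact_isotropy x.1
    (G.restrictIsotropy _ x).toHomeomorph.symm.compactSpace
  lie_isotropy x := (G.lie_isotropy x.1).congr (G.restrictIsotropy _ x).symm
  finite_types := by
    set f : (G.toTopGroupoid.restrict (G.orbitMap ⁻¹' Y)).Obj → LieClass.{u} :=
      fun x => G.isoClass x.1
    have hf : (range f).Finite := G.finite_range_isoClass.subset (by
      rintro _ ⟨x, rfl⟩
      exact ⟨x.1, rfl⟩)
    have : Finite (range f) := hf
    choose g hg using fun c : range f => c.2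
    refine ⟨range g, finite_range g, fun x => ⟨_, ⟨⟨f x, x, rfl⟩, rfl⟩, ?_⟩⟩
    obtain ⟨e⟩ := G.isoClass_eq_iff.1 (hg ⟨f x, x, rfl⟩).symm
    exact ⟨((G.restrictIsotropy _ x).trans e).trans (G.restrictIsotropy _ _).symm⟩
  isDef_type x := by
    have h := S.inter hY (G.isDef_type x.1)
    convert h using 1
    rw [← image_inter G.isEmbedding_emb.injective, image_comp]
    congr 1
    ext y
    constructor
    · rintro ⟨_, ⟨z, ⟨e⟩, rfl⟩, rfl⟩
      exact ⟨z.2, z.1, ⟨((G.restrictIsotropy _ z).symm.trans e).trans (G.restrictIsotropy _ x)⟩, rfl⟩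
    · rintro ⟨hy, z, ⟨e⟩, rfl⟩
      let w : (G.toTopGroupoid.restrict (G.orbitMap ⁻¹' Y)).Obj := ⟨z, hy⟩
      exact ⟨_, ⟨w, ⟨((G.restrictIsotropy _ w).trans e).trans
        (G.restrictIsotropy _ x).symm⟩, rfl⟩, rfl⟩

/-- The map `|G × H| → ℝᵐ⁺ⁿ` with components the embeddings of `|G|` and `|H|`. -/
def prodEmb (G H : OrbitDefGroupoid.{u} S) :
    (G.toTopGroupoid.prod H.toTopGroupoid).OrbitSpace → Fin (G.dim + H.dim) → ℝ :=
  Quotient.lift (fun x => Fin.append (G.emb (G.orbitMap x.1)) (H.emb (H.orbitMap x.2))) (by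
    rintro _ _ ⟨g, rfl, rfl⟩
    have h1 := G.orbitMap_eq_iff.2 ⟨g.1, rfl, rfl⟩
    have h2 := H.orbitMap_eq_iff.2 ⟨g.2, rfl, rfl⟩
    exact congrArg₂ Fin.append (congrArg G.emb h1) (congrArg H.emb h2))

theorem prodEmb_image (G H : OrbitDefGroupoid.{u} S) (A : Set G.Obj) (B : Set H.Obj) :
    G.prodEmb H '' ((G.toTopGroupoid.prod H.toTopGroupoid).orbitMap '' (A ×ˢ B)) =
      OMinimalStructure.prodSet (G.emb '' (G.orbitMap '' A)) (H.emb '' (H.orbitMap '' B)) := by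
  ext x
  constructor
  · rintro ⟨_, ⟨⟨a, b⟩, ⟨ha, hb⟩, rfl⟩, rfl⟩
    refine ⟨⟨_, ⟨a, ha, rfl⟩, ?_⟩, ⟨_, ⟨b, hb, rfl⟩, ?_⟩⟩
    · funext i
      exact (Fin.append_left _ _ i).symm
    · funext i
      exact (Fin.append_right _ _ i).symm
  · rintro ⟨⟨_, ⟨a, ha, rfl⟩, h1⟩, ⟨_, ⟨b, hb, rfl⟩, h2⟩⟩
    refine ⟨_, ⟨(a, b), ⟨ha, hb⟩, rfl⟩, ?_⟩
    change Fin.append _ _ = x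
    rw [h1, h2]
    exact Fin.append_castAdd_natAdd

/-- The product of orbit space definable groupoids with the product embedding. The hypothesis says
that the quotient topology of `|G × H|` is the product topology of `|G| × |H|`; it holds for
instance when the source maps are open. -/
def prod (G H : OrbitDefGroupoid.{u} S) (h : IsEmbedding (G.prodEmb H)) :
    OrbitDefGroupoid.{u} S where
  toTopGroupoid := G.toTopGroupoid.prod H.toTopGroupoid
  dim := G.dim + H.dim
  emb := G.prodEmb H
  isEmbedding_emb := h
  isDef_range := by
    have h1 : range (G.prodEmb H) = OMinimalStructure.prodSet (range G.emb) (range H.emb) := by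
      have h2 := G.prodEmb_image H univ univ
      rw [image_univ_of_surjective G.surjective_orbitMap,
        image_univ_of_surjective H.surjective_orbitMap, image_univ, image_univ] at h2
      rw [← h2, ← image_univ, ← image_univ_of_surjective (TopGroupoid.surjective_orbitMap _)]
      congr 2
      exact univ_prod_univ.symm
    rw [h1]
    exact S.isDef_prodSet G.isDef_range H.isDef_range
  compact_isotropy x :=
    haveI := G.compact_isotropy x.1
    haveI := H.compact_isotropy x.2
    (G.toTopGroupoid.prodIsotropy H.toTopGroupoid x).toHomeomorph.symm.compactSpace
  lie_isotropy x := ((G.lie_isotropy x.1).prod (H.lie_isotropy x.2)).congr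
    (G.toTopGroupoid.prodIsotropy H.toTopGroupoid x).symm
  finite_types := by
    obtain ⟨F, hF, hF'⟩ := G.finite_types
    obtain ⟨F₂, hF₂, hF₂'⟩ := H.finite_types
    refine ⟨F ×ˢ F₂, hF.prod hF₂, fun x => ?_⟩
    obtain ⟨y, hy, ⟨e⟩⟩ := hF' x.1
    obtain ⟨z, hz, ⟨f⟩⟩ := hF₂' x.2
    let w : (G.toTopGroupoid.prod H.toTopGroupoid).Obj := (y, z)
    exact ⟨w, ⟨hy, hz⟩, ⟨((G.toTopGroupoid.prodIsotropy H.toTopGroupoid x).trans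
      (continuousMulEquivProd e f)).trans
        (G.toTopGroupoid.prodIsotropy H.toTopGroupoid w).symm⟩⟩
  isDef_type x := by
    obtain ⟨F, hF, hF'⟩ := G.finite_types
    obtain ⟨F₂, hF₂, hF₂'⟩ := H.finite_types
    let P := G.toTopGroupoid.prod H.toTopGroupoid
    let s : Set P.Obj := {w | w ∈ F ×ˢ F₂ ∧ Nonempty (P.Isotropy w ≃ₜ* P.Isotropy x)}
    have hs : s.Finite := (hF.prod hF₂).subset fun w hw => hw.1
    have key : ∀ w w' : P.Obj, Nonempty (G.Isotropy w.1 ≃ₜ* G.Isotropy w'.1) →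
        Nonempty (H.Isotropy w.2 ≃ₜ* H.Isotropy w'.2) →
        Nonempty (P.Isotropy w ≃ₜ* P.Isotropy w') := by
      rintro w w' ⟨e⟩ ⟨f⟩
      exact ⟨((G.toTopGroupoid.prodIsotropy H.toTopGroupoid w).trans
        (continuousMulEquivProd e f)).trans
          (G.toTopGroupoid.prodIsotropy H.toTopGroupoid w').symm⟩
    have hset : G.prodEmb H '' (P.orbitMap '' {y | Nonempty (P.Isotropy y ≃ₜ* P.Isotropy x)}) =
        ⋃ w ∈ s, OMinimalStructure.prodSet
          (G.emb '' (G.orbitMap '' {a | Nonempty (G.Isotropy a ≃ₜ* G.Isotropy w.1)}))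
          (H.emb '' (H.orbitMap '' {b | Nonempty (H.Isotropy b ≃ₜ* H.Isotropy w.2)})) := by
      simp_rw [← G.prodEmb_image H]
      apply Subset.antisymm
      · rintro _ ⟨_, ⟨y, ⟨e⟩, rfl⟩, rfl⟩
        obtain ⟨a, ha, e1⟩ := hF' y.1
        obtain ⟨b, hb, e2⟩ := hF₂' y.2
        let w : P.Obj := (a, b)
        obtain ⟨f⟩ := key y w e1 e2
        have hw : w ∈ s := ⟨⟨ha, hb⟩, ⟨f.symm.trans e⟩⟩
        exact mem_biUnion hw ⟨_, ⟨y, ⟨e1, e2⟩, rfl⟩, rfl⟩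
      · refine iUnion₂_subset fun w hw => image_mono (image_mono ?_)
        rintro y ⟨e1, e2⟩
        obtain ⟨f⟩ := key y w e1 e2
        obtain ⟨e⟩ := hw.2
        exact ⟨f.trans e⟩
    refine hset ▸ S.biUnion hs fun w _ => S.isDef_prodSet (G.isDef_type w.1) (H.isDef_type w.2)

/-! ### Isotropy local triviality and invariants -/

/-- `G` is isotropy locally trivial: the orbit space has a cell decomposition subordinate to the
weak orbit types such that, for each cell `C`, the restriction of `G` to `π⁻¹(C)` is topologically
Morita equivalent to `K ⋉ C` with trivial action, where `K` is the isotropy group of a point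
over `C`. -/
def IsIsotropyLocallyTrivial (G : OrbitDefGroupoid.{u} S) : Prop :=
  haveI : T2Space G.OrbitSpace := G.isEmbedding_emb.t2Space
  ∃ D : S.CellDecomposition (range G.emb), ∀ (i : Fin D.card) (x : G.Obj),
    G.orbitMap x ∈ G.emb ⁻¹' D.cell i →
      G.emb ⁻¹' D.cell i ⊆ G.orbitType (G.isoClass x) ∧
      (G.toTopGroupoid.restrict (G.orbitMap ⁻¹' (G.emb ⁻¹' D.cell i))).MoritaEquiv
        (TopGroupoid.trivialAction (G.Isotropy x) (G.emb ⁻¹' D.cell i))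

variable {R : Type v}

/-- Topological invariants: Morita equivalent groupoids have the same value. -/
def IsTopInvariant (I : OrbitDefGroupoid.{u} S → R) : Prop :=
  ∀ G H : OrbitDefGroupoid.{u} S, G.MoritaEquiv H.toTopGroupoid → I G = I H

/-- Additivity on isotropy locally trivial groupoids, for decompositions of the orbit space into a
definable set and its complement. -/
def IsAdditiveOnILT [Add R] (I : OrbitDefGroupoid.{u} S → R) : Prop :=
  ∀ G : OrbitDefGroupoid.{u} S, G.IsIsotropyLocallyTrivial →
    ∀ (Y : Set G.OrbitSpace) (hY : S.IsDef (G.emb '' Y)),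
      I G = I (G.restrict Y hY) + I (G.restrict Yᶜ (G.isDef_compl hY))

/-- Multiplicativity on isotropy locally trivial groupoids, for all pairs whose product is orbit
space definable with the product embedding. -/
def IsMultiplicativeOnILT [Mul R] (I : OrbitDefGroupoid.{u} S → R) : Prop :=
  ∀ G H : OrbitDefGroupoid.{u} S, G.IsIsotropyLocallyTrivial → H.IsIsotropyLocallyTrivial →
    ∀ h : IsEmbedding (G.prodEmb H), I (G.prod H h) = I G * I H

/-- The value on the one-point groupoid (one object and one arrow) is `1`. -/
def IsNormalized [One R] (I : OrbitDefGroupoid.{u} S → R) : Prop :=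
  ∀ G : OrbitDefGroupoid.{u} S, Nonempty (Unique G.Arr) → I G = 1

end OrbitDefGroupoid

/-! An isotropy locally trivial groupoid is cut by its cells `C` into pieces Morita equivalent to `K
⋉ C`. A cell of dimension `d` is homeomorphic to `ℝᵈ`, so a topological invariant sees only `d` and
the class of `K` in such a piece. A hyperplane splits `ℝᵈ⁺¹` into a copy of `ℝᵈ` and two copies of
`ℝᵈ⁺¹`. Additivity therefore gives `a = b + 2a`, that is `a = -b`, for the values `a` on `K ⋉ ℝᵈ⁺¹`
and `b` on `K ⋉ ℝᵈ` (`trivialDef_univ_succ`). Hence `I G` is the sum of `(-1) ^ dim C` times the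
value on `K ⋉ pt` over the cells, and `G.univEuler` is the same sum with `T^[K]` in place of that
value (`exists_eq_sum_pointValue`).

The value on `K ⋉ pt` is multiplicative in `K` (`pointValue_mul`). The universal ring maps to the
monoid ring of the monoid of isomorphism classes with `T^[K]` going to `[K]`, so this multiplicative
function extends to a homomorphism `r` (`UnivRing.lift`). It is unique because the elements `T^[K]`
are universal Euler characteristics of groupoids `K ⋉ pt` and generate the ring additively
(`closure_range_univT`). Since `1 = T^[e]`, the homomorphism preserves the unit exactly when `I` is
`1` on the one-point groupoid.

Conversely, `r ∘ χᵘⁿ` has the required properties once isotropy local triviality passes to definable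
pieces and to products, and the universal Euler characteristic is additive and multiplicative on
isotropy locally trivial groupoids. This rests on two facts of o-minimal geometry, both proved here:
every definable set is a finite disjoint union of cells (`partCells_of_isDef`), and the alternating
sum over the cells does not depend on the partition (`eulerChar_iUnion`).

The cell decomposition uses Baire category over `ℝ` instead of the monotonicity theorem. A definable
set without interior is nowhere dense (`interiorOrNowhereDense`), so a definable function on an open
set is continuous off a meagre set. The frontiers of the fibres of a definable set form a definable
family of finite sets. This family varies continuously outside a definable set with empty interior;
the cells in that exceptional set have lower dimension and are handled by induction
(`partCells_trivialFamily`). Independence of the partition follows from a stronger linear statement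
about indicator functions of cells, proved fibre by fibre (`sum_eq_zero_of_isCell`). -/

/-! ### A calculus of definable predicates and maps -/

/-- A type identified with some `ℝⁿ` by coordinates. -/
class DefSpace (E : Type) where
  card : ℕ
  coord : E ≃ (Fin card → ℝ)

instance (n : ℕ) : DefSpace (Fin n → ℝ) := ⟨n, Equiv.refl _⟩

instance : DefSpace ℝ := ⟨1, (Equiv.funUnique (Fin 1) ℝ).symm⟩

instance (E F : Type) [DefSpace E] [DefSpace F] : DefSpace (E × F) :=
  ⟨DefSpace.card E + DefSpace.card F,
    (Equiv.prodCongr DefSpace.coord DefSpace.coord).trans (Fin.appendEquiv _ _)⟩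

namespace OMinimalStructure

variable (S : OMinimalStructure) {E F H : Type} [DefSpace E] [DefSpace F] [DefSpace H]

/-- Definable predicates on a space with coordinates. -/
def DefP (P : E → Prop) : Prop := S.IsDef {v | P (DefSpace.coord.symm v)}

/-- Maps with definable graph. -/
def DefMap (f : E → F) : Prop := S.DefP fun p : E × F => p.2 = f p.1

variable {S}

theorem DefP.congr {P Q : E → Prop} (h : S.DefP P) (hPQ : ∀ x, Q x ↔ P x) : S.DefP Q := by
  have : Q = P := funext fun x => propext (hPQ x)
  rwa [this]

theorem DefP.not {P : E → Prop} (h : S.DefP P) : S.DefP fun x => ¬ P x := S.compl h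

theorem DefP.or {P Q : E → Prop} (h : S.DefP P) (h' : S.DefP Q) : S.DefP fun x => P x ∨ Q x :=
  S.union h h'

theorem DefP.and {P Q : E → Prop} (h : S.DefP P) (h' : S.DefP Q) : S.DefP fun x => P x ∧ Q x :=
  S.inter h h'

theorem DefP.imp {P Q : E → Prop} (h : S.DefP P) (h' : S.DefP Q) : S.DefP fun x => P x → Q x :=
  (h.not.or h').congr fun _ => imp_iff_not_or

theorem DefP.iff {P Q : E → Prop} (h : S.DefP P) (h' : S.DefP Q) : S.DefP fun x => P x ↔ Q x :=
  ((h.imp h').and (h'.imp h)).congr fun _ => iff_def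

theorem defP_const (p : Prop) : S.DefP fun _ : E => p := by
  by_cases hp : p
  · have := S.compl (S.empty (DefSpace.card E))
    simpa [DefP, hp] using this
  · simpa [DefP, hp] using S.empty (DefSpace.card E)

theorem DefP.exists_finite {ι : Type} [Finite ι] {P : ι → E → Prop} (h : ∀ i, S.DefP (P i)) :
    S.DefP fun x => ∃ i, P i x := by
  have := S.biUnion (s := (univ : Set ι)) (Set.toFinite _)
    (A := fun i => {v | P i (DefSpace.coord.symm v)}) fun i _ => h i
  simpa [DefP, ofPred_exists] using this

theorem DefP.forall_finite {ι : Type} [Finite ι] {P : ι → E → Prop} (h : ∀ i, S.DefP (P i)) :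
    S.DefP fun x => ∀ i, P i x :=
  (DefP.exists_finite fun i => (h i).not).not.congr fun x => by simp

/-- Substitution of variables, for maps whose output coordinates are all input coordinates.
Substitution of arbitrary definable maps is derived from it with the help of quantifiers. -/
theorem DefP.reindex {P : F → Prop} (h : S.DefP P) (f : E → F)
    (σ : Fin (DefSpace.card F) → Fin (DefSpace.card E))
    (hσ : ∀ x j, DefSpace.coord (f x) j = DefSpace.coord x (σ j)) : S.DefP fun x => P (f x) := by
  have := S.reindex σ h
  refine (congrArg S.IsDef ?_).mp this
  ext v
  have h2 : DefSpace.coord.symm (fun i => v (σ i)) = f (DefSpace.coord.symm v) := by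
    rw [Equiv.symm_apply_eq]
    funext j
    rw [hσ, Equiv.apply_symm_apply]
  simp only [mem_ofPred_eq, h2]

/-- Coordinates are projected away one at a time from the end. This gives quantifiers over all of
`ℝⁿ`, hence first-order formulas as proofs of definability. -/
theorem isDef_exists_append {m n : ℕ} {A : Set (Fin (m + n) → ℝ)} (h : S.IsDef A) :
    S.IsDef {x : Fin m → ℝ | ∃ y : Fin n → ℝ, Fin.append x y ∈ A} := by
  induction n with
  | zero =>
    refine (congrArg S.IsDef ?_).mp h
    ext x
    have : ∀ y : Fin 0 → ℝ, Fin.append x y = x := fun y => by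
      rw [Subsingleton.elim y Fin.elim0]; exact Fin.append_elim0 x
    simp [this]
  | succ n ih =>
    refine (congrArg S.IsDef ?_).mp (ih (S.proj h))
    ext x
    constructor
    · rintro ⟨y, z, hz, hzy⟩
      refine ⟨Fin.snoc y (z (Fin.last _)), ?_⟩
      have : Fin.append x (Fin.snoc y (z (Fin.last _)) : Fin (n + 1) → ℝ) = z := by
        rw [Fin.append_snoc, ← hzy]
        exact Fin.snoc_init_self z
      rwa [this]
    · rintro ⟨y, hy⟩
      refine ⟨Fin.init y, _, hy, ?_⟩
      have h2 : Fin.append x y = Fin.snoc (Fin.append x (Fin.init y)) (y (Fin.last _)) := by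
        rw [← Fin.append_snoc, Fin.snoc_init_self]
      rw [h2]
      exact Fin.init_snoc _ _

theorem DefP.exists {P : E → F → Prop} (h : S.DefP fun p : E × F => P p.1 p.2) :
    S.DefP fun x => ∃ y, P x y := by
  refine (congrArg S.IsDef ?_).mp (isDef_exists_append h)
  ext v
  have key : ∀ w : Fin (DefSpace.card F) → ℝ,
      DefSpace.coord.symm (Fin.append v w : Fin (DefSpace.card (E × F)) → ℝ) =
        ((DefSpace.coord.symm v, DefSpace.coord.symm w) : E × F) := fun w => by
    rw [Equiv.symm_apply_eq]
    simp only [DefSpace.coord, Equiv.trans_apply, Equiv.prodCongr_apply, Prod.map,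
      Equiv.apply_symm_apply]
    rfl
  constructor
  · rintro ⟨w, hw⟩
    refine ⟨DefSpace.coord.symm w, ?_⟩
    have hw' : P (DefSpace.coord.symm (Fin.append v w : Fin (DefSpace.card (E × F)) → ℝ) : E × F).1
      (DefSpace.coord.symm (Fin.append v w : Fin (DefSpace.card (E × F)) → ℝ) : E × F).2 := hw
    rwa [key] at hw'
  · rintro ⟨y, hy⟩
    refine ⟨DefSpace.coord y, ?_⟩
    change P (DefSpace.coord.symm (Fin.append v _ : Fin (DefSpace.card (E × F)) → ℝ) : E × F).1
      (DefSpace.coord.symm (Fin.append v _ : Fin (DefSpace.card (E × F)) → ℝ) : E × F).2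
    rw [key]
    simpa using hy

theorem DefP.forall {P : E → F → Prop} (h : S.DefP fun p : E × F => P p.1 p.2) :
    S.DefP fun x => ∀ y, P x y :=
  (DefP.exists (P := fun x y => ¬ P x y) h.not).not.congr fun x => by simp

theorem coord_prod_castAdd (p : E × F) (i : Fin (DefSpace.card E)) :
    DefSpace.coord p (Fin.castAdd _ i) = DefSpace.coord p.1 i := by
  simp [DefSpace.coord]

theorem coord_prod_natAdd (p : E × F) (i : Fin (DefSpace.card F)) :
    DefSpace.coord p (Fin.natAdd _ i) = DefSpace.coord p.2 i := by
  simp [DefSpace.coord]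

theorem DefP.snd {P : F → Prop} (h : S.DefP P) : S.DefP fun p : E × F => P p.2 :=
  h.reindex Prod.snd _ fun p i => (coord_prod_natAdd p i).symm

/-- The condition at `f x` is rewritten as `∃ y, y = f x ∧ P y`. -/
theorem DefP.comp {P : F → Prop} (h : S.DefP P) {f : E → F} (hf : S.DefMap f) :
    S.DefP fun x => P (f x) :=
  (DefP.exists (P := fun x y => y = f x ∧ P y) (hf.and h.snd)).congr fun x => by simp

/-! ### Polynomial conditions and the algebra of definable maps. -/

theorem isDef_eval_lt {n : ℕ} (p q : MvPolynomial (Fin n) ℝ) :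
    S.DefP fun x : Fin n → ℝ => MvPolynomial.eval x p < MvPolynomial.eval x q := by
  have := S.semialgebraic (q - p)
  simp only [map_sub, sub_pos] at this
  exact this

theorem isDef_eval_eq {n : ℕ} (p q : MvPolynomial (Fin n) ℝ) :
    S.DefP fun x : Fin n → ℝ => MvPolynomial.eval x p = MvPolynomial.eval x q :=
  ((isDef_eval_lt p q).not.and (isDef_eval_lt q p).not).congr fun x => by
    rw [not_lt, not_lt]
    exact ⟨fun h => ⟨h.ge, h.le⟩, fun h => le_antisymm h.2 h.1⟩

theorem defMap_of_reindex (f : E → F) (σ : Fin (DefSpace.card F) → Fin (DefSpace.card E))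
    (hσ : ∀ x j, DefSpace.coord (f x) j = DefSpace.coord x (σ j)) : S.DefMap f := by
  have : S.DefP fun p : E × F => ∀ j, DefSpace.coord p.2 j = DefSpace.coord p.1 (σ j) := by
    refine DefP.forall_finite fun j => ?_
    have h := isDef_eval_eq (S := S) (MvPolynomial.X (0 : Fin 2)) (MvPolynomial.X 1)
    refine (h.reindex (fun p : E × F => ![DefSpace.coord p.2 j, DefSpace.coord p.1 (σ j)])
      ![Fin.natAdd _ j, Fin.castAdd _ (σ j)] ?_).congr ?_
    · intro p i
      fin_cases i
      · exact (coord_prod_natAdd p j).symm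
      · exact (coord_prod_castAdd p (σ j)).symm
    · intro p
      simp
  refine this.congr fun p => ?_
  simp only [← hσ, ← funext_iff]
  exact (DefSpace.coord.injective.eq_iff).symm

theorem defMap_id : S.DefMap fun x : E => x := defMap_of_reindex _ id fun _ _ => rfl

theorem defMap_fst : S.DefMap fun x : E × F => x.1 :=
  defMap_of_reindex _ _ fun p i => (coord_prod_castAdd p i).symm

theorem defMap_snd : S.DefMap fun x : E × F => x.2 :=
  defMap_of_reindex _ _ fun p i => (coord_prod_natAdd p i).symm

theorem defMap_apply {n : ℕ} (i : Fin n) : S.DefMap fun x : Fin n → ℝ => x i :=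
  defMap_of_reindex _ (fun _ => i) fun _ _ => rfl

theorem DefMap.comp {g : F → H} {f : E → F} (hg : S.DefMap g) (hf : S.DefMap f) :
    S.DefMap fun x => g (f x) := by
  -- Both graphs are pulled back to `(E × H) × F` by shuffling coordinates; the middle point in `F`
  -- is then quantified away.
  have h1 : S.DefP fun q : (E × H) × F => q.2 = f q.1.1 := by
    refine DefP.reindex hf (fun q : (E × H) × F => (q.1.1, q.2))
      (Fin.addCases (fun i => Fin.castAdd _ (Fin.castAdd _ i)) fun i => Fin.natAdd _ i) ?_
    intro x j
    refine Fin.addCases (fun i => ?_) (fun i => ?_) j <;>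
      simp [coord_prod_castAdd, coord_prod_natAdd]
  have h2 : S.DefP fun q : (E × H) × F => q.1.2 = g q.2 := by
    refine DefP.reindex hg (fun q : (E × H) × F => (q.2, q.1.2))
      (Fin.addCases (fun i => Fin.natAdd _ i) fun i => Fin.castAdd _ (Fin.natAdd _ i)) ?_
    intro x j
    refine Fin.addCases (fun i => ?_) (fun i => ?_) j <;>
      simp [coord_prod_castAdd, coord_prod_natAdd]
  exact (DefP.exists (P := fun (p : E × H) (y : F) => y = f p.1 ∧ p.2 = g y)
    (h1.and h2)).congr fun p => by simp

theorem DefMap.fst {f : E → F × H} (hf : S.DefMap f) : S.DefMap fun x => (f x).1 :=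
  defMap_fst.comp hf

theorem DefMap.snd {f : E → F × H} (hf : S.DefMap f) : S.DefMap fun x => (f x).2 :=
  defMap_snd.comp hf

theorem DefMap.apply {n : ℕ} {f : E → Fin n → ℝ} (hf : S.DefMap f) (i : Fin n) :
    S.DefMap fun x => f x i :=
  (defMap_apply i).comp hf

theorem DefMap.prodMk {f : E → F} {g : E → H} (hf : S.DefMap f) (hg : S.DefMap g) :
    S.DefMap fun x => (f x, g x) := by
  have h1 : S.DefP fun q : E × (F × H) => q.2.1 = f q.1 := by
    refine DefP.reindex hf (fun q : E × (F × H) => (q.1, q.2.1))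
      (Fin.addCases (fun i => Fin.castAdd _ i) fun i => Fin.natAdd _ (Fin.castAdd _ i)) ?_
    intro x j
    refine Fin.addCases (fun i => ?_) (fun i => ?_) j <;>
      simp [coord_prod_castAdd, coord_prod_natAdd]
  have h2 : S.DefP fun q : E × (F × H) => q.2.2 = g q.1 := by
    refine DefP.reindex hg (fun q : E × (F × H) => (q.1, q.2.2))
      (Fin.addCases (fun i => Fin.castAdd _ i) fun i => Fin.natAdd _ (Fin.natAdd _ i)) ?_
    intro x j
    refine Fin.addCases (fun i => ?_) (fun i => ?_) j <;>
      simp [coord_prod_castAdd, coord_prod_natAdd]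
  exact (h1.and h2).congr fun p => Prod.ext_iff

theorem DefP.eq {f g : E → F} (hf : S.DefMap f) (hg : S.DefMap g) :
    S.DefP fun x => f x = g x :=
  (DefP.comp (P := fun p : F × F => p.2 = p.1) defMap_id (hg.prodMk hf)).congr fun _ => Iff.rfl

theorem DefMap.pi {n : ℕ} {f : E → Fin n → ℝ} (hf : ∀ i, S.DefMap fun x => f x i) :
    S.DefMap f :=
  (DefP.forall_finite fun i => DefP.eq (defMap_snd.apply i) ((hf i).comp
    (defMap_fst (S := S) (E := E) (F := Fin n → ℝ)))).congr fun _ => funext_iff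

theorem defMap_const (c : ℝ) : S.DefMap fun _ : E => c := by
  have h := isDef_eval_eq (S := S) (MvPolynomial.X (0 : Fin 1)) (MvPolynomial.C c)
  refine (h.comp (f := fun p : E × ℝ => fun _ => p.2) (DefMap.pi fun _ => defMap_snd)).congr ?_
  intro p
  simp

theorem DefP.lt {f g : E → ℝ} (hf : S.DefMap f) (hg : S.DefMap g) :
    S.DefP fun x => f x < g x := by
  have h := isDef_eval_lt (S := S) (MvPolynomial.X (0 : Fin 2)) (MvPolynomial.X 1)
  refine (h.comp (f := fun x : E => ![f x, g x]) (DefMap.pi fun i => ?_)).congr ?_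
  · fin_cases i
    · exact hf
    · exact hg
  · intro p
    simp

theorem DefP.abs_sub_lt {f g h : E → ℝ} (hf : S.DefMap f) (hg : S.DefMap g) (hh : S.DefMap h) :
    S.DefP fun x => |f x - g x| < h x := by
  have key : ∀ {f g h : E → ℝ}, S.DefMap f → S.DefMap g → S.DefMap h →
      S.DefP fun x => f x - g x < h x := by
    intro f g h hf hg hh
    have h0 := isDef_eval_lt (S := S) (MvPolynomial.X (0 : Fin 3) - MvPolynomial.X 1)
      (MvPolynomial.X 2)
    refine (h0.comp (f := fun x : E => ![f x, g x, h x]) (DefMap.pi fun i => ?_)).congr ?_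
    · fin_cases i
      · exact hf
      · exact hg
      · exact hh
    · intro p
      simp
  refine ((key hf hg hh).and (key hg hf hh)).congr fun x => ?_
  rw [abs_sub_lt_iff]

/-- Points of `ℝⁿ` at distance less than `ε`. -/
theorem DefP.dist_lt {n : ℕ} {f g : E → Fin n → ℝ} {h : E → ℝ} (hf : S.DefMap f)
    (hg : S.DefMap g) (hh : S.DefMap h) : S.DefP fun x => 0 < h x ∧ dist (f x) (g x) < h x := by
  refine ((DefP.lt (defMap_const 0) hh).and (DefP.forall_finite fun i : Fin n =>
    DefP.abs_sub_lt (hf.apply i) (hg.apply i) hh)).congr fun x => ?_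
  refine and_congr_right fun h0 => ?_
  -- Positivity of the radius is needed: for `n = 0` the coordinatewise conditions are vacuous.
  rw [dist_pi_lt_iff h0]
  rfl

theorem DefP.isDef {n : ℕ} {A : Set (Fin n → ℝ)} {P : (Fin n → ℝ) → Prop} (h : S.DefP P)
    (hA : ∀ x, x ∈ A ↔ P x) : S.IsDef A := by
  have : A = {x | P x} := ext hA
  rw [this]
  exact h

end OMinimalStructure

/-! ### Definable sets are somewhere open or nowhere dense -/

/-- Points and intervals have only their end points in the frontier, and the frontier of a union of
two sets lies in the union of their frontiers. Nothing else about tame sets is used later. -/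
theorem IsTameSet.finite_frontier {A : Set ℝ} (h : IsTameSet A) : (frontier A).Finite := by
  obtain ⟨F, hF, hJ, rfl⟩ := h
  have h1 : ∀ J ∈ F, (frontier J).Finite := by
    intro J hJF
    rcases hJ J hJF with ⟨a, rfl⟩ | ⟨a, b, rfl⟩
    · exact (finite_singleton a).subset (isClosed_singleton.frontier_subset)
    · set J := {t : ℝ | a < (t : EReal) ∧ (t : EReal) < b} with hJdef
      have ho : IsOpen J :=
        (isOpen_Ioo (a := a) (b := b)).preimage continuous_coe_real_ereal
      have hc : closure J ⊆ {t : ℝ | a ≤ (t : EReal) ∧ (t : EReal) ≤ b} :=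
        closure_minimal (fun t ht => ⟨ht.1.le, ht.2.le⟩)
          ((isClosed_Icc (a := a) (b := b)).preimage continuous_coe_real_ereal)
      -- An infinite end point contributes the spurious value `0`, which is harmless in a finite
      -- superset.
      refine Set.Finite.subset (s := {a.toReal, b.toReal}) (by simp) ?_
      rw [ho.frontier_eq]
      rintro t ⟨ht, ht'⟩
      have h2 := hc ht
      by_cases h3 : a < t
      · have h4 : (t : EReal) = b := le_antisymm h2.2 (not_lt.1 fun h => ht' ⟨h3, h⟩)
        right
        simp [← h4]
      · have h4 : a = (t : EReal) := le_antisymm h2.1 (not_lt.1 h3)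
        left
        simp [h4]
  clear hJ
  induction F, hF using Set.Finite.induction_on with
  | empty => simp
  | insert _ _ ih =>
    rw [sUnion_insert]
    refine ((h1 _ (mem_insert _ _)).union (ih fun J hJ => h1 J (mem_insert_of_mem _ hJ))).subset ?_
    refine (frontier_union_subset _ _).trans (union_subset_union inter_subset_left ?_)
    exact inter_subset_right

/-- Append a last coordinate. -/
def snocR {n : ℕ} (y : Fin n → ℝ) (t : ℝ) : Fin (n + 1) → ℝ := Fin.snoc y t

@[simp] theorem snocR_last {n : ℕ} (y : Fin n → ℝ) (t : ℝ) : snocR y t (Fin.last n) = t := by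
  simp [snocR]

@[simp] theorem snocR_castSucc {n : ℕ} (y : Fin n → ℝ) (t : ℝ) (i : Fin n) :
    snocR y t i.castSucc = y i := by
  simp [snocR]

@[simp] theorem dropLast_snocR {n : ℕ} (y : Fin n → ℝ) (t : ℝ) : dropLast (snocR y t) = y := by
  funext i; simp [dropLast]

@[simp] theorem snocR_dropLast {n : ℕ} (x : Fin (n + 1) → ℝ) :
    snocR (dropLast x) (x (Fin.last n)) = x := by
  funext i
  refine Fin.lastCases ?_ (fun i => ?_) i
  · simp
  · simp [dropLast]

theorem continuous_dropLast {n : ℕ} : Continuous (dropLast (n := n)) :=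
  continuous_pi fun _ => continuous_apply _

theorem continuous_snocR {n : ℕ} : Continuous fun p : (Fin n → ℝ) × ℝ => snocR p.1 p.2 := by
  refine continuous_pi fun i => ?_
  refine Fin.lastCases ?_ (fun i => ?_) i
  · simpa using continuous_snd
  · simpa [Function.comp_def] using (continuous_apply i).comp (continuous_fst (X := Fin n → ℝ) (Y := ℝ))

namespace OMinimalStructure

variable {S : OMinimalStructure} {E F : Type} [DefSpace E] [DefSpace F]

theorem DefMap.snocR {n : ℕ} {f : E → Fin n → ℝ} {g : E → ℝ} (hf : S.DefMap f)
    (hg : S.DefMap g) : S.DefMap fun x => snocR (f x) (g x) :=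
  DefMap.pi fun i => by
    refine Fin.lastCases ?_ (fun i => ?_) i
    · simpa using hg
    · simpa using hf.apply i

theorem DefMap.dropLast {n : ℕ} {f : E → Fin (n + 1) → ℝ} (hf : S.DefMap f) :
    S.DefMap fun x => dropLast (f x) :=
  DefMap.pi fun i => hf.apply i.castSucc

theorem IsDef.comp {n : ℕ} {A : Set (Fin n → ℝ)} (hA : S.IsDef A) {f : E → Fin n → ℝ}
    (hf : S.DefMap f) : S.DefP fun x => f x ∈ A :=
  DefP.comp (P := (· ∈ A)) hA hf

theorem tame_of_defP {P : ℝ → Prop} (h : S.DefP P) : IsTameSet {t | P t} := by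
  have : S.DefP fun x : Fin 1 → ℝ => P (x 0) := h.comp (defMap_apply 0)
  exact S.tame this

/-- Being interior is a first-order condition, since balls of the sup metric are definable. -/
theorem isDef_interior {n : ℕ} {A : Set (Fin n → ℝ)} (hA : S.IsDef A) :
    S.IsDef (interior A) := by
  have h1 : S.DefP fun x : Fin n → ℝ => ∃ ε : ℝ, 0 < ε ∧
      ∀ y : Fin n → ℝ, (0 < ε ∧ dist y x < ε) → y ∈ A := by
    refine DefP.exists ((DefP.lt (defMap_const 0) defMap_snd).and (DefP.forall ?_))
    exact (DefP.dist_lt defMap_snd defMap_fst.fst defMap_fst.snd).imp (IsDef.comp hA defMap_snd)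
  refine h1.isDef fun x => ?_
  rw [mem_interior_iff_mem_nhds, Metric.mem_nhds_iff]
  refine exists_congr fun ε => and_congr_right fun h0 => ?_
  exact ⟨fun h y hy => h hy.2, fun h y hy => h y ⟨h0, hy⟩⟩

/-- Definable subsets of `ℝⁿ` without interior are nowhere dense. -/
def InteriorOrNowhereDense (S : OMinimalStructure) (n : ℕ) : Prop :=
  ∀ A : Set (Fin n → ℝ), S.IsDef A → interior A = ∅ → IsNowhereDense A

/-- Each `B i \ interior (B i)` is definable without interior, so nowhere dense, and countably many
such sets cannot cover a nonempty open set. In this way a countable case distinction can be made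
constant on an open set. -/
theorem InteriorOrNowhereDense.exists_interior {n : ℕ} (hS : S.InteriorOrNowhereDense n)
    {ι : Type} [Countable ι] {B : ι → Set (Fin n → ℝ)} (hB : ∀ i, S.IsDef (B i))
    {V : Set (Fin n → ℝ)} (hV : IsOpen V) (hne : V.Nonempty) (hVB : V ⊆ ⋃ i, B i) :
    ∃ i, (V ∩ interior (B i)).Nonempty := by
  by_contra! hcon
  have h1 : ∀ i, IsNowhereDense (B i \ interior (B i)) := fun i => by
    refine hS _ (S.diff (hB i) (isDef_interior (hB i))) ?_
    by_contra h
    obtain ⟨x, hx⟩ := nonempty_iff_ne_empty.2 h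
    have h2 : x ∈ interior (B i) := interior_mono sdiff_subset hx
    exact (interior_subset hx).2 h2
  have h2 : IsMeagre (⋃ i, B i \ interior (B i)) := isMeagre_iUnion fun i => (h1 i).isMeagre
  refine not_isMeagre_of_isOpen hV hne (h2.mono fun x hx => ?_)
  obtain ⟨i, hi⟩ := mem_iUnion.1 (hVB hx)
  refine mem_iUnion.2 ⟨i, hi, fun h => ?_⟩
  have := hcon i
  exact (this ▸ (⟨hx, h⟩ : x ∈ V ∩ interior (B i)) : x ∈ (∅ : Set _))

/-- The interval is infinite, so it has a point off the frontier, near which `T` is everything or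
nothing. Rational end points leave only countably many alternatives, as the Baire argument requires.
-/
theorem exists_rat_Ioo_of_finite_frontier {T : Set ℝ} (hT : (frontier T).Finite) {a b : ℝ}
    (hab : a < b) : ∃ p q : ℚ, a < p ∧ (p : ℝ) < q ∧ q < b ∧
      ((∀ t : ℝ, p < t → t < q → t ∈ T) ∨ (∀ t : ℝ, p < t → t < q → t ∉ T)) := by
  obtain ⟨t, ht, htT⟩ : ∃ t ∈ Ioo a b, t ∉ frontier T := by
    by_contra! hcon
    exact (Ioo_infinite hab) (hT.subset hcon)
  have key : ∀ U : Set ℝ, IsOpen U → t ∈ U → ∃ p q : ℚ, a < p ∧ (p : ℝ) < q ∧ q < b ∧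
      ∀ s : ℝ, p < s → s < q → s ∈ U := by
    intro U hU htU
    obtain ⟨l, r, htlr, hlr⟩ := (mem_nhds_iff_exists_Ioo_subset).1
      ((hU.inter isOpen_Ioo).mem_nhds ⟨htU, ht⟩)
    obtain ⟨p, hp, hp'⟩ := exists_rat_btwn htlr.1
    obtain ⟨q, hq, hq'⟩ := exists_rat_btwn htlr.2
    have hpm := hlr (show (p : ℝ) ∈ Ioo l r from ⟨hp, hp'.trans htlr.2⟩)
    have hqm := hlr (show (q : ℝ) ∈ Ioo l r from ⟨htlr.1.trans hq, hq'⟩)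
    exact ⟨p, q, hpm.2.1, hp'.trans hq, hqm.2.2, fun s hs hs' =>
      (hlr ⟨hp.trans hs, hs'.trans hq'⟩).1⟩
  by_cases h : t ∈ T
  · have h2 : t ∈ interior T := by
      by_contra h3
      exact htT ⟨subset_closure h, h3⟩
    obtain ⟨p, q, h1, h2, h3, h4⟩ := key _ isOpen_interior h2
    exact ⟨p, q, h1, h2, h3, Or.inl fun s hs hs' => interior_subset (h4 s hs hs')⟩
  · have h2 : t ∈ (closure T)ᶜ := fun h3 => htT ⟨h3, fun h4 => h (interior_subset h4)⟩
    obtain ⟨p, q, h1, h2, h3, h4⟩ := key _ isClosed_closure.isOpen_compl h2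
    exact ⟨p, q, h1, h2, h3, Or.inr fun s hs hs' h5 => h4 s hs hs' (subset_closure h5)⟩

theorem isTameSet_fiber {n : ℕ} {A : Set (Fin (n + 1) → ℝ)} (hA : S.IsDef A) (y : Fin n → ℝ) :
    IsTameSet {t | _root_.snocR y t ∈ A} :=
  tame_of_defP (IsDef.comp hA
    (DefMap.snocR (DefMap.pi fun i => defMap_const (y i)) defMap_id))

/-- By induction on `n`. Suppose that `A` is dense in a box. Every fibre over the base of the box
contains or misses some rational interval within the height of the box, and by Baire in `ℝⁿ` one
interval and one alternative serve over an open set of base points. Containing the interval gives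
`A` an interior point; missing it contradicts density. -/
theorem interiorOrNowhereDense (S : OMinimalStructure) (n : ℕ) : S.InteriorOrNowhereDense n := by
  induction n with
  | zero =>
    intro A _ h
    rcases Subsingleton.eq_empty_or_singleton (subsingleton_of_subsingleton (s := A)) with rfl | ⟨x, rfl⟩
    · simp [IsNowhereDense]
    · have : ({x} : Set (Fin 0 → ℝ)) = univ := by ext y; simp [Subsingleton.elim y x]
      rw [this, interior_univ] at h
      exact absurd h (by simp)
  | succ n ih =>
    intro A hA hint
    by_contra hnd
    obtain ⟨x, hx⟩ := nonempty_iff_ne_empty.2 hnd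
    obtain ⟨ε, hε, hball⟩ := Metric.mem_nhds_iff.1 (mem_interior_iff_mem_nhds.1 hx)
    let U := Metric.ball (dropLast x) ε
    have hbox : ∀ y ∈ U, ∀ t : ℝ, |t - x (Fin.last n)| < ε → snocR y t ∈ closure A := by
      intro y hy t ht
      refine hball ((dist_pi_lt_iff hε).2 fun i => ?_)
      refine Fin.lastCases ?_ (fun i => ?_) i
      · simpa [Real.dist_eq] using ht
      · simpa [dropLast] using (dist_pi_lt_iff hε).1 hy i
    set a := x (Fin.last n) - ε
    set b := x (Fin.last n) + ε
    let ι := {p : ℚ × ℚ // a < p.1 ∧ (p.1 : ℝ) < p.2 ∧ p.2 < b}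
    -- The value `true` records that the fibre contains the rational interval, `false` that it
    -- misses it.
    let B : ι × Bool → Set (Fin n → ℝ) := fun i =>
      {y | ∀ t : ℝ, (i.1.1.1 : ℝ) < t → t < (i.1.1.2 : ℝ) →
        (if i.2 then snocR y t ∈ A else snocR y t ∉ A)}
    have hA' : S.DefP fun p : (Fin n → ℝ) × ℝ => snocR p.1 p.2 ∈ A :=
      IsDef.comp hA (defMap_fst.snocR defMap_snd)
    have hB : ∀ i, S.IsDef (B i) := by
      rintro ⟨i, s⟩
      refine DefP.isDef (P := fun y => ∀ t : ℝ, (i.1.1 : ℝ) < t → t < (i.1.2 : ℝ) →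
        (if s then snocR y t ∈ A else snocR y t ∉ A)) (DefP.forall ?_) fun y => Iff.rfl
      refine (DefP.lt (defMap_const _) defMap_snd).imp
        ((DefP.lt defMap_snd (defMap_const _)).imp ?_)
      cases s
      · simpa using hA'.not
      · simpa using hA'
    obtain ⟨⟨⟨⟨p, q⟩, hp, hpq, hq⟩, s⟩, y, hyU, hyB⟩ := ih.exists_interior hB
      Metric.isOpen_ball ⟨dropLast x, Metric.mem_ball_self hε⟩ (V := U) (by
        intro y hy
        obtain ⟨p, q, hp, hpq, hq, h⟩ := exists_rat_Ioo_of_finite_frontier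
          (isTameSet_fiber hA y).finite_frontier (show a < b by simp only [a, b]; linarith)
        rcases h with h | h
        · exact mem_iUnion.2 ⟨(⟨(p, q), hp, hpq, hq⟩, true), by simpa [B] using h⟩
        · exact mem_iUnion.2 ⟨(⟨(p, q), hp, hpq, hq⟩, false), by simpa [B] using h⟩)
    simp only at hp hpq hq
    let W : Set (Fin (n + 1) → ℝ) := {z | dropLast z ∈ interior (B (⟨⟨p, q⟩, hp, hpq, hq⟩, s)) ∧
      z (Fin.last n) ∈ Ioo (p : ℝ) q}
    have hW : IsOpen W := (isOpen_interior.preimage continuous_dropLast).inter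
      (isOpen_Ioo.preimage (continuous_apply _))
    obtain ⟨t, ht⟩ := exists_between hpq
    have htW : snocR y t ∈ W := by simp [W, hyB, ht]
    have hmem : ∀ z ∈ W, if s then z ∈ A else z ∉ A := by
      intro z hz
      have := interior_subset hz.1 (z (Fin.last n)) hz.2.1 hz.2.2
      simpa using this
    cases s
    · have hcl : snocR y t ∈ closure A := hbox y hyU t (by
        rw [abs_lt]
        simp only [a, b] at hp hq
        constructor <;> linarith [ht.1, ht.2])
      obtain ⟨z, hz, hzA⟩ := mem_closure_iff.1 hcl W hW htW
      have := hmem z hz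
      simp [hzA] at this
    · have : snocR y t ∈ interior A := mem_interior.2 ⟨W, fun z hz => by
        simpa using hmem z hz, hW, htW⟩
      rw [hint] at this
      exact this

/-! ### Generic continuity of definable functions. -/

theorem isNowhereDense_frontier {n : ℕ} {A : Set (Fin n → ℝ)} (hA : S.IsDef A) :
    IsNowhereDense (A \ interior A) := by
  refine S.interiorOrNowhereDense n _ (S.diff hA (isDef_interior hA)) ?_
  by_contra h
  obtain ⟨x, hx⟩ := nonempty_iff_ne_empty.2 h
  exact (interior_subset hx).2 (interior_mono sdiff_subset hx)

/-- A definable function on an open set is continuous off a meagre set. -/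
theorem isMeagre_not_continuousAt {n : ℕ} {V : Set (Fin n → ℝ)} {f : (Fin n → ℝ) → ℝ}
    (hf : S.IsDef (graphOver V f)) :
    IsMeagre {x ∈ V | ¬ ContinuousAt f x} := by
  let A : ℚ × ℚ → Set (Fin n → ℝ) := fun p => {x | x ∈ V ∧ (p.1 : ℝ) < f x ∧ f x < p.2}
  have hA : ∀ p, S.IsDef (A p) := by
    intro p
    have : S.DefP fun x : Fin n → ℝ => ∃ t : ℝ, snocR x t ∈ graphOver V f ∧ (p.1 : ℝ) < t ∧ t < p.2 :=
      DefP.exists ((IsDef.comp hf (defMap_fst.snocR defMap_snd)).and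
        ((DefP.lt (defMap_const _) defMap_snd).and (DefP.lt defMap_snd (defMap_const _))))
    refine this.isDef fun x => ?_
    simp only [graphOver, mem_ofPred_eq, dropLast_snocR, snocR_last, A]
    constructor
    · rintro ⟨h1, h2⟩
      exact ⟨_, ⟨h1, rfl⟩, h2⟩
    · rintro ⟨t, ⟨h1, rfl⟩, h2⟩
      exact ⟨h1, h2⟩
  -- At a point of `V` outside this set, every rational interval around the value has a
  -- neighbourhood of the point in its preimage, which is continuity there.
  have h2 : IsMeagre (⋃ p, A p \ interior (A p)) :=
    isMeagre_iUnion fun p => (isNowhereDense_frontier (hA p)).isMeagre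
  refine h2.mono ?_
  rintro x ⟨hxV, hx⟩
  by_contra hcon
  refine hx (Metric.continuousAt_iff'.2 fun ε hε => ?_)
  obtain ⟨p, hp, hp'⟩ := exists_rat_btwn (show f x - ε < f x by linarith)
  obtain ⟨q, hq, hq'⟩ := exists_rat_btwn (show f x < f x + ε by linarith)
  have hmem : x ∈ interior (A (p, q)) := by
    by_contra h
    exact hcon (mem_iUnion.2 ⟨(p, q), ⟨hxV, hp', hq⟩, h⟩)
  filter_upwards [mem_interior_iff_mem_nhds.1 hmem] with y hy
  rw [Real.dist_eq, abs_lt]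
  constructor <;> linarith [hy.2.1, hy.2.2]

end OMinimalStructure

/-! ### Properties of cells -/

/-- `ℝⁿ × ℝ` and `ℝⁿ⁺¹` are homeomorphic. -/
def snocHomeomorph (n : ℕ) : (Fin n → ℝ) × ℝ ≃ₜ (Fin (n + 1) → ℝ) where
  toFun p := snocR p.1 p.2
  invFun x := (dropLast x, x (Fin.last n))
  left_inv p := by simp
  right_inv x := by simp
  continuous_toFun := continuous_snocR
  continuous_invFun := continuous_dropLast.prodMk (continuous_apply _)

namespace OMinimalStructure

variable {S : OMinimalStructure}

theorem mem_graphOver {n : ℕ} {Y : Set (Fin n → ℝ)} {f : (Fin n → ℝ) → ℝ} {y : Fin n → ℝ}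
    {t : ℝ} : snocR y t ∈ graphOver Y f ↔ y ∈ Y ∧ t = f y := by
  simp [graphOver]

theorem mem_bandOver {n : ℕ} {Y : Set (Fin n → ℝ)} {f g : (Fin n → ℝ) → EReal} {y : Fin n → ℝ}
    {t : ℝ} : snocR y t ∈ bandOver Y f g ↔ y ∈ Y ∧ f y < t ∧ (t : EReal) < g y := by
  simp [bandOver]

/-- Only the graph over `Y` is definable, while `f` is arbitrary elsewhere. A condition on `f (g x)`
is therefore stated jointly with `g x ∈ Y`, and the value is quantified over the graph. -/
theorem DefP.restrict_graph {E : Type} [DefSpace E] {n : ℕ} {Y : Set (Fin n → ℝ)}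
    {f : (Fin n → ℝ) → ℝ} (hf : S.IsDef (graphOver Y f)) {g : E → Fin n → ℝ} (hg : S.DefMap g)
    {P : E → ℝ → Prop} (hP : S.DefP fun p : E × ℝ => P p.1 p.2) :
    S.DefP fun x => g x ∈ Y ∧ P x (f (g x)) := by
  have : S.DefP fun x => ∃ t : ℝ, snocR (g x) t ∈ graphOver Y f ∧ P x t :=
    DefP.exists ((IsDef.comp hf ((hg.comp defMap_fst).snocR defMap_snd)).and hP)
  refine this.congr fun x => ?_
  simp only [mem_graphOver]
  constructor
  · rintro ⟨h1, h2⟩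
    exact ⟨_, ⟨h1, rfl⟩, h2⟩
  · rintro ⟨_, ⟨h1, rfl⟩, h2⟩
    exact ⟨h1, h2⟩

theorem IsBound.defP_lt {E : Type} [DefSpace E] {n : ℕ} {Y : Set (Fin n → ℝ)}
    {f : (Fin n → ℝ) → EReal} (hY : S.IsDef Y) (hf : S.IsBound ⊥ Y f) {g : E → Fin n → ℝ}
    {h : E → ℝ} (hg : S.DefMap g) (hh : S.DefMap h) :
    S.DefP fun x => g x ∈ Y ∧ f (g x) < h x := by
  rcases hf with ⟨f', ⟨-, hf'⟩, hff'⟩ | hf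
  · refine (DefP.restrict_graph (P := fun x t => t < h x) hf' hg
      (DefP.lt defMap_snd (hh.comp defMap_fst))).congr fun x => and_congr_right fun hx => ?_
    rw [hff' _ hx, EReal.coe_lt_coe_iff]
  · refine (IsDef.comp hY hg).congr fun x => ?_
    refine ⟨And.left, fun hx => ⟨hx, ?_⟩⟩
    rw [hf _ hx]
    exact EReal.bot_lt_coe _

theorem IsBound.defP_gt {E : Type} [DefSpace E] {n : ℕ} {Y : Set (Fin n → ℝ)}
    {f : (Fin n → ℝ) → EReal} (hY : S.IsDef Y) (hf : S.IsBound ⊤ Y f) {g : E → Fin n → ℝ}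
    {h : E → ℝ} (hg : S.DefMap g) (hh : S.DefMap h) :
    S.DefP fun x => g x ∈ Y ∧ h x < f (g x) := by
  rcases hf with ⟨f', ⟨-, hf'⟩, hff'⟩ | hf
  · refine (DefP.restrict_graph (P := fun x t => h x < t) hf' hg
      (DefP.lt (hh.comp defMap_fst) defMap_snd)).congr fun x => and_congr_right fun hx => ?_
    rw [hff' _ hx, EReal.coe_lt_coe_iff]
  · refine (IsDef.comp hY hg).congr fun x => ?_
    refine ⟨And.left, fun hx => ⟨hx, ?_⟩⟩
    rw [hf _ hx]
    exact EReal.coe_lt_top _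

theorem isDef_bandOver {n : ℕ} {Y : Set (Fin n → ℝ)} {f g : (Fin n → ℝ) → EReal}
    (hY : S.IsDef Y) (hf : S.IsBound ⊥ Y f) (hg : S.IsBound ⊤ Y g) :
    S.IsDef (bandOver Y f g) := by
  refine ((hf.defP_lt hY (defMap_id (E := Fin (n + 1) → ℝ)).dropLast
    (defMap_apply (Fin.last n))).and (hg.defP_gt hY (defMap_id (E := Fin (n + 1) → ℝ)).dropLast
    (defMap_apply (Fin.last n)))).isDef fun x => ?_
  simp only [bandOver, mem_ofPred_eq]
  tauto

theorem DefContOn.mono {n : ℕ} {Y Z : Set (Fin n → ℝ)} {f : (Fin n → ℝ) → ℝ}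
    (hf : S.DefContOn Y f) (hZ : S.IsDef Z) (h : Z ⊆ Y) : S.DefContOn Z f := by
  refine ⟨hf.1.mono h, ?_⟩
  refine ((IsDef.comp hZ (defMap_id (E := Fin (n + 1) → ℝ)).dropLast).and
    (IsDef.comp hf.2 defMap_id)).isDef fun x => ?_
  simp only [graphOver, mem_ofPred_eq]
  exact ⟨fun hx => ⟨hx.1, h hx.1, hx.2⟩, fun hx => ⟨hx.1, hx.2.2⟩⟩

theorem IsBound.mono {c : EReal} {n : ℕ} {Y Z : Set (Fin n → ℝ)} {f : (Fin n → ℝ) → EReal}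
    (hf : S.IsBound c Y f) (hZ : S.IsDef Z) (h : Z ⊆ Y) : S.IsBound c Z f := by
  rcases hf with ⟨f', h1, h2⟩ | hf
  · exact Or.inl ⟨f', h1.mono hZ h, fun y hy => h2 y (h hy)⟩
  · exact Or.inr fun y hy => hf y (h hy)

/-- Composition with a continuous definable map. -/
theorem DefContOn.comp {m n : ℕ} {Y : Set (Fin n → ℝ)} {Z : Set (Fin m → ℝ)}
    {f : (Fin n → ℝ) → ℝ} {p : (Fin m → ℝ) → Fin n → ℝ} (hf : S.DefContOn Y f)
    (hp : ContinuousOn p Z) (hp' : S.DefP fun q : (Fin m → ℝ) × (Fin n → ℝ) =>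
      q.1 ∈ Z ∧ q.2 = p q.1) (h : ∀ z ∈ Z, p z ∈ Y) : S.DefContOn Z fun z => f (p z) := by
  refine ⟨hf.1.comp hp h, ?_⟩
  have h1 : S.DefP fun x : Fin (m + 1) → ℝ => ∃ y : Fin n → ℝ, (dropLast x ∈ Z ∧ y = p (dropLast x)) ∧
      snocR y (x (Fin.last m)) ∈ graphOver Y f :=
    DefP.exists ((DefP.comp (f := fun q : (Fin (m + 1) → ℝ) × (Fin n → ℝ) => (dropLast q.1, q.2))
      hp' (defMap_fst.dropLast.prodMk defMap_snd)).and
        (IsDef.comp hf.2 (defMap_snd.snocR (defMap_fst.apply _))))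
  refine h1.isDef fun x => ?_
  simp only [graphOver, mem_ofPred_eq, dropLast_snocR, snocR_last]
  constructor
  · rintro ⟨hx, hx'⟩
    exact ⟨_, ⟨hx, rfl⟩, h _ hx, hx'⟩
  · rintro ⟨_, ⟨hx, rfl⟩, _, hx'⟩
    exact ⟨hx, hx'⟩

theorem IsBound.comp {c : EReal} {m n : ℕ} {Y : Set (Fin n → ℝ)} {Z : Set (Fin m → ℝ)}
    {f : (Fin n → ℝ) → EReal} {p : (Fin m → ℝ) → Fin n → ℝ} (hf : S.IsBound c Y f)
    (hp : ContinuousOn p Z) (hp' : S.DefP fun q : (Fin m → ℝ) × (Fin n → ℝ) =>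
      q.1 ∈ Z ∧ q.2 = p q.1) (h : ∀ z ∈ Z, p z ∈ Y) : S.IsBound c Z fun z => f (p z) := by
  rcases hf with ⟨f', h1, h2⟩ | hf
  · exact Or.inl ⟨_, h1.comp hp hp' h, fun y hy => h2 _ (h y hy)⟩
  · exact Or.inr fun y hy => hf _ (h y hy)

theorem IsCell.dim_le {n d : ℕ} {C : Set (Fin n → ℝ)} (h : S.IsCell d C) : d ≤ n := by
  induction h with
  | point => exact le_rfl
  | graph _ _ ih => exact ih.trans (Nat.le_succ _)
  | band _ _ _ _ ih => exact Nat.succ_le_succ ih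

theorem IsCell.isDef {n d : ℕ} {C : Set (Fin n → ℝ)} (h : S.IsCell d C) : S.IsDef C := by
  induction h with
  | point => simpa using S.compl (S.empty 0)
  | graph _ hf _ => exact hf.2
  | band _ hf hg _ ih => exact isDef_bandOver ih hf hg

theorem IsCell.nonempty {n d : ℕ} {C : Set (Fin n → ℝ)} (h : S.IsCell d C) : C.Nonempty := by
  induction h with
  | point => exact univ_nonempty
  | @graph n d Y f _ _ ih =>
    obtain ⟨y, hy⟩ := ih
    exact ⟨snocR y (f y), mem_graphOver.2 ⟨hy, rfl⟩⟩
  | band _ _ _ hfg ih =>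
    obtain ⟨y, hy⟩ := ih
    obtain ⟨t, ht, ht'⟩ := EReal.lt_iff_exists_real_btwn.1 (hfg y hy)
    exact ⟨snocR y t, mem_bandOver.2 ⟨hy, ht, ht'⟩⟩

theorem isBound_continuousOn {n : ℕ} {c : EReal} {Y : Set (Fin n → ℝ)}
    {f : (Fin n → ℝ) → EReal} (hf : S.IsBound c Y f) : ContinuousOn f Y := by
  rcases hf with ⟨f', h1, h2⟩ | hf
  · exact (continuous_coe_real_ereal.comp_continuousOn h1.1).congr h2
  · exact continuousOn_const.congr hf

/-- Full dimension forces every stage of the construction to be a band, and a band between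
continuous bounds over an open base is open. -/
theorem IsCell.isOpen {n d : ℕ} {C : Set (Fin n → ℝ)} (h : S.IsCell d C) (hd : d = n) :
    IsOpen C := by
  induction h with
  | point => exact isOpen_univ
  | graph hY _ _ => exact absurd hY.dim_le (by omega)
  | @band n d Y f g hY hf hg _ ih =>
    have hYo := ih (by omega)
    rw [isOpen_iff_mem_nhds]
    intro x hx
    have h1 : ContinuousAt (fun x : Fin (n + 1) → ℝ => f (dropLast x)) x :=
      ContinuousAt.comp (f := dropLast) ((isBound_continuousOn hf).continuousAt
        (hYo.mem_nhds hx.1)) continuous_dropLast.continuousAt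
    have h2 : ContinuousAt (fun x : Fin (n + 1) → ℝ => g (dropLast x)) x :=
      ContinuousAt.comp (f := dropLast) ((isBound_continuousOn hg).continuousAt
        (hYo.mem_nhds hx.1)) continuous_dropLast.continuousAt
    have h3 : ContinuousAt (fun x : Fin (n + 1) → ℝ => (x (Fin.last n) : EReal)) x :=
      (continuous_coe_real_ereal.comp (continuous_apply _)).continuousAt
    exact Filter.inter_mem (continuous_dropLast.continuousAt (hYo.mem_nhds hx.1))
      (Filter.inter_mem (h1.eventually_lt h3 hx.2.1) (h3.eventually_lt h2 hx.2.2))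

/-- An order isomorphism of `ℝ` with `(-1, 1)` turns finite and infinite bounds alike into
continuous functions `F < G` with values in `[-1, 1]`. The band between these is straightened by
affine maps in the fibres. -/
theorem nonempty_homeomorph_band {n : ℕ} {Y : Set (Fin n → ℝ)} {f g : (Fin n → ℝ) → EReal}
    (hf : S.IsBound ⊥ Y f) (hg : S.IsBound ⊤ Y g) (hfg : ∀ y ∈ Y, f y < g y) :
    Nonempty (bandOver Y f g ≃ₜ Y × ℝ) := by
  let ρ : ℝ ≃ₜ Ioo (-1 : ℝ) 1 := (orderIsoIooNegOneOne ℝ).toHomeomorph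
  have hρ : ∀ s t, (ρ s : ℝ) < ρ t ↔ s < t := fun s t => (orderIsoIooNegOneOne ℝ).lt_iff_lt
  have hρc : Continuous fun t => (ρ t : ℝ) := continuous_subtype_val.comp ρ.continuous
  obtain ⟨F, hFc, hF1, hF⟩ : ∃ F : (Fin n → ℝ) → ℝ, ContinuousOn F Y ∧ (∀ y ∈ Y, -1 ≤ F y) ∧
      ∀ y ∈ Y, ∀ t : ℝ, f y < t ↔ F y < ρ t := by
    rcases hf with ⟨f', h1, h2⟩ | hf
    · exact ⟨fun y => ρ (f' y), hρc.comp_continuousOn h1.1, fun y _ => (ρ (f' y)).2.1.le,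
        fun y hy t => by rw [h2 y hy, EReal.coe_lt_coe_iff, hρ]⟩
    · exact ⟨fun _ => -1, continuousOn_const, fun _ _ => le_rfl, fun y hy t => by
        simp only [hf y hy, EReal.bot_lt_coe, true_iff]; exact (ρ t).2.1⟩
  obtain ⟨G, hGc, hG1, hG⟩ : ∃ G : (Fin n → ℝ) → ℝ, ContinuousOn G Y ∧ (∀ y ∈ Y, G y ≤ 1) ∧
      ∀ y ∈ Y, ∀ t : ℝ, (t : EReal) < g y ↔ ρ t < G y := by
    rcases hg with ⟨f', h1, h2⟩ | hf
    · exact ⟨fun y => ρ (f' y), hρc.comp_continuousOn h1.1, fun y _ => (ρ (f' y)).2.2.le,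
        fun y hy t => by rw [h2 y hy, EReal.coe_lt_coe_iff, hρ]⟩
    · exact ⟨fun _ => 1, continuousOn_const, fun _ _ => le_rfl, fun y hy t => by
        simp only [hf y hy, EReal.coe_lt_top, true_iff]; exact (ρ t).2.2⟩
  have hFG : ∀ y ∈ Y, F y < G y := fun y hy => by
    obtain ⟨t, ht, ht'⟩ := EReal.lt_iff_exists_real_btwn.1 (hfg y hy)
    exact ((hF y hy t).1 ht).trans ((hG y hy t).1 ht')
  have hFc' : Continuous fun y : Y => F y := continuousOn_iff_continuous_domRestrict.1 hFc
  have hGc' : Continuous fun y : Y => G y := continuousOn_iff_continuous_domRestrict.1 hGc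
  -- In each fibre `a` takes `(F, G)` affinely onto `(-1, 1)`; the second component of its inverse
  -- is `w`, read through `ρ`.
  let a : bandOver Y f g → Y × Ioo (-1 : ℝ) 1 := fun x =>
    (⟨dropLast x.1, x.2.1⟩, ⟨2 * (ρ (x.1 (Fin.last n)) - F (dropLast x.1)) /
      (G (dropLast x.1) - F (dropLast x.1)) - 1, by
        have h1 := (hF _ x.2.1 _).1 x.2.2.1
        have h2 := (hG _ x.2.1 _).1 x.2.2.2
        have h3 := hFG _ x.2.1
        constructor
        · have : 0 < 2 * (ρ (x.1 (Fin.last n)) - F (dropLast x.1)) /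
            (G (dropLast x.1) - F (dropLast x.1)) := div_pos (by linarith) (by linarith)
          linarith
        · have : 2 * (ρ (x.1 (Fin.last n)) - F (dropLast x.1)) /
            (G (dropLast x.1) - F (dropLast x.1)) < 2 := by
            rw [div_lt_iff₀ (by linarith)]
            linarith
          linarith⟩)
  have hbm : ∀ p : Y × Ioo (-1 : ℝ) 1,
      F p.1 < F p.1 + (G p.1 - F p.1) * (p.2 + 1) / 2 ∧
        F p.1 + (G p.1 - F p.1) * (p.2 + 1) / 2 < G p.1 := by
    intro p
    have h1 := hFG _ p.1.2
    have h2 := p.2.2.1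
    have h3 := p.2.2.2
    constructor <;> nlinarith
  let w : Y × Ioo (-1 : ℝ) 1 → Ioo (-1 : ℝ) 1 := fun p =>
    ⟨F p.1 + (G p.1 - F p.1) * (p.2 + 1) / 2,
      lt_of_le_of_lt (hF1 _ p.1.2) (hbm p).1, lt_of_lt_of_le (hbm p).2 (hG1 _ p.1.2)⟩
  let b : Y × Ioo (-1 : ℝ) 1 → bandOver Y f g := fun p =>
    ⟨snocR p.1 (ρ.symm (w p)), mem_bandOver.2 ⟨p.1.2,
      (hF _ p.1.2 _).2 (by rw [ρ.apply_symm_apply]; exact (hbm p).1),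
      (hG _ p.1.2 _).2 (by rw [ρ.apply_symm_apply]; exact (hbm p).2)⟩⟩
  have hw : Continuous w := by
    refine Continuous.subtype_mk ?_ _
    have h1 := hFc'.comp (continuous_fst (X := Y) (Y := Ioo (-1 : ℝ) 1))
    have h2 := hGc'.comp (continuous_fst (X := Y) (Y := Ioo (-1 : ℝ) 1))
    have h3 := continuous_subtype_val.comp (continuous_snd (X := Y) (Y := Ioo (-1 : ℝ) 1))
    exact h1.add (((h2.sub h1).mul (h3.add continuous_const)).div_const 2)
  let e : bandOver Y f g ≃ₜ Y × Ioo (-1 : ℝ) 1 :=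
    { toFun := a
      invFun := b
      left_inv := by
        intro x
        apply Subtype.ext
        have h3 := hFG _ x.2.1
        have : w (a x) = ρ (x.1 (Fin.last n)) := by
          apply Subtype.ext
          simp only [w, a]
          field_simp [show G (dropLast x.1) - F (dropLast x.1) ≠ 0 by linarith]
          ring
        change snocR (dropLast x.1) (ρ.symm (w (a x))) = x.1
        rw [this, ρ.symm_apply_apply, snocR_dropLast]
      right_inv := by
        intro p
        have h3 := hFG _ p.1.2
        refine Prod.ext (Subtype.ext (dropLast_snocR _ _)) (Subtype.ext ?_)
        simp only [a, b, dropLast_snocR, snocR_last, ρ.apply_symm_apply, w]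
        field_simp [show G p.1 - F p.1 ≠ 0 by linarith]
        ring
      continuous_toFun := by
        have h1 : Continuous fun x : bandOver Y f g => (⟨dropLast x.1, x.2.1⟩ : Y) :=
          (continuous_dropLast.comp continuous_subtype_val).subtype_mk _
        have h2 := hFc'.comp h1
        have h3 := hGc'.comp h1
        have h4 : Continuous fun x : bandOver Y f g => (ρ (x.1 (Fin.last n)) : ℝ) :=
          hρc.comp ((continuous_apply _).comp continuous_subtype_val)
        refine h1.prodMk (Continuous.subtype_mk ?_ _)
        refine Continuous.sub (Continuous.div ((continuous_const).mul (h4.sub h2)) (h3.sub h2) ?_)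
          continuous_const
        intro x
        have := hFG _ x.2.1
        simp only [ne_eq]
        linarith
      continuous_invFun :=
        Continuous.subtype_mk (continuous_snocR.comp ((continuous_subtype_val.comp
          continuous_fst).prodMk (ρ.symm.continuous.comp hw))) _ }
  exact ⟨e.trans ((Homeomorph.refl Y).prodCongr ρ.symm)⟩

theorem IsCell.nonempty_homeomorph {n d : ℕ} {C : Set (Fin n → ℝ)} (h : S.IsCell d C) :
    Nonempty (C ≃ₜ (Fin d → ℝ)) := by
  induction h with
  | point => exact ⟨Homeomorph.Set.univ _⟩
  | @graph n d Y f hY hf ih =>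
    obtain ⟨e⟩ := ih
    let e' : graphOver Y f ≃ₜ Y :=
      { toFun := fun x => ⟨dropLast x.1, x.2.1⟩
        invFun := fun y => ⟨snocR y (f y), mem_graphOver.2 ⟨y.2, rfl⟩⟩
        left_inv := fun x => Subtype.ext (by
          change snocR (dropLast x.1) (f (dropLast x.1)) = x.1
          rw [← x.2.2, snocR_dropLast])
        right_inv := fun y => Subtype.ext (dropLast_snocR _ _)
        continuous_toFun := (continuous_dropLast.comp continuous_subtype_val).subtype_mk _
        continuous_invFun := Continuous.subtype_mk (continuous_snocR.comp
          (continuous_subtype_val.prodMk (continuousOn_iff_continuous_domRestrict.1 hf.1))) _ }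
    exact ⟨e'.trans e⟩
  | band hY hf hg hfg ih =>
    obtain ⟨e⟩ := ih
    obtain ⟨e'⟩ := nonempty_homeomorph_band hf hg hfg
    exact ⟨(e'.trans (e.prodCongr (Homeomorph.refl ℝ))).trans (snocHomeomorph _)⟩

theorem IsCell.isPreconnected {n d : ℕ} {C : Set (Fin n → ℝ)} (h : S.IsCell d C) :
    IsPreconnected C := by
  obtain ⟨e⟩ := h.nonempty_homeomorph
  have : PreconnectedSpace C := e.symm.surjective.denseRange.preconnectedSpace e.symm.continuous
  exact isPreconnected_iff_preconnectedSpace.2 this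

/-- Induction on the construction of `B`: the last coordinates of the product are those of `B`, so a
graph or band over `Y` becomes a graph or band over `A × Y`. -/
theorem isCell_prodSet {m n a b : ℕ} {A : Set (Fin m → ℝ)} {B : Set (Fin n → ℝ)}
    (hA : S.IsCell a A) (hB : S.IsCell b B) : S.IsCell (a + b) (prodSet A B) := by
  have hp : ∀ {k : ℕ} (Z : Set (Fin (m + k) → ℝ)), S.IsDef Z →
      S.DefP fun q : (Fin (m + k) → ℝ) × (Fin k → ℝ) =>
        q.1 ∈ Z ∧ q.2 = fun j => q.1 (Fin.natAdd m j) := fun Z hZ =>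
    (IsDef.comp hZ defMap_fst).and (DefP.eq defMap_snd (DefMap.pi fun j => defMap_fst.apply _))
  have hpc : ∀ {k : ℕ} (Z : Set (Fin (m + k) → ℝ)),
      ContinuousOn (fun z : Fin (m + k) → ℝ => fun j : Fin k => z (Fin.natAdd m j)) Z := fun Z =>
    (continuous_pi fun j => continuous_apply _).continuousOn
  induction hB with
  | point =>
    have : prodSet A (univ : Set (Fin 0 → ℝ)) = A := by
      ext x
      exact ⟨fun h => h.1, fun h => ⟨h, mem_univ _⟩⟩
    rw [this]
    exact hA
  | @graph n d Y f hY hf ih =>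
    have h1 : prodSet A (graphOver Y f) =
        graphOver (prodSet A Y) fun z => f fun j => z (Fin.natAdd m j) := by
      ext x
      exact and_assoc.symm
    rw [h1]
    exact IsCell.graph ih (hf.comp (hpc _) (hp _ ih.isDef) fun z hz => hz.2)
  | @band n d Y f g hY hf hg hfg ih =>
    have h1 : prodSet A (bandOver Y f g) =
        bandOver (prodSet A Y) (fun z => f fun j => z (Fin.natAdd m j))
          (fun z => g fun j => z (Fin.natAdd m j)) := by
      ext x
      exact and_assoc.symm
    rw [h1]
    exact IsCell.band ih (hf.comp (hpc _) (hp _ ih.isDef) fun z hz => hz.2)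
      (hg.comp (hpc _) (hp _ ih.isDef) fun z hz => hz.2) fun z hz => hfg _ hz.2

/-- A cell of dimension `d` projects homeomorphically onto an open cell of `ℝᵈ`, and cells
in the image pull back to cells. -/
theorem IsCell.exists_proj {n d : ℕ} {C : Set (Fin n → ℝ)} (hC : S.IsCell d C) :
    ∃ (e : Fin d → Fin n) (q : (Fin d → ℝ) → Fin n → ℝ),
      (∀ x ∈ C, q (fun i => x (e i)) = x) ∧ ContinuousOn q ((fun x i => x (e i)) '' C) ∧
      S.IsCell d ((fun x i => x (e i)) '' C) ∧
      ∀ k D, D ⊆ (fun x i => x (e i)) '' C → S.IsCell k D →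
        S.IsCell k {x | x ∈ C ∧ (fun i => x (e i)) ∈ D} := by
  induction hC with
  | point =>
    refine ⟨id, id, fun _ _ => rfl, continuousOn_id, ?_, fun k D _ hD => ?_⟩
    · simpa using IsCell.point
    · have : {x | x ∈ univ ∧ (fun i => x (id i)) ∈ D} = D := by ext x; simp
      rwa [this]
  | @graph n d Y f hY hf ih =>
    obtain ⟨e, q, hq, hqc, hcell, hpull⟩ := ih
    have him : (fun (x : Fin (n + 1) → ℝ) i => x (e i).castSucc) '' graphOver Y f =
        (fun x i => x (e i)) '' Y := by
      ext z
      constructor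
      · rintro ⟨x, hx, rfl⟩
        exact ⟨_, hx.1, rfl⟩
      · rintro ⟨y, hy, rfl⟩
        exact ⟨snocR y (f y), mem_graphOver.2 ⟨hy, rfl⟩, by simp⟩
    have hmaps : ∀ z ∈ (fun x i => x (e i)) '' Y, q z ∈ Y := by
      rintro _ ⟨y, hy, rfl⟩
      rwa [hq y hy]
    refine ⟨fun i => (e i).castSucc, fun z => snocR (q z) (f (q z)), ?_, ?_, ?_, ?_⟩
    · intro x hx
      have := hq _ hx.1
      change snocR (q fun i => dropLast x (e i)) (f (q fun i => dropLast x (e i))) = x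
      rw [this, ← hx.2, snocR_dropLast]
    · rw [him]
      exact continuous_snocR.comp_continuousOn (hqc.prodMk (hf.1.comp hqc hmaps))
    · rwa [him]
    · intro k D hD hDc
      rw [him] at hD
      have h2 := hpull k D hD hDc
      have h3 : {x | x ∈ graphOver Y f ∧ (fun i => x (e i).castSucc) ∈ D} =
          graphOver {x | x ∈ Y ∧ (fun i => x (e i)) ∈ D} f := by
        ext x
        simp only [graphOver, mem_ofPred_eq, dropLast]
        tauto
      rw [h3]
      exact IsCell.graph h2 (hf.mono h2.isDef fun x hx => hx.1)
  | @band n d Y f g hY hf hg hfg ih =>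
    obtain ⟨e, q, hq, hqc, hcell, hpull⟩ := ih
    set P : Set (Fin d → ℝ) := (fun x i => x (e i)) '' Y with hP
    -- A band keeps its last coordinate under the projection, whereas a graph forgets it.
    let e' : Fin (d + 1) → Fin (n + 1) :=
      Fin.lastCases (Fin.last n) fun i => (e i).castSucc
    have he' : ∀ x : Fin (n + 1) → ℝ,
        (fun i => x (e' i)) = snocR (fun i => dropLast x (e i)) (x (Fin.last n)) := by
      intro x
      funext i
      refine Fin.lastCases ?_ (fun i => ?_) i
      · simp [e']
      · simp [e', dropLast]
    have hmaps : ∀ z ∈ P, q z ∈ Y := by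
      rintro _ ⟨y, hy, rfl⟩
      rwa [hq y hy]
    have hpq : ∀ z ∈ P, (fun i => q z (e i)) = z := by
      rintro _ ⟨y, hy, rfl⟩
      rw [hq y hy]
    have him : (fun (x : Fin (n + 1) → ℝ) i => x (e' i)) '' bandOver Y f g =
        bandOver P (fun z => f (q z)) fun z => g (q z) := by
      ext z
      constructor
      · rintro ⟨x, hx, rfl⟩
        simp only [he']
        rw [mem_bandOver, hq _ hx.1]
        exact ⟨⟨_, hx.1, rfl⟩, hx.2⟩
      · intro hz
        refine ⟨snocR (q (dropLast z)) (z (Fin.last d)), mem_bandOver.2 ⟨hmaps _ hz.1, hz.2⟩, ?_⟩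
        simp only [he', dropLast_snocR, snocR_last]
        rw [hpq _ hz.1, snocR_dropLast]
    -- The inverse `q` came without definability; over `P` its graph is the transposed graph of the
    -- coordinate projection of `Y`.
    have hqdef : S.DefP fun r : (Fin d → ℝ) × (Fin n → ℝ) => r.1 ∈ P ∧ r.2 = q r.1 := by
      refine ((IsDef.comp hY.isDef defMap_snd).and (DefP.eq defMap_fst
        (DefMap.pi fun i => defMap_snd.apply (e i)))).congr fun r => ?_
      constructor
      · rintro ⟨h1, h2⟩
        rw [h2]
        exact ⟨hmaps _ h1, (hpq _ h1).symm⟩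
      · rintro ⟨h1, h2⟩
        rw [h2]
        exact ⟨⟨_, h1, rfl⟩, (hq _ h1).symm⟩
    refine ⟨e', fun z => snocR (q (dropLast z)) (z (Fin.last d)), ?_, ?_, ?_, ?_⟩
    · intro x hx
      have h0 : x (e' (Fin.last d)) = x (Fin.last n) := by simp [e']
      simp only [he', dropLast_snocR]
      rw [hq _ hx.1, h0, snocR_dropLast]
    · rw [him]
      refine continuous_snocR.comp_continuousOn (ContinuousOn.prodMk (hqc.comp
        continuous_dropLast.continuousOn fun z hz => hz.1) (continuous_apply _).continuousOn)
    · rw [him]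
      exact IsCell.band hcell (hf.comp hqc hqdef hmaps)
        (hg.comp hqc hqdef hmaps) fun z hz => hfg _ (hmaps z hz)
    · intro k D hD hDc
      rw [him] at hD
      have hpc : Continuous fun (x : Fin n → ℝ) i => x (e i) :=
        continuous_pi fun i => continuous_apply _
      have hpdef : ∀ Z : Set (Fin n → ℝ), S.IsDef Z →
          S.DefP fun r : (Fin n → ℝ) × (Fin d → ℝ) => r.1 ∈ Z ∧ r.2 = fun i => r.1 (e i) :=
        fun Z hZ => (IsDef.comp hZ defMap_fst).and
          (DefP.eq defMap_snd (DefMap.pi fun i => defMap_fst.apply (e i)))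
      -- Since `D` lies in the image of the band, its heights respect the bounds `f` and `g`. The
      -- pullback of `D` is thus a plain graph or band over the pulled back base.
      have hDbase : ∀ z t, snocR z t ∈ D → z ∈ P ∧ f (q z) < t ∧ (t : EReal) < g (q z) :=
        fun z t h => mem_bandOver.1 (hD h)
      cases hDc with
      | @graph _ _ D' h hD' hh =>
        have hsub : D' ⊆ P := fun z hz => (hDbase z (h z) (mem_graphOver.2 ⟨hz, rfl⟩)).1
        have h2 := hpull k D' hsub hD'
        have h3 : {x | x ∈ bandOver Y f g ∧ (fun i => x (e' i)) ∈ graphOver D' h} =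
            graphOver {x | x ∈ Y ∧ (fun i => x (e i)) ∈ D'} fun x => h fun i => x (e i) := by
          ext x
          simp only [he', mem_ofPred_eq, mem_graphOver]
          constructor
          · rintro ⟨h4, h5, h6⟩
            exact ⟨⟨h4.1, h5⟩, h6⟩
          · rintro ⟨⟨h4, h5⟩, h6⟩
            have h7 := hDbase _ _ (mem_graphOver.2 ⟨h5, h6⟩)
            rw [hq _ h4] at h7
            exact ⟨⟨h4, h7.2⟩, h5, h6⟩
        rw [h3]
        exact IsCell.graph h2 (hh.comp hpc.continuousOn (hpdef _ h2.isDef)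
          fun z hz => hz.2)
      | @band _ k' D' h h' hD' hh hh' hlt =>
        have hsub : D' ⊆ P := fun z hz => by
          obtain ⟨t, ht, ht'⟩ := EReal.lt_iff_exists_real_btwn.1 (hlt z hz)
          exact (hDbase z t (mem_bandOver.2 ⟨hz, ht, ht'⟩)).1
        have h2 := hpull k' D' hsub hD'
        have h3 : {x | x ∈ bandOver Y f g ∧ (fun i => x (e' i)) ∈ bandOver D' h h'} =
            bandOver {x | x ∈ Y ∧ (fun i => x (e i)) ∈ D'} (fun x => h fun i => x (e i))
              fun x => h' fun i => x (e i) := by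
          ext x
          simp only [he', mem_ofPred_eq, mem_bandOver]
          constructor
          · rintro ⟨h4, h5, h6⟩
            exact ⟨⟨h4.1, h5⟩, h6⟩
          · rintro ⟨⟨h4, h5⟩, h6⟩
            have h7 := hDbase _ _ (mem_bandOver.2 ⟨h5, h6⟩)
            rw [hq _ h4] at h7
            exact ⟨⟨h4, h7.2⟩, h5, h6⟩
        rw [h3]
        exact IsCell.band h2 (hh.comp hpc.continuousOn (hpdef _ h2.isDef)
            fun z hz => hz.2) (hh'.comp hpc.continuousOn (hpdef _ h2.isDef)
            fun z hz => hz.2) fun z hz => hlt _ hz.2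

end OMinimalStructure

/-! ### Partitions into cells -/

namespace OMinimalStructure

variable {S : OMinimalStructure}

variable (S) in
/-- `X` is a finite disjoint union of cells with the property `P`. -/
def PartCells {n : ℕ} (P : Set (Fin n → ℝ) → Prop) (X : Set (Fin n → ℝ)) : Prop :=
  ∃ F : Set (Set (Fin n → ℝ)), F.Finite ∧ F.PairwiseDisjoint id ∧ ⋃₀ F = X ∧
    ∀ C ∈ F, (∃ d, S.IsCell d C) ∧ P C

theorem PartCells.iUnion {n : ℕ} {P : Set (Fin n → ℝ) → Prop} {ι : Type*} [Finite ι]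
    {X : ι → Set (Fin n → ℝ)} (hX : Pairwise fun i j => Disjoint (X i) (X j))
    (h : ∀ i, S.PartCells P (X i)) : S.PartCells P (⋃ i, X i) := by
  choose F h1 h2 h3 h4 using h
  have hsub : ∀ i, ∀ C ∈ F i, C ⊆ X i := fun i C hC => by
    rw [← h3 i]
    exact subset_sUnion_of_mem hC
  refine ⟨⋃ i, F i, finite_iUnion h1, ?_, ?_, ?_⟩
  · intro C hC D hD hCD
    obtain ⟨i, hi⟩ := mem_iUnion.1 hC
    obtain ⟨j, hj⟩ := mem_iUnion.1 hD
    by_cases hij : i = j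
    · subst hij
      exact h2 i hi hj hCD
    · exact (hX hij).mono (hsub i C hi) (hsub j D hj)
  · rw [sUnion_iUnion]
    exact iUnion_congr h3
  · intro C hC
    obtain ⟨i, hi⟩ := mem_iUnion.1 hC
    exact h4 i C hi

theorem PartCells.union {n : ℕ} {P : Set (Fin n → ℝ) → Prop} {X Y : Set (Fin n → ℝ)}
    (hXY : Disjoint X Y) (hX : S.PartCells P X) (hY : S.PartCells P Y) :
    S.PartCells P (X ∪ Y) := by
  rw [union_eq_iUnion]
  refine PartCells.iUnion ?_ ?_
  · rintro (_ | _) (_ | _) h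
    · exact absurd rfl h
    · exact hXY.symm
    · exact hXY
    · exact absurd rfl h
  · rintro (_ | _)
    · exact hY
    · exact hX

theorem PartCells.sUnion {n : ℕ} {P : Set (Fin n → ℝ) → Prop} {F : Set (Set (Fin n → ℝ))}
    (hF : F.Finite) (hd : F.PairwiseDisjoint id) (h : ∀ C ∈ F, S.PartCells P C) :
    S.PartCells P (⋃₀ F) := by
  have : Finite F := hF
  rw [sUnion_eq_iUnion]
  exact PartCells.iUnion (fun i j hij => hd i.2 j.2 fun h => hij (Subtype.ext h)) fun i => h i.1 i.2

/-- Refinement of a partition, one cell at a time. -/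
theorem PartCells.bind {n : ℕ} {P Q : Set (Fin n → ℝ) → Prop} {X : Set (Fin n → ℝ)}
    (hX : S.PartCells Q X) (h : ∀ C ⊆ X, ∀ d, S.IsCell d C → Q C → S.PartCells P C) :
    S.PartCells P X := by
  obtain ⟨F, h1, h2, rfl, h4⟩ := hX
  refine PartCells.sUnion h1 h2 fun C hC => ?_
  obtain ⟨⟨d, hd⟩, hQ⟩ := h4 C hC
  exact h C (subset_sUnion_of_mem hC) d hd hQ

theorem PartCells.of_isCell {n d : ℕ} {P : Set (Fin n → ℝ) → Prop} {C : Set (Fin n → ℝ)}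
    (hC : S.IsCell d C) (hP : P C) : S.PartCells P C :=
  ⟨{C}, finite_singleton C, pairwiseDisjoint_singleton C id, sUnion_singleton C, by
    rintro _ rfl
    exact ⟨⟨d, hC⟩, hP⟩⟩

/-- Images of a partition under an operation on sets that preserves disjointness. -/
theorem PartCells.map {m n : ℕ} {P : Set (Fin n → ℝ) → Prop} {Q : Set (Fin m → ℝ) → Prop}
    {X : Set (Fin m → ℝ)} (hX : S.PartCells Q X) (φ : Set (Fin m → ℝ) → Set (Fin n → ℝ))
    (hd : ∀ C D, Disjoint C D → Disjoint (φ C) (φ D))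
    (h : ∀ C ⊆ X, ∀ d, S.IsCell d C → Q C → (∃ d, S.IsCell d (φ C)) ∧ P (φ C))
    (hU : ∀ F : Set (Set (Fin m → ℝ)), ⋃₀ (φ '' F) = φ (⋃₀ F)) : S.PartCells P (φ X) := by
  obtain ⟨F, h1, h2, rfl, h4⟩ := hX
  refine ⟨φ '' F, h1.image φ, ?_, hU F, ?_⟩
  · rintro _ ⟨C, hC, rfl⟩ _ ⟨D, hD, rfl⟩ hne
    exact hd C D (h2 hC hD fun h => hne (h ▸ rfl))
  · rintro _ ⟨C, hC, rfl⟩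
    obtain ⟨⟨d, hd⟩, hQ⟩ := h4 C hC
    exact h C (subset_sUnion_of_mem hC) d hd hQ

theorem PartCells.exists_decomposition {n : ℕ} {P : Set (Fin n → ℝ) → Prop}
    {X : Set (Fin n → ℝ)} (hX : S.PartCells P X) :
    ∃ D : S.CellDecomposition X, ∀ i, P (D.cell i) := by
  obtain ⟨F, h1, h2, rfl, h4⟩ := hX
  have : Finite F := h1
  obtain ⟨k, ⟨e⟩⟩ := Finite.exists_equiv_fin F
  choose d hd using fun i : Fin k => (h4 _ (e.symm i).2).1
  refine ⟨⟨k, fun i => (e.symm i).1, d, hd, ?_, ?_⟩, fun i => (h4 _ (e.symm i).2).2⟩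
  · intro i j hij
    exact h2 (e.symm i).2 (e.symm j).2 fun h => hij (e.symm.injective (Subtype.ext h))
  · rw [sUnion_eq_iUnion]
    exact e.symm.surjective.iUnion_comp fun C : F => C.1

/-! ### Families of finite sets of reals -/

/-- `v` enumerates the fibre of `A` over `y` increasingly. -/
def Enumerates {n k : ℕ} (A : Set (Fin (n + 1) → ℝ)) (y : Fin n → ℝ) (v : Fin k → ℝ) : Prop :=
  (∀ i j, i < j → v i < v j) ∧ ∀ t, snocR y t ∈ A ↔ ∃ i, t = v i

theorem Enumerates.range_eq {n k : ℕ} {A : Set (Fin (n + 1) → ℝ)} {y : Fin n → ℝ}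
    {v : Fin k → ℝ} (h : Enumerates A y v) : range v = {t | snocR y t ∈ A} := by
  ext t
  rw [mem_ofPred_eq, h.2]
  exact exists_congr fun i => eq_comm

theorem Enumerates.card_eq {n k k' : ℕ} {A : Set (Fin (n + 1) → ℝ)} {y : Fin n → ℝ}
    {v : Fin k → ℝ} {v' : Fin k' → ℝ} (h : Enumerates A y v) (h' : Enumerates A y v') :
    k = k' := by
  have hv : StrictMono v := fun i j => h.1 i j
  have hv' : StrictMono v' := fun i j => h'.1 i j
  have h1 := Set.ncard_image_of_injective univ hv.injective
  have h2 := Set.ncard_image_of_injective univ hv'.injective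
  rw [image_univ, h.range_eq] at h1
  rw [image_univ, h'.range_eq] at h2
  simpa using h1.symm.trans h2

theorem Enumerates.eq {n k : ℕ} {A : Set (Fin (n + 1) → ℝ)} {y : Fin n → ℝ}
    {v v' : Fin k → ℝ} (h : Enumerates A y v) (h' : Enumerates A y v') : v = v' :=
  (StrictMono.range_inj (fun i j => h.1 i j) (fun i j => h'.1 i j)).1
    (h.range_eq.trans h'.range_eq.symm)

theorem exists_enumerates {n : ℕ} {A : Set (Fin (n + 1) → ℝ)} {y : Fin n → ℝ}
    (h : {t | snocR y t ∈ A}.Finite) : ∃ (k : ℕ) (v : Fin k → ℝ), Enumerates A y v := by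
  refine ⟨h.toFinset.card, h.toFinset.orderEmbOfFin rfl, fun i j hij => by simpa using hij,
    fun t => ?_⟩
  have := Set.ext_iff.1 (h.toFinset.range_orderEmbOfFin rfl) t
  simp only [mem_range, Finset.mem_coe, Set.Finite.mem_toFinset, mem_ofPred_eq] at this
  rw [← this]
  exact exists_congr fun i => eq_comm

theorem defP_enumerates {n : ℕ} {A : Set (Fin (n + 1) → ℝ)} (hA : S.IsDef A) (k : ℕ) :
    S.DefP fun p : (Fin n → ℝ) × (Fin k → ℝ) => Enumerates A p.1 p.2 := by
  refine DefP.and (DefP.forall_finite fun i => DefP.forall_finite fun j => (defP_const _).imp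
    (DefP.lt (defMap_snd.apply i) (defMap_snd.apply j))) (DefP.forall ?_)
  exact (IsDef.comp hA (defMap_fst.fst.snocR defMap_snd)).iff (DefP.exists_finite fun i =>
    DefP.eq defMap_snd (defMap_fst.snd.apply i))

open Classical in
/-- The increasing enumeration of the fibres of `A` with `k` elements. -/
noncomputable def enumFun {n : ℕ} (A : Set (Fin (n + 1) → ℝ)) (k : ℕ) (i : Fin k)
    (y : Fin n → ℝ) : ℝ :=
  -- The value `0` plays no role: only base points whose fibre has exactly `k` elements matter
  -- below.
  if h : ∃ v : Fin k → ℝ, Enumerates A y v then h.choose i else 0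

theorem enumFun_eq {n k : ℕ} {A : Set (Fin (n + 1) → ℝ)} {y : Fin n → ℝ} {v : Fin k → ℝ}
    (h : Enumerates A y v) (i : Fin k) : enumFun A k i y = v i := by
  have h' : ∃ v : Fin k → ℝ, Enumerates A y v := ⟨v, h⟩
  rw [enumFun, dif_pos h', h'.choose_spec.eq h]

/-- Increasing enumerations are unique, so the chosen one may be replaced by an existentially
quantified one and the formula stays first order. -/
theorem isDef_graphOver_enumFun {n : ℕ} {A : Set (Fin (n + 1) → ℝ)} (hA : S.IsDef A) {k : ℕ}
    {C : Set (Fin n → ℝ)} (hC : S.IsDef C) (h : ∀ y ∈ C, ∃ v : Fin k → ℝ, Enumerates A y v)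
    (i : Fin k) : S.IsDef (graphOver C (enumFun A k i)) := by
  have h1 : S.DefP fun x : Fin (n + 1) → ℝ => dropLast x ∈ C ∧ ∃ v : Fin k → ℝ,
      Enumerates A (dropLast x) v ∧ x (Fin.last n) = v i := by
    refine (IsDef.comp hC (defMap_id (E := Fin (n + 1) → ℝ)).dropLast).and (DefP.exists ?_)
    exact (DefP.comp (f := fun q : (Fin (n + 1) → ℝ) × (Fin k → ℝ) => (dropLast q.1, q.2))
      (defP_enumerates hA k) (defMap_fst.dropLast.prodMk defMap_snd)).and
        (DefP.eq (defMap_fst.apply _) (defMap_snd.apply i))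
  refine h1.isDef fun x => and_congr_right fun hx => ?_
  obtain ⟨v, hv⟩ := h _ hx
  rw [enumFun_eq hv]
  constructor
  · intro h
    exact ⟨v, hv, h⟩
  · rintro ⟨v', hv', h⟩
    rw [hv.eq hv', h]

/-- Near `y` the points in the fibres of `A` are uniformly separated, and the fibres depend
continuously on the base point at `y`. -/
def FibresContinuousAt {n : ℕ} (A : Set (Fin (n + 1) → ℝ)) (y : Fin n → ℝ) : Prop :=
  (∃ ρ : ℝ, 0 < ρ ∧ ∀ y' : Fin n → ℝ, (0 < ρ ∧ dist y' y < ρ) →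
    ∀ t t' : ℝ, snocR y' t ∈ A → snocR y' t' ∈ A → |t - t'| < ρ → t = t') ∧
  ∀ ε : ℝ, 0 < ε → ∃ δ : ℝ, 0 < δ ∧ ∀ y' : Fin n → ℝ, (0 < δ ∧ dist y' y < δ) →
    (∀ t : ℝ, snocR y t ∈ A → ∃ t' : ℝ, snocR y' t' ∈ A ∧ |t' - t| < ε) ∧
    ∀ t' : ℝ, snocR y' t' ∈ A → ∃ t : ℝ, snocR y t ∈ A ∧ |t' - t| < ε

/-- The condition does not mention the number of points in a fibre, so it is a single formula even
though no uniform bound on that number is known. -/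
theorem isDef_fibresContinuousAt {n : ℕ} {A : Set (Fin (n + 1) → ℝ)} (hA : S.IsDef A) :
    S.IsDef {y | FibresContinuousAt A y} := by
  refine DefP.isDef (DefP.and (DefP.exists (DefP.and (DefP.lt (defMap_const 0) defMap_snd)
    (DefP.forall (DefP.imp (DefP.dist_lt defMap_snd defMap_fst.fst defMap_fst.snd)
    (DefP.forall (DefP.forall (DefP.imp
      (IsDef.comp hA (defMap_fst.fst.snd.snocR defMap_fst.snd)) (DefP.imp
      (IsDef.comp hA (defMap_fst.fst.snd.snocR defMap_snd)) (DefP.imp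
      (DefP.abs_sub_lt defMap_fst.snd defMap_snd defMap_fst.fst.fst.snd)
      (DefP.eq defMap_fst.snd defMap_snd)))))))))) (DefP.forall (DefP.imp
      (DefP.lt (defMap_const 0) defMap_snd) (DefP.exists (DefP.and
      (DefP.lt (defMap_const 0) defMap_snd) (DefP.forall (DefP.imp
      (DefP.dist_lt defMap_snd defMap_fst.fst.fst defMap_fst.snd)
      (DefP.and (DefP.forall (DefP.imp (IsDef.comp hA (defMap_fst.fst.fst.fst.snocR defMap_snd))
        (DefP.exists (DefP.and (IsDef.comp hA (defMap_fst.fst.snd.snocR defMap_snd))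
          (DefP.abs_sub_lt defMap_snd defMap_fst.snd defMap_fst.fst.fst.fst.snd)))))
       (DefP.forall (DefP.imp (IsDef.comp hA (defMap_fst.snd.snocR defMap_snd))
        (DefP.exists (DefP.and (IsDef.comp hA (defMap_fst.fst.fst.fst.fst.snocR defMap_snd))
          (DefP.abs_sub_lt defMap_fst.snd defMap_snd defMap_fst.fst.fst.fst.snd))))))))))))) fun y =>
    Iff.rfl

/-- Closeness of the fibres produces a point `v' i` near each `v i`. Uniform separation preserves
their order and excludes further points. -/
theorem FibresContinuousAt.exists_near {n k : ℕ} {A : Set (Fin (n + 1) → ℝ)} {y : Fin n → ℝ}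
    (h : FibresContinuousAt A y) {v : Fin k → ℝ} (hv : Enumerates A y v) {ε : ℝ} (hε : 0 < ε) :
    ∀ᶠ y' in 𝓝 y, ∃ v' : Fin k → ℝ, Enumerates A y' v' ∧ ∀ i, |v' i - v i| < ε := by
  obtain ⟨⟨ρ, hρ, hsep⟩, hH⟩ := h
  -- With the bound `ρ / 2`, two points near the same `v i` are within `ρ` of each other and hence
  -- equal, while points near `v i < v j`, which are at least `ρ` apart, stay in order.
  obtain ⟨δ, hδ, hδ'⟩ := hH (min ε (ρ / 2)) (by positivity)
  filter_upwards [Metric.ball_mem_nhds y hδ, Metric.ball_mem_nhds y hρ] with y' h1 h2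
  obtain ⟨h3, h4⟩ := hδ' y' ⟨hδ, h1⟩
  choose v' hv' hvv' using fun i => h3 (v i) ((hv.2 _).2 ⟨i, rfl⟩)
  have hlt : ∀ i, |v' i - v i| < ρ / 2 := fun i => (hvv' i).trans_le (min_le_right _ _)
  refine ⟨v', ⟨fun i j hij => ?_, fun t => ⟨fun ht => ?_, ?_⟩⟩,
    fun i => (hvv' i).trans_le (min_le_left _ _)⟩
  · have h5 := hv.1 i j hij
    have h6 : ρ ≤ v j - v i := by
      by_contra! hcon
      exact h5.ne' (hsep y ⟨hρ, by simpa using hρ⟩ _ _ ((hv.2 _).2 ⟨j, rfl⟩) ((hv.2 _).2 ⟨i, rfl⟩)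
        (by rwa [abs_of_pos (by linarith)]))
    have h7 := abs_lt.1 (hlt i)
    have h8 := abs_lt.1 (hlt j)
    linarith [h7.1, h7.2, h8.1, h8.2]
  · obtain ⟨s, hs, hst⟩ := h4 t ht
    obtain ⟨i, rfl⟩ := (hv.2 s).1 hs
    refine ⟨i, hsep y' ⟨hρ, h2⟩ _ _ ht (hv' i) ?_⟩
    have h7 := abs_lt.1 (hlt i)
    have h8 := abs_lt.1 (hst.trans_le (min_le_right _ _))
    rw [abs_lt]
    constructor <;> linarith [h7.1, h7.2, h8.1, h8.2]
  · rintro ⟨i, rfl⟩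
    exact hv' i

variable (S) in
/-- Over `C` the set `A` is a finite disjoint union of graphs of continuous functions. -/
def TrivialFamily {n : ℕ} (A : Set (Fin (n + 1) → ℝ)) (C : Set (Fin n → ℝ)) : Prop :=
  ∃ (k : ℕ) (f : Fin k → (Fin n → ℝ) → ℝ), (∀ i, S.DefContOn C (f i)) ∧
    ∀ y ∈ C, Enumerates A y fun i => f i y

/-- The number of points in a fibre is locally constant at the points of `C`, hence constant on the
connected set `C`. The enumerating functions are continuous by `exists_near`. -/
theorem trivialFamily_of_continuousAt {n : ℕ} {A : Set (Fin (n + 1) → ℝ)} (hA : S.IsDef A)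
    (hfin : ∀ y, {t | snocR y t ∈ A}.Finite) {C : Set (Fin n → ℝ)} (hC : S.IsDef C)
    (hconn : IsPreconnected C) (hne : C.Nonempty) (h : ∀ y ∈ C, FibresContinuousAt A y) :
    S.TrivialFamily A C := by
  choose K v hv using fun y => exists_enumerates (hfin y)
  have hK : ∀ y ∈ C, ∀ᶠ y' in 𝓝 y, K y' = K y := fun y hy => by
    filter_upwards [(h y hy).exists_near (hv y) one_pos] with y' hy'
    obtain ⟨v', hv', -⟩ := hy'
    exact (hv y').card_eq hv'
  obtain ⟨y₀, hy₀⟩ := hne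
  have hconst : ∀ y ∈ C, K y = K y₀ := fun y hy =>
    hconn.constant (fun z hz => (Filter.Tendsto.congr' ((hK z hz).mono fun _ h => h.symm)
      tendsto_const_nhds).mono_left nhdsWithin_le_nhds) hy hy₀
  have hex : ∀ y ∈ C, ∃ w : Fin (K y₀) → ℝ, Enumerates A y w := fun y hy => by
    rw [← hconst y hy]
    exact ⟨v y, hv y⟩
  refine ⟨K y₀, enumFun A (K y₀), fun i => ⟨fun y hy => ?_, isDef_graphOver_enumFun hA hC hex i⟩,
    fun y hy => ?_⟩
  · obtain ⟨w, hw⟩ := hex y hy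
    refine ContinuousAt.continuousWithinAt (Metric.continuousAt_iff'.2 fun ε hε => ?_)
    filter_upwards [(h y hy).exists_near hw hε] with y' hy'
    obtain ⟨v', hv', hlt⟩ := hy'
    rw [enumFun_eq hv', enumFun_eq hw]
    exact hlt i
  · obtain ⟨w, hw⟩ := hex y hy
    have : (fun i => enumFun A (K y₀) i y) = w := funext fun i => enumFun_eq hw i
    rwa [this]

/-- A converse to `exists_near`, used to exhibit points where the family behaves well. -/
theorem fibresContinuousAt_of_continuousAt {n k : ℕ} {A : Set (Fin (n + 1) → ℝ)}
    {y : Fin n → ℝ} {f : Fin k → (Fin n → ℝ) → ℝ} (hf : ∀ i, ContinuousAt (f i) y)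
    (hA : ∀ᶠ y' in 𝓝 y, Enumerates A y' fun i => f i y') : FibresContinuousAt A y := by
  have hlt : ∀ ε : ℝ, 0 < ε → ∀ᶠ y' in 𝓝 y, ∀ i, |f i y' - f i y| < ε := fun ε hε =>
    Filter.eventually_all.2 fun i => Metric.continuousAt_iff'.1 (hf i) ε hε
  have hy := hA.self_of_nhds
  constructor
  -- Gaps larger than `2 * γ` stay larger than `γ` after each point has moved by less than `γ / 2`.
  · obtain ⟨γ, hγ0, hγ⟩ : ∃ γ : ℝ, 0 < γ ∧ ∀ i j, i < j → 2 * γ < f j y - f i y := by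
      have h1 : ∀ᶠ γ in 𝓝[>] (0 : ℝ), ∀ i j, i < j → 2 * γ < f j y - f i y := by
        refine Filter.eventually_all.2 fun i => Filter.eventually_all.2 fun j => ?_
        by_cases hij : i < j
        · have h2 := hy.1 i j hij
          have h3 : Filter.Tendsto (fun γ : ℝ => 2 * γ) (𝓝[>] 0) (𝓝 (2 * 0)) :=
            ((continuous_const.mul continuous_id).tendsto 0).mono_left nhdsWithin_le_nhds
          filter_upwards [h3.eventually_lt_const (show 2 * 0 < f j y - f i y by linarith)]
            with γ hγ _ using hγ
        · exact Filter.Eventually.of_forall fun γ h => absurd h hij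
      obtain ⟨γ, h3, h2⟩ := (h1.and (self_mem_nhdsWithin (s := Ioi (0 : ℝ)))).exists
      exact ⟨γ, h2, h3⟩
    obtain ⟨δ, hδ, hball⟩ := Metric.eventually_nhds_iff.1 (hA.and (hlt (γ / 2) (by positivity)))
    refine ⟨min γ δ, by positivity, fun y' hy' t t' ht ht' htt' => ?_⟩
    obtain ⟨h1, h2⟩ := hball (hy'.2.trans_le (min_le_right _ _))
    obtain ⟨i, rfl⟩ := (h1.2 t).1 ht
    obtain ⟨j, rfl⟩ := (h1.2 t').1 ht'
    have h3 := abs_lt.1 (htt'.trans_le (min_le_left _ _))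
    have h4 := abs_lt.1 (h2 i)
    have h5 := abs_lt.1 (h2 j)
    rcases lt_trichotomy i j with hij | rfl | hij
    · linarith [hγ i j hij, h3.1, h3.2, h4.1, h4.2, h5.1, h5.2]
    · rfl
    · linarith [hγ j i hij, h3.1, h3.2, h4.1, h4.2, h5.1, h5.2]
  · intro ε hε
    obtain ⟨δ, hδ, hball⟩ := Metric.eventually_nhds_iff.1 (hA.and (hlt ε hε))
    refine ⟨δ, hδ, fun y' hy' => ?_⟩
    obtain ⟨h1, h2⟩ := hball hy'.2
    constructor
    · intro t ht
      obtain ⟨i, rfl⟩ := (hy.2 t).1 ht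
      exact ⟨f i y', (h1.2 _).2 ⟨i, rfl⟩, h2 i⟩
    · intro t ht
      obtain ⟨i, rfl⟩ := (h1.2 t).1 ht
      exact ⟨f i y, (hy.2 _).2 ⟨i, rfl⟩, h2 i⟩

/-- Baire is used twice. On a nonempty open set of bad points some fibre size `k` would be constant
on a smaller nonempty open set. There the `k` enumerating functions are definable, so they have a
common point of continuity, and that point is not bad. -/
theorem interior_not_fibresContinuousAt {n : ℕ} {A : Set (Fin (n + 1) → ℝ)} (hA : S.IsDef A)
    (hfin : ∀ y, {t | snocR y t ∈ A}.Finite) :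
    interior {y | ¬ FibresContinuousAt A y} = ∅ := by
  by_contra hcon
  have hV₀ : S.IsDef (interior {y | ¬ FibresContinuousAt A y}) :=
    isDef_interior (S.compl (isDef_fibresContinuousAt hA))
  set V₀ := interior {y | ¬ FibresContinuousAt A y} with hV₀def
  have hB : ∀ k : ℕ, S.IsDef {y | ∃ v : Fin k → ℝ, Enumerates A y v} := fun k =>
    DefP.isDef (DefP.exists (defP_enumerates hA k)) fun y => Iff.rfl
  obtain ⟨k, hk⟩ := (S.interiorOrNowhereDense n).exists_interior hB isOpen_interior
    (nonempty_iff_ne_empty.2 hcon) (V := V₀) fun y _ => by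
      obtain ⟨k, v, hv⟩ := exists_enumerates (hfin y)
      exact mem_iUnion.2 ⟨k, v, hv⟩
  set V := V₀ ∩ interior {y | ∃ v : Fin k → ℝ, Enumerates A y v} with hV
  have hVo : IsOpen V := isOpen_interior.inter isOpen_interior
  have hex : ∀ y ∈ V, ∃ v : Fin k → ℝ, Enumerates A y v := fun y hy =>
    (interior_subset hy.2 : y ∈ {y | ∃ v : Fin k → ℝ, Enumerates A y v})
  have hmeagre : IsMeagre (⋃ i : Fin k, {y ∈ V | ¬ ContinuousAt (enumFun A k i) y}) :=
    isMeagre_iUnion fun i => isMeagre_not_continuousAt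
      (isDef_graphOver_enumFun hA (S.inter hV₀ (isDef_interior (hB k))) hex i)
  obtain ⟨y, hyV, hy⟩ : ∃ y ∈ V, ∀ i : Fin k, ContinuousAt (enumFun A k i) y := by
    by_contra! hcon
    refine not_isMeagre_of_isOpen hVo hk (hmeagre.mono fun y hy => ?_)
    obtain ⟨i, hi⟩ := hcon y hy
    exact mem_iUnion.2 ⟨i, hy, hi⟩
  refine interior_subset hyV.1 (fibresContinuousAt_of_continuousAt hy ?_)
  filter_upwards [hVo.mem_nhds hyV] with y' hy'
  obtain ⟨w, hw⟩ := hex y' hy'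
  have : (fun i => enumFun A k i y') = w := funext fun i => enumFun_eq hw i
  rwa [this]

/-- A definable family of finite sets is trivial over each cell of some partition. -/
theorem partCells_trivialFamily {n : ℕ}
    (hI : ∀ m ≤ n, ∀ X : Set (Fin m → ℝ), S.IsDef X → S.PartCells (fun _ => True) X)
    {A : Set (Fin (n + 1) → ℝ)} (hA : S.IsDef A) (hfin : ∀ y, {t | snocR y t ∈ A}.Finite)
    {X : Set (Fin n → ℝ)} (hX : S.IsDef X) : S.PartCells (S.TrivialFamily A) X := by
  induction n using Nat.strong_induction_on with
  | _ n ih =>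
    have hG := isDef_fibresContinuousAt hA
    set G := {y | FibresContinuousAt A y} with hGdef
    rw [← inter_union_sdiff X G]
    refine PartCells.union (disjoint_sdiff_right.mono_left inter_subset_right) ?_ ?_
    · refine (hI n le_rfl _ (S.inter hX hG)).bind fun C hC d hd _ => PartCells.of_isCell hd ?_
      exact trivialFamily_of_continuousAt hA hfin hd.isDef hd.isPreconnected hd.nonempty
        fun y hy => (hC hy).2
    · refine (hI n le_rfl _ (S.diff hX hG)).bind fun C hC d hd _ => ?_
      -- A cell of dimension `n` is open, so it cannot consist of bad points.
      have hdn : d < n := by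
        refine lt_of_le_of_ne hd.dim_le fun h => ?_
        obtain ⟨y, hy⟩ := hd.nonempty
        have h1 : C ⊆ interior {y | ¬ FibresContinuousAt A y} :=
          interior_maximal (fun y hy => (hC hy).2) (hd.isOpen h)
        rw [interior_not_fibresContinuousAt hA hfin] at h1
        exact h1 hy
      -- The cell is projected injectively to `ℝᵈ` and the family is carried along as `A'`, which is
      -- empty off the projection. The induction hypothesis applies there, and the resulting cells
      -- are pulled back.
      obtain ⟨e, q, hq, hqc, hcell, hpull⟩ := hd.exists_proj
      set P := (fun (x : Fin n → ℝ) i => x (e i)) '' C with hP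
      let A' : Set (Fin (d + 1) → ℝ) := {z | ∃ x : Fin n → ℝ, x ∈ C ∧
        dropLast z = (fun i => x (e i)) ∧ snocR x (z (Fin.last d)) ∈ A}
      have hA' : S.IsDef A' := by
        refine DefP.isDef (DefP.exists (DefP.and (IsDef.comp hd.isDef defMap_snd) (DefP.and
          (DefP.eq defMap_fst.dropLast (DefMap.pi fun i => defMap_snd.apply (e i)))
          (IsDef.comp hA (defMap_snd.snocR (defMap_fst.apply _)))))) fun z => Iff.rfl
      have hmem : ∀ x ∈ C, ∀ t, snocR (fun i => x (e i)) t ∈ A' ↔ snocR x t ∈ A := by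
        intro x hx t
        simp only [A', mem_ofPred_eq, dropLast_snocR, snocR_last]
        constructor
        · rintro ⟨x', hx', hxx', h⟩
          have : x = x' := by rw [← hq x hx, ← hq x' hx', hxx']
          rwa [this]
        · exact fun h => ⟨x, hx, rfl, h⟩
      have hfin' : ∀ z, {t | snocR z t ∈ A'}.Finite := by
        intro z
        by_cases hz : z ∈ P
        · obtain ⟨x, hx, rfl⟩ := hz
          exact (hfin x).subset fun t ht => (hmem x hx t).1 ht
        · refine (finite_empty (α := ℝ)).subset ?_
          rintro t ⟨x, hx, hxz, -⟩
          rw [dropLast_snocR] at hxz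
          exact hz ⟨x, hx, hxz.symm⟩
      have h1 := ih d hdn (fun m hm => hI m (hm.trans hdn.le)) hA' hfin' hcell.isDef
      have h2 := PartCells.map (P := S.TrivialFamily A) h1
        (fun D => {x | x ∈ C ∧ (fun i => x (e i)) ∈ D}) ?_ ?_ ?_
      · have h3 : {x | x ∈ C ∧ (fun i => x (e i)) ∈ P} = C := by
          ext x
          exact ⟨fun h => h.1, fun h => ⟨h, x, h, rfl⟩⟩
        rwa [h3] at h2
      · intro D D' hDD'
        rw [Set.disjoint_left] at hDD' ⊢
        exact fun x hx hx' => hDD' hx.2 hx'.2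
      · rintro D hDP k hD ⟨l, f, hf, hfe⟩
        have hcell' := hpull k D hDP hD
        refine ⟨⟨k, hcell'⟩, l, fun i x => f i fun j => x (e j), fun i => ?_, fun y hy => ?_⟩
        · refine (hf i).comp (continuous_pi fun i => continuous_apply _).continuousOn ?_
            fun x hx => hx.2
          exact (IsDef.comp hcell'.isDef defMap_fst).and
            (DefP.eq defMap_snd (DefMap.pi fun i => defMap_fst.apply (e i)))
        · have h3 := hfe _ hy.2
          exact ⟨h3.1, fun t => (hmem y hy.1 t).symm.trans (h3.2 t)⟩
      · intro F
        ext x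
        simp only [mem_sUnion, mem_image, exists_exists_and_eq_and, mem_ofPred_eq]
        constructor
        · rintro ⟨D, hD, hx, hxD⟩
          exact ⟨hx, D, hD, hxD⟩
        · rintro ⟨hx, D, hD, hxD⟩
          exact ⟨D, hD, hx, hxD⟩

/-! ### The cell decomposition theorem -/

/-- The points that lie in the frontier of the fibre of `A` through them. -/
def fibreFrontier {n : ℕ} (A : Set (Fin (n + 1) → ℝ)) : Set (Fin (n + 1) → ℝ) :=
  {x | x (Fin.last n) ∈ frontier {t | snocR (dropLast x) t ∈ A}}

theorem mem_fibreFrontier {n : ℕ} {A : Set (Fin (n + 1) → ℝ)} {y : Fin n → ℝ} {t : ℝ} :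
    snocR y t ∈ fibreFrontier A ↔ t ∈ frontier {t | snocR y t ∈ A} := by
  simp [fibreFrontier]

theorem isDef_fibreFrontier {n : ℕ} {A : Set (Fin (n + 1) → ℝ)} (hA : S.IsDef A) :
    S.IsDef (fibreFrontier A) := by
  have h1 : S.DefP fun x : Fin (n + 1) → ℝ => ∀ ε : ℝ, 0 < ε →
      (∃ s : ℝ, snocR (dropLast x) s ∈ A ∧ |x (Fin.last n) - s| < ε) ∧
        ∃ s : ℝ, snocR (dropLast x) s ∉ A ∧ |x (Fin.last n) - s| < ε := by
    refine DefP.forall (DefP.imp (DefP.lt (defMap_const 0) defMap_snd)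
      (DefP.and (DefP.exists ?_) (DefP.exists ?_)))
    · exact (IsDef.comp hA (defMap_fst.fst.dropLast.snocR defMap_snd)).and
        (DefP.abs_sub_lt (defMap_fst.fst.apply _) defMap_snd defMap_fst.snd)
    · exact (IsDef.comp hA (defMap_fst.fst.dropLast.snocR defMap_snd)).not.and
        (DefP.abs_sub_lt (defMap_fst.fst.apply _) defMap_snd defMap_fst.snd)
  refine h1.isDef fun x => ?_
  rw [fibreFrontier, mem_ofPred_eq, frontier_eq_closure_inter_closure, mem_inter_iff,
    Metric.mem_closure_iff, Metric.mem_closure_iff]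
  constructor
  · rintro ⟨h2, h3⟩ ε hε
    exact ⟨h2 ε hε, h3 ε hε⟩
  · exact fun h => ⟨fun ε hε => (h ε hε).1, fun ε hε => (h ε hε).2⟩

/-- A connected set that avoids the frontier lies in the interior of `T` or in its exterior; the
point `t₀` decides which. -/
theorem subset_or_disjoint_of_frontier {s T : Set ℝ} (hs : IsPreconnected s)
    (h : ∀ t ∈ s, t ∉ frontier T) {t₀ : ℝ} (ht₀ : t₀ ∈ s) (ht₀' : t₀ ∈ T) : s ⊆ T := by
  have h1 : s ⊆ interior T ∪ (closure T)ᶜ := fun t ht => by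
    by_cases h2 : t ∈ closure T
    · exact Or.inl (by_contra fun h3 => h t ht ⟨h2, h3⟩)
    · exact Or.inr h2
  refine (hs.subset_left_of_subset_union isOpen_interior isClosed_closure.isOpen_compl ?_ h1
    ⟨t₀, ht₀, ?_⟩).trans interior_subset
  · exact disjoint_compl_right.mono_left (interior_subset.trans subset_closure)
  · by_contra h3
    exact h t₀ ht₀ ⟨subset_closure ht₀', h3⟩

theorem partCells_graphOver {n : ℕ} {B Y : Set (Fin n → ℝ)} {f : (Fin n → ℝ) → ℝ}
    (hB : S.PartCells (fun _ => True) B) (hBY : B ⊆ Y) (hf : S.DefContOn Y f) :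
    S.PartCells (fun _ => True) (graphOver B f) := by
  refine hB.map (fun D => graphOver D f) (fun D D' h => ?_) (fun D hD d hd _ => ?_) fun F => ?_
  · rw [Set.disjoint_left] at h ⊢
    exact fun x hx hx' => h hx.1 hx'.1
  · exact ⟨⟨d, IsCell.graph hd (hf.mono hd.isDef (hD.trans hBY))⟩, trivial⟩
  · ext x
    simp only [mem_sUnion, mem_image, exists_exists_and_eq_and, graphOver, mem_ofPred_eq]
    tauto

theorem partCells_bandOver {n : ℕ} {B Y : Set (Fin n → ℝ)} {f g : (Fin n → ℝ) → EReal}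
    (hB : S.PartCells (fun _ => True) B) (hBY : B ⊆ Y) (hf : S.IsBound ⊥ Y f)
    (hg : S.IsBound ⊤ Y g) (hfg : ∀ y ∈ Y, f y < g y) :
    S.PartCells (fun _ => True) (bandOver B f g) := by
  refine hB.map (fun D => bandOver D f g) (fun D D' h => ?_) (fun D hD d hd _ => ?_) fun F => ?_
  · rw [Set.disjoint_left] at h ⊢
    exact fun x hx hx' => h hx.1 hx'.1
  · exact ⟨⟨d + 1, IsCell.band hd (hf.mono hd.isDef (hD.trans hBY))
      (hg.mono hd.isDef (hD.trans hBY)) fun y hy => hfg y (hBY (hD hy))⟩, trivial⟩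
  · ext x
    simp only [mem_sUnion, mem_image, exists_exists_and_eq_and, bandOver, mem_ofPred_eq]
    constructor
    · rintro ⟨D, hD, h1, h2⟩
      exact ⟨⟨D, hD, h1⟩, h2⟩
    · rintro ⟨⟨D, hD, h1⟩, h2⟩
      exact ⟨D, hD, h1, h2⟩

/-- The frontier points cut each vertical line over `C` into `k` points and `k + 1` open intervals,
and each of these pieces lies in `A` or misses it. So `A` meets every graph or band exactly over a
definable subset of `C`, which `hI` cuts into cells. -/
theorem partCells_over_trivialFamily {n d : ℕ}
    (hI : ∀ X : Set (Fin n → ℝ), S.IsDef X → S.PartCells (fun _ => True) X)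
    {A : Set (Fin (n + 1) → ℝ)} (hA : S.IsDef A) {C : Set (Fin n → ℝ)} (hC : S.IsCell d C)
    (h : S.TrivialFamily (fibreFrontier A) C) :
    S.PartCells (fun _ => True) (A ∩ dropLast ⁻¹' C) := by
  obtain ⟨k, f, hf, hfe⟩ := h
  have hmono : ∀ y ∈ C, StrictMono fun i => f i y := fun y hy i j => (hfe y hy).1 i j
  -- The interval with index `j` runs from `f (j - 1)` to `f j`; the outer ends `lo 0` and `hi k`
  -- are infinite.
  let lo : Fin (k + 1) → (Fin n → ℝ) → EReal :=
    fun j y => Fin.cases ⊥ (fun i => (f i y : EReal)) j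
  let hi : Fin (k + 1) → (Fin n → ℝ) → EReal :=
    fun j y => Fin.lastCases ⊤ (fun i => (f i y : EReal)) j
  have lo_zero : ∀ y, lo 0 y = ⊥ := fun y => rfl
  have lo_succ : ∀ i y, lo (Fin.succ i) y = f i y := fun i y => rfl
  have hi_last : ∀ y, hi (Fin.last k) y = ⊤ := fun y => by simp [hi]
  have hi_castSucc : ∀ i y, hi (Fin.castSucc i) y = f i y := fun i y => by simp [hi]
  have hlo : ∀ j, S.IsBound ⊥ C (lo j) := fun j => by
    refine Fin.cases (Or.inr fun y _ => lo_zero y) (fun i => Or.inl ⟨f i, hf i, fun y _ => ?_⟩) j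
    exact lo_succ i y
  have hhi : ∀ j, S.IsBound ⊤ C (hi j) := fun j => by
    refine Fin.lastCases (Or.inr fun y _ => hi_last y)
      (fun i => Or.inl ⟨f i, hf i, fun y _ => ?_⟩) j
    exact hi_castSucc i y
  have hle : ∀ y ∈ C, ∀ j j' : Fin (k + 1), j < j' → hi j y ≤ lo j' y := by
    intro y hy j j'
    refine Fin.cases (fun h => absurd h (Fin.not_lt_zero _)) (fun i' => ?_) j'
    refine Fin.lastCases (fun h => absurd h (not_lt.2 (Fin.le_last _))) (fun i h => ?_) j
    rw [hi_castSucc, lo_succ, EReal.coe_le_coe_iff]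
    exact (hmono y hy).monotone (Fin.castSucc_lt_succ_iff.1 h)
  have hlt : ∀ y ∈ C, ∀ j : Fin (k + 1), lo j y < hi j y := by
    intro y hy j
    refine Fin.cases ?_ (fun i => ?_) j
    · rw [lo_zero, bot_lt_iff_ne_bot]
      cases k with
      | zero => exact (hi_last y).symm ▸ top_ne_bot
      | succ k => exact (hi_castSucc 0 y).symm ▸ EReal.coe_ne_bot _
    · rw [lo_succ]
      induction h : i.succ using Fin.lastCases with
      | last => rw [hi_last]; exact EReal.coe_lt_top _
      | cast i' =>
        rw [hi_castSucc, EReal.coe_lt_coe_iff]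
        refine hmono y hy ?_
        rw [Fin.lt_def]
        have := congrArg Fin.val h
        simp at this
        omega
  have hcover : ∀ y ∈ C, ∀ t : ℝ, (∀ i, t ≠ f i y) →
      ∃ j, lo j y < t ∧ (t : EReal) < hi j y := by
    intro y hy t ht
    -- The least interval whose upper end exceeds `t` works: by minimality `t` is not below the
    -- previous upper end, which is the lower end of this one.
    obtain ⟨j, hj, hmin⟩ := WellFounded.has_min (wellFounded_lt (α := Fin (k + 1)))
      {j | (t : EReal) < hi j y} ⟨Fin.last k, by simp [hi_last]⟩
    refine ⟨j, ?_, hj⟩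
    induction j using Fin.cases with
    | zero => exact EReal.bot_lt_coe t
    | succ i =>
      rw [lo_succ, EReal.coe_lt_coe_iff]
      have h2 : ¬ (t : EReal) < hi i.castSucc y := fun h2 =>
        hmin _ h2 (Fin.castSucc_lt_succ)
      rw [hi_castSucc, EReal.coe_lt_coe_iff, not_lt] at h2
      exact lt_of_le_of_ne h2 (ht i).symm
  have hnot : ∀ y ∈ C, ∀ (t : ℝ) (j : Fin (k + 1)), lo j y < t → (t : EReal) < hi j y →
      ∀ i, t ≠ f i y := by
    rintro y hy t j h1 h2 i rfl
    rcases lt_or_ge i.castSucc j with h3 | h3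
    · have := hle y hy _ _ h3
      rw [hi_castSucc] at this
      exact absurd h1 (not_lt.2 this)
    · have := hle y hy j i.succ (h3.trans_lt Fin.castSucc_lt_succ)
      rw [lo_succ] at this
      exact absurd h2 (not_lt.2 this)
  let X : Fin k ⊕ Fin (k + 1) → Set (Fin (n + 1) → ℝ) :=
    Sum.elim (fun i => A ∩ graphOver C (f i)) fun j => A ∩ bandOver C (lo j) (hi j)
  have hX : A ∩ dropLast ⁻¹' C = ⋃ i, X i := by
    ext x
    simp only [mem_iUnion, Sum.exists, X, Sum.elim_inl, Sum.elim_inr]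
    constructor
    · rintro ⟨hxA, hxC⟩
      by_cases h1 : ∃ i, x (Fin.last n) = f i (dropLast x)
      · obtain ⟨i, hi⟩ := h1
        exact Or.inl ⟨i, hxA, hxC, hi⟩
      · push Not at h1
        obtain ⟨j, hj⟩ := hcover _ hxC _ h1
        exact Or.inr ⟨j, hxA, hxC, hj⟩
    · rintro (⟨i, h1, h2⟩ | ⟨j, h1, h2⟩)
      · exact ⟨h1, h2.1⟩
      · exact ⟨h1, h2.1⟩
  rw [hX]
  refine PartCells.iUnion ?_ ?_
  · have hgb : ∀ i j, Disjoint (A ∩ graphOver C (f i)) (A ∩ bandOver C (lo j) (hi j)) := by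
      intro i j
      rw [Set.disjoint_left]
      rintro x ⟨-, h1, h2⟩ ⟨-, -, h3, h4⟩
      exact hnot _ h1 _ j h3 h4 i h2
    rintro (i | i) (j | j) hij
    · refine Set.disjoint_left.2 ?_
      rintro x ⟨-, h1, h2⟩ ⟨-, -, h3⟩
      exact hij (congrArg Sum.inl ((hmono _ h1).injective (h2.symm.trans h3)))
    · exact hgb i j
    · exact (hgb j i).symm
    · refine Set.disjoint_left.2 ?_
      rintro x ⟨-, h1, h2, h3⟩ ⟨-, -, h4, h5⟩
      rcases lt_trichotomy i j with h6 | h6 | h6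
      · exact absurd (h3.trans_le (hle _ h1 _ _ h6)) (not_lt.2 h4.le)
      · exact hij (congrArg Sum.inr h6)
      · exact absurd (h5.trans_le (hle _ h1 _ _ h6)) (not_lt.2 h2.le)
  · rintro (i | j)
    · change S.PartCells _ (A ∩ graphOver C (f i))
      have h1 : A ∩ graphOver C (f i) =
          graphOver (dropLast '' (A ∩ graphOver C (f i))) (f i) := by
        ext x
        constructor
        · exact fun hx => ⟨⟨x, hx, rfl⟩, hx.2.2⟩
        · rintro ⟨⟨z, hz, hzx⟩, hx⟩
          have : z = x := by
            rw [← snocR_dropLast z, ← snocR_dropLast x, hz.2.2, hx, hzx]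
          rwa [← this]
      have h2 : dropLast '' (A ∩ graphOver C (f i)) ⊆ C := by
        rintro _ ⟨x, hx, rfl⟩
        exact hx.2.1
      rw [h1]
      exact partCells_graphOver (hI _ (S.proj (S.inter hA (hf i).2))) h2 (hf i)
    · change S.PartCells _ (A ∩ bandOver C (lo j) (hi j))
      have h1 : A ∩ bandOver C (lo j) (hi j) =
          bandOver (dropLast '' (A ∩ bandOver C (lo j) (hi j))) (lo j) (hi j) := by
        ext x
        constructor
        · exact fun hx => ⟨⟨x, hx, rfl⟩, hx.2.2⟩
        · rintro ⟨⟨z, hz, hzx⟩, hx⟩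
          have hxC : dropLast x ∈ C := hzx ▸ hz.2.1
          refine ⟨?_, hxC, hx⟩
          -- The open interval contains no frontier point of the fibre, so membership of `z` in `A`
          -- spreads to all heights in it.
          have hconn : IsPreconnected {t : ℝ | lo j (dropLast x) < t ∧
              (t : EReal) < hi j (dropLast x)} := by
            refine OrdConnected.isPreconnected ⟨fun a ha b hb c hc => ⟨?_, ?_⟩⟩
            · exact ha.1.trans_le (EReal.coe_le_coe_iff.2 hc.1)
            · exact (EReal.coe_le_coe_iff.2 hc.2).trans_lt hb.2
          have h3 := subset_or_disjoint_of_frontier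
            (T := {t | snocR (dropLast x) t ∈ A}) hconn (fun t ht hfr => ?_)
            (t₀ := z (Fin.last n)) (hzx ▸ hz.2.2) (by
              change snocR (dropLast x) (z (Fin.last n)) ∈ A
              rw [← hzx, snocR_dropLast]
              exact hz.1) hx
          · simpa using h3
          · obtain ⟨i, hi⟩ := ((hfe _ hxC).2 t).1 (mem_fibreFrontier.2 hfr)
            exact hnot _ hxC t j ht.1 ht.2 i hi
      have h2 : dropLast '' (A ∩ bandOver C (lo j) (hi j)) ⊆ C := by
        rintro _ ⟨x, hx, rfl⟩
        exact hx.2.1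
      rw [h1]
      exact partCells_bandOver (hI _ (S.proj (S.inter hA
        (isDef_bandOver hC.isDef (hlo j) (hhi j))))) h2 (hlo j) (hhi j) fun y hy => hlt y hy j

/-- The cell decomposition theorem: every definable set is a finite disjoint union of cells. -/
theorem partCells_of_isDef {n : ℕ} {X : Set (Fin n → ℝ)} (hX : S.IsDef X) :
    S.PartCells (fun _ => True) X := by
  induction n using Nat.strong_induction_on with
  | _ n ih =>
    cases n with
    | zero =>
      rcases X.eq_empty_or_nonempty with rfl | ⟨x, hx⟩
      · exact ⟨∅, finite_empty, pairwiseDisjoint_empty, sUnion_empty, fun C hC => absurd hC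
          (notMem_empty C)⟩
      · have : X = univ := by
          ext y
          simpa [Subsingleton.elim y x] using hx
        rw [this]
        exact PartCells.of_isCell IsCell.point trivial
    | succ n =>
      have huniv : S.IsDef (univ : Set (Fin n → ℝ)) := by
        simpa using S.compl (S.empty n)
      -- The frontiers of the fibres are finite by tameness, so the base splits into cells over
      -- which they are graphs of continuous functions.
      obtain ⟨F, h1, h2, h3, h4⟩ := partCells_trivialFamily
        (fun m hm X hX => ih m (Nat.lt_succ_of_le hm) hX) (isDef_fibreFrontier hX)
        (fun y => by
          simp only [mem_fibreFrontier]
          exact (isTameSet_fiber hX y).finite_frontier) huniv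
      have h5 : X = ⋃ C : F, X ∩ dropLast ⁻¹' C.1 := by
        rw [← inter_iUnion, ← preimage_iUnion, ← sUnion_eq_iUnion, h3, preimage_univ, inter_univ]
      have : Finite F := h1
      rw [h5]
      refine PartCells.iUnion ?_ ?_
      · intro C D hCD
        have h6 := h2 C.2 D.2 fun h => hCD (Subtype.ext h)
        exact (Disjoint.preimage dropLast h6).mono inter_subset_right inter_subset_right
      · intro C
        obtain ⟨⟨d, hd⟩, hT⟩ := h4 C.1 C.2
        exact partCells_over_trivialFamily (fun X hX => ih n (Nat.lt_succ_self n) hX) hX hd hT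

end OMinimalStructure

/-! ### Invariance of the Euler characteristic -/

namespace OMinimalStructure

variable {S : OMinimalStructure}

/-- `J` is empty, a point or an open interval, of Euler characteristic `ε`. -/
def LineCell (J : Set ℝ) (ε : ℤ) : Prop :=
  (J = ∅ ∧ ε = 0) ∨ (∃ s : ℝ, J = {s} ∧ ε = 1) ∨
    ∃ l r : EReal, l < r ∧ J = {t : ℝ | l < t ∧ (t : EReal) < r} ∧ ε = -1

open Classical in
/-- The Euler characteristic of a subset of `ℝ`, computed from the jumps at `T`. -/
noncomputable def jumpSum (T : Finset ℝ) (δ m : ℝ) (J : Set ℝ) : ℤ :=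
  (∑ t ∈ T, ((if t ∈ J then 1 else 0) - if t + δ ∈ J then 1 else 0)) - if m ∈ J then 1 else 0

/-- For an open interval the jump from `t` to `t + δ` is nonzero only at the left end, where it
contributes `-1`. If that end is `-∞`, the point `m` to the left of `T` contributes instead. A
single point contributes `1`. The formula is useful because it is linear in the indicator function
of `J`, and because one `T` serves many sets at once. -/
theorem LineCell.exists_finset {J : Set ℝ} {ε : ℤ} (hJ : LineCell J ε) :
    ∃ T₀ : Finset ℝ, ∀ T : Finset ℝ, T₀ ⊆ T → ∀ δ m : ℝ, 0 < δ →
      (∀ t ∈ T, ∀ t' ∈ T, t < t' → t + δ < t') → (∀ t ∈ T, m < t) → jumpSum T δ m J = ε := by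
  classical
  rcases hJ with ⟨rfl, rfl⟩ | ⟨s, rfl, rfl⟩ | ⟨l, r, hlr, hJ, rfl⟩
  · exact ⟨∅, fun T _ δ m _ _ _ => by simp [jumpSum]⟩
  · refine ⟨{s}, fun T hT δ m hδ hsep hm => ?_⟩
    have hs : s ∈ T := hT (Finset.mem_singleton_self s)
    have h1 : ∀ t ∈ T, t + δ ≠ s := fun t ht h => by
      have := hsep t ht s hs (by linarith)
      linarith
    have h2 : m ≠ s := (hm s hs).ne
    have h3 : ∑ t ∈ T, (if t + δ = s then (1 : ℤ) else 0) = 0 :=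
      Finset.sum_eq_zero fun t ht => if_neg (h1 t ht)
    simp [jumpSum, h2, Finset.sum_sub_distrib, h3, hs]
  -- Infinite ends add only the point `0`, and superfluous points of `T` have jump zero.
  · refine ⟨{l.toReal, r.toReal}, fun T hT δ m hδ hsep hm => ?_⟩
    have hl : ∀ x : ℝ, l = x → x ∈ T := fun x hx => hT (by simp [hx])
    have hr : ∀ x : ℝ, r = x → x ∈ T := fun x hx => hT (by simp [hx])
    have memJ : ∀ t, t ∈ J ↔ l < t ∧ (t : EReal) < r := fun t => by rw [hJ]; rfl
    clear hJ
    have hδ' : ∀ t : ℝ, (t : EReal) < (t + δ : ℝ) := fun t =>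
      EReal.coe_lt_coe_iff.2 (by linarith)
    -- A step of length `δ` from a point of `T` never reaches the next end point, as finite end
    -- points belong to `T`.
    have hstep : ∀ c : EReal, (∀ x : ℝ, c = x → x ∈ T) → ∀ t ∈ T, (t : EReal) < c →
        ((t + δ : ℝ) : EReal) < c := by
      intro c hc t ht htc
      induction c with
      | bot => exact absurd htc not_lt_bot
      | coe x =>
        rw [EReal.coe_lt_coe_iff] at htc ⊢
        exact hsep t ht x (hc x rfl) htc
      | top => exact EReal.coe_lt_top _
    have h1 : ∀ t ∈ T, ((if t ∈ J then (1 : ℤ) else 0) - if t + δ ∈ J then 1 else 0) =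
        if (t : EReal) = l then -1 else 0 := by
      intro t ht
      rcases lt_trichotomy (t : EReal) l with h | h | h
      · have h2 : t ∉ J := fun h3 => ((memJ _).1 h3).1.not_gt h
        have h3 : t + δ ∉ J := fun h3 => ((memJ _).1 h3).1.not_gt (hstep l hl t ht h)
        simp [h2, h3, h.ne]
      · have h2 : t ∉ J := fun h3 => ((memJ _).1 h3).1.ne' h
        have h3 : t + δ ∈ J := (memJ _).2 ⟨h ▸ hδ' t, hstep r hr t ht (h ▸ hlr)⟩
        simp [h2, h3, h]
      · have h2 : t ∈ J ↔ t + δ ∈ J := by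
          rw [memJ, memJ]
          exact ⟨fun h3 => ⟨h.trans (hδ' t), hstep r hr t ht h3.2⟩, fun h3 => ⟨h, (hδ' t).trans h3.2⟩⟩
        simp [h2, h.ne']
    have hmr : (m : EReal) < r := by
      induction r with
      | bot => exact absurd hlr not_lt_bot
      | coe x => exact EReal.coe_lt_coe_iff.2 (hm x (hr x rfl))
      | top => exact EReal.coe_lt_top _
    rw [jumpSum, Finset.sum_congr rfl h1]
    induction l with
    | bot =>
      have h2 : m ∈ J := (memJ _).2 ⟨EReal.bot_lt_coe m, hmr⟩
      simp [h2]
    | coe x =>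
      have hx := hl x rfl
      have h2 : m ∉ J := fun h => (EReal.coe_lt_coe_iff.1 ((memJ _).1 h).1).not_gt (hm x hx)
      simp [h2, EReal.coe_eq_coe_iff, hx]
    | top => exact absurd hlr not_top_lt

open Classical in
-- Evaluated with a common `T`, `δ` and `m`, the sum becomes a combination of values of the function
-- `∑ i, a i * 1_{J i}`, which vanishes everywhere.
theorem sum_eq_zero_of_lineCell {ι : Type*} [Fintype ι] {J : ι → Set ℝ} {ε a : ι → ℤ}
    (hJ : ∀ i, LineCell (J i) (ε i)) (h : ∀ t, ∑ i, (if t ∈ J i then a i else 0) = 0) :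
    ∑ i, a i * ε i = 0 := by
  choose T₀ hT₀ using fun i => (hJ i).exists_finset
  let T := Finset.univ.biUnion T₀
  obtain ⟨δ, hsep, hδ⟩ : ∃ δ : ℝ, (∀ t ∈ T, ∀ t' ∈ T, t < t' → t + δ < t') ∧ 0 < δ := by
    have h1 : ∀ᶠ δ in 𝓝[>] (0 : ℝ), ∀ t ∈ T, ∀ t' ∈ T, t < t' → t + δ < t' := by
      refine (Filter.eventually_all_finset T).2 fun t _ =>
        (Filter.eventually_all_finset T).2 fun t' _ => ?_
      by_cases htt' : t < t'
      · have h3 : Filter.Tendsto (fun δ : ℝ => t + δ) (𝓝[>] 0) (𝓝 (t + 0)) :=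
          ((continuous_const.add continuous_id).tendsto 0).mono_left nhdsWithin_le_nhds
        filter_upwards [h3.eventually_lt_const (show t + 0 < t' by linarith)] with δ hδ _ using hδ
      · exact Filter.Eventually.of_forall fun _ h => absurd h htt'
    obtain ⟨δ, h2, h3⟩ := (h1.and (self_mem_nhdsWithin (s := Ioi (0 : ℝ)))).exists
    exact ⟨δ, h2, h3⟩
  -- The lower bound `b` may lie in `T`, so `b - 1` is used as the point strictly to the left.
  obtain ⟨b, hb⟩ := T.finite_toSet.bddBelow
  have hm : ∀ t ∈ T, b - 1 < t := fun t ht => by linarith [hb ht]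
  have key : ∀ i, ε i = jumpSum T δ (b - 1) (J i) := fun i =>
    (hT₀ i T (Finset.subset_biUnion_of_mem T₀ (Finset.mem_univ i)) δ (b - 1) hδ hsep hm).symm
  have h' : ∀ t, ∑ i, a i * (if t ∈ J i then 1 else 0) = 0 := fun t => by
    simpa using h t
  calc ∑ i, a i * ε i = ∑ i, ((∑ t ∈ T, (a i * (if t ∈ J i then 1 else 0) -
        a i * if t + δ ∈ J i then 1 else 0)) - a i * if b - 1 ∈ J i then 1 else 0) := by
        refine Finset.sum_congr rfl fun i _ => ?_
        rw [key, jumpSum, mul_sub, Finset.mul_sum]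
        simp only [mul_sub]
    _ = 0 := by
        rw [Finset.sum_sub_distrib, h', Finset.sum_comm]
        simp only [Finset.sum_sub_distrib, h']
        simp

/-- A Fubini property: all fibres over the base have the same Euler characteristic, `1` for a graph
and `-1` for a band. -/
theorem IsCell.exists_base {n d : ℕ} {C : Set (Fin (n + 1) → ℝ)} (hC : S.IsCell d C) :
    ∃ (Y : Set (Fin n → ℝ)) (d' : ℕ) (ε : ℤ), S.IsCell d' Y ∧ (-1) ^ d = ε * (-1) ^ d' ∧
      (∀ y ∈ Y, LineCell {t | snocR y t ∈ C} ε) ∧ ∀ y ∉ Y, {t | snocR y t ∈ C} = ∅ := by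
  cases hC with
  | @graph _ _ Y f hY hf =>
    refine ⟨Y, d, 1, hY, (one_mul _).symm, fun y hy => Or.inr (Or.inl ⟨f y, ?_, rfl⟩),
      fun y hy => ?_⟩
    · ext t
      simp [mem_graphOver, hy]
    · ext t
      simp [mem_graphOver, hy]
  | @band _ d' Y f g hY hf hg hfg =>
    refine ⟨Y, d', -1, hY, by ring, fun y hy => Or.inr (Or.inr ⟨f y, g y, hfg y hy, ?_, rfl⟩),
      fun y hy => ?_⟩
    · ext t
      simp [mem_bandOver, hy]
    · ext t
      simp [mem_bandOver, hy]

open Classical in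
/-- Every linear relation between indicator functions of cells holds between the numbers
`(-1) ^ dim`. -/
theorem sum_eq_zero_of_isCell {n : ℕ} {ι : Type*} [Fintype ι] {C : ι → Set (Fin n → ℝ)}
    {d : ι → ℕ} {a : ι → ℤ} (hC : ∀ i, S.IsCell (d i) (C i))
    (h : ∀ x, ∑ i, (if x ∈ C i then a i else 0) = 0) : ∑ i, a i * (-1) ^ d i = 0 := by
  induction n generalizing a d with
  | zero =>
    have h1 : ∀ i, d i = 0 := fun i => Nat.le_zero.1 (hC i).dim_le
    have h2 : ∀ i, Fin.elim0 ∈ C i := fun i => by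
      obtain ⟨x, hx⟩ := (hC i).nonempty
      rwa [Subsingleton.elim Fin.elim0 x]
    simpa [h1, h2] using h Fin.elim0
  | succ n ih =>
    choose Y d' ε hY hd hfib hemp using fun i => (hC i).exists_base
    -- Over a fixed `y` the given relation is one on the line, where it yields `∑ a i * ε i = 0`
    -- over the cells whose base contains `y`. This is a relation between the indicator functions of
    -- the bases.
    have h1 := ih (C := Y) (d := d') (a := fun i => a i * ε i) hY fun y => by
      have h2 := sum_eq_zero_of_lineCell (J := fun i => {t | snocR y t ∈ C i})
        (ε := fun i => if y ∈ Y i then ε i else 0) (a := a) (fun i => ?_) fun t => h (snocR y t)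
      · simpa using h2
      · by_cases hy : y ∈ Y i
        · simpa [hy] using hfib i y hy
        · exact Or.inl ⟨hemp i y hy, by simp [hy]⟩
    rw [← h1]
    exact Finset.sum_congr rfl fun i _ => by rw [hd, mul_assoc]

open Classical in
theorem sum_indicator_of_disjoint {α ι : Type*} [Fintype ι] {B : ι → Set α}
    (hB : Pairwise fun i j => Disjoint (B i) (B j)) {x : α} :
    ∑ i, (if x ∈ B i then (1 : ℤ) else 0) = if x ∈ ⋃ i, B i then 1 else 0 := by
  by_cases hx : x ∈ ⋃ i, B i
  · obtain ⟨i, hi⟩ := mem_iUnion.1 hx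
    rw [if_pos hx, Finset.sum_eq_single i, if_pos hi]
    · exact fun j _ hj => if_neg fun h => Set.disjoint_left.1 (hB hj) h hi
    · simp
  · rw [if_neg hx]
    exact Finset.sum_eq_zero fun i _ => if_neg fun h => hx (mem_iUnion.2 ⟨i, h⟩)

/-- The Euler characteristic can be computed from any partition into cells. -/
theorem eulerChar_iUnion {n : ℕ} {ι : Type*} [Fintype ι] {C : ι → Set (Fin n → ℝ)} {d : ι → ℕ}
    (hC : ∀ i, S.IsCell (d i) (C i)) (hd : Pairwise fun i j => Disjoint (C i) (C j)) :
    S.eulerChar (⋃ i, C i) = ∑ i, (-1) ^ d i := by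
  classical
  have hne : Nonempty (S.CellDecomposition (⋃ i, C i)) := by
    let e := Fintype.equivFin ι
    exact ⟨⟨Fintype.card ι, fun j => C (e.symm j), fun j => d (e.symm j), fun j => hC _,
      fun i j hij => hd fun h => hij (e.symm.injective h), e.symm.surjective.iUnion_comp C⟩⟩
  rw [eulerChar, dif_pos hne]
  set D := hne.some
  -- Two partitions of one set, taken with coefficients `1` and `-1`, have cancelling indicator
  -- functions.
  have key := sum_eq_zero_of_isCell (S := S) (ι := Fin D.card ⊕ ι)
    (C := Sum.elim D.cell C) (d := Sum.elim D.dim d) (a := Sum.elim (fun _ => 1) fun _ => -1)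
    (by rintro (i | i); exacts [D.isCell i, hC i]) fun x => ?_
  · simp only [Fintype.sum_sum_type, Sum.elim_inl, Sum.elim_inr, one_mul, neg_mul,
      Finset.sum_neg_distrib] at key
    linarith
  · calc _ = (∑ i, if x ∈ D.cell i then (1 : ℤ) else 0) + ∑ i, (if x ∈ C i then (-1 : ℤ) else 0) :=
          Fintype.sum_sum_type _
      _ = (∑ i, if x ∈ D.cell i then (1 : ℤ) else 0) - ∑ i, if x ∈ C i then (1 : ℤ) else 0 := by
          rw [sub_eq_add_neg, ← Finset.sum_neg_distrib]
          congr 1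
          exact Finset.sum_congr rfl fun i _ => by split_ifs <;> rfl
      _ = 0 := by
          rw [sum_indicator_of_disjoint D.disjoint, sum_indicator_of_disjoint hd, D.iUnion_cell,
            sub_self]

end OMinimalStructure

/-! ### Isomorphisms, restrictions and products of groupoids up to Morita equivalence -/

/-- A subtype of a subtype. -/
def Homeomorph.subtypeSubtype {Z : Type*} [TopologicalSpace Z] {p : Z → Prop} {q : {z // p z} → Prop}
    {r : Z → Prop} (h : ∀ z, r z ↔ ∃ hz : p z, q ⟨z, hz⟩) : {w // q w} ≃ₜ {z // r z} where
  toFun x := ⟨x.1.1, (h _).2 ⟨x.1.2, x.2⟩⟩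
  invFun x := ⟨⟨x.1, ((h _).1 x.2).1⟩, ((h _).1 x.2).2⟩
  left_inv _ := rfl
  right_inv _ := rfl
  continuous_toFun := (continuous_subtype_val.comp continuous_subtype_val).subtype_mk _
  continuous_invFun := (continuous_subtype_val.subtype_mk _).subtype_mk _

/-- A subtype of a product. -/
def Homeomorph.subtypeProd {Z W : Type*} [TopologicalSpace Z] [TopologicalSpace W]
    {p : Z → Prop} {q : W → Prop} {r : Z × W → Prop} (h : ∀ z, r z ↔ p z.1 ∧ q z.2) :
    {z // r z} ≃ₜ {z // p z} × {w // q w} where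
  toFun x := (⟨x.1.1, ((h _).1 x.2).1⟩, ⟨x.1.2, ((h _).1 x.2).2⟩)
  invFun x := ⟨(x.1.1, x.2.1), (h _).2 ⟨x.1.2, x.2.2⟩⟩
  left_inv _ := rfl
  right_inv _ := rfl
  continuous_toFun := ((continuous_fst.comp continuous_subtype_val).subtype_mk _).prodMk
    ((continuous_snd.comp continuous_subtype_val).subtype_mk _)
  continuous_invFun := ((continuous_subtype_val.comp continuous_fst).prodMk
    (continuous_subtype_val.comp continuous_snd)).subtype_mk _

/-- A subtype of a product cut out by the second factor. -/
def Homeomorph.subtypeProdRight {Z W : Type*} [TopologicalSpace Z] [TopologicalSpace W]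
    {q : W → Prop} {r : Z × W → Prop} (h : ∀ z, r z ↔ q z.2) :
    {z // r z} ≃ₜ Z × {w // q w} where
  toFun x := (x.1.1, ⟨x.1.2, (h _).1 x.2⟩)
  invFun x := ⟨(x.1, x.2.1), (h _).2 x.2.2⟩
  left_inv _ := rfl
  right_inv _ := rfl
  continuous_toFun := (continuous_fst.comp continuous_subtype_val).prodMk
    ((continuous_snd.comp continuous_subtype_val).subtype_mk _)
  continuous_invFun := (continuous_fst.prodMk
    (continuous_subtype_val.comp continuous_snd)).subtype_mk _

namespace TopGroupoid

/-- Isomorphisms of topological groupoids. -/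
structure Iso (G H : TopGroupoid.{u}) where
  obj : G.Obj ≃ₜ H.Obj
  arr : G.Arr ≃ₜ H.Arr
  map_src : ∀ g, H.src (arr g) = obj (G.src g)
  map_tgt : ∀ g, H.tgt (arr g) = obj (G.tgt g)
  map_unit : ∀ x, arr (G.unit x) = H.unit (obj x)
  map_inv : ∀ g, arr (G.inv g) = H.inv (arr g)
  map_mul : ∀ g h (e : G.src g = G.tgt h), arr (G.mul g h e) =
    H.mul (arr g) (arr h) ((map_src g).trans ((congrArg obj e).trans (map_tgt h).symm))

/-- The inverse isomorphism. -/
def Iso.symm {G H : TopGroupoid.{u}} (e : Iso G H) : Iso H G where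
  obj := e.obj.symm
  arr := e.arr.symm
  map_src g := by
    rw [Homeomorph.eq_symm_apply, ← e.map_src, e.arr.apply_symm_apply]
  map_tgt g := by
    rw [Homeomorph.eq_symm_apply, ← e.map_tgt, e.arr.apply_symm_apply]
  map_unit x := by
    rw [Homeomorph.symm_apply_eq, e.map_unit, e.obj.apply_symm_apply]
  map_inv g := by
    rw [Homeomorph.symm_apply_eq, e.map_inv, e.arr.apply_symm_apply]
  map_mul g h he := by
    rw [Homeomorph.symm_apply_eq, e.map_mul]
    exact H.mul_congr (e.arr.apply_symm_apply g).symm (e.arr.apply_symm_apply h).symm _ _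

/-- The identity homomorphism. -/
def Hom.id (G : TopGroupoid.{u}) : Hom G G where
  obj x := x
  arr g := g
  continuous_obj := continuous_id
  continuous_arr := continuous_id
  map_src _ := rfl
  map_tgt _ := rfl
  map_unit _ := rfl
  map_inv _ := rfl
  map_mul _ _ _ := rfl

/-- A homomorphism followed by an isomorphism. -/
def Hom.compIso {K G H : TopGroupoid.{u}} (Φ : Hom K G) (e : Iso G H) : Hom K H where
  obj x := e.obj (Φ.obj x)
  arr g := e.arr (Φ.arr g)
  continuous_obj := e.obj.continuous.comp Φ.continuous_obj
  continuous_arr := e.arr.continuous.comp Φ.continuous_arr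
  map_src g := by rw [e.map_src, Φ.map_src]
  map_tgt g := by rw [e.map_tgt, Φ.map_tgt]
  map_unit g := by rw [Φ.map_unit, e.map_unit]
  map_inv g := by rw [Φ.map_inv, e.map_inv]
  map_mul g h he := by rw [Φ.map_mul, e.map_mul]

theorem Hom.isEssentialEquiv_id (G : TopGroupoid.{u}) : (Hom.id G).IsEssentialEquiv where
  local_sections y := ⟨univ, isOpen_univ, mem_univ y, fun z => ⟨(G.unit z.1, z.1), G.src_unit z.1⟩,
    ((G.continuous_unit.comp continuous_subtype_val).prodMk continuous_subtype_val).subtype_mk _,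
    fun z => G.tgt_unit z.1⟩
  isEmbedding := IsEmbedding.of_leftInverse (f := Prod.snd) (fun _ => rfl) continuous_snd
    ((G.continuous_src.prodMk G.continuous_tgt).prodMk continuous_id)
  range_eq := by
    ext p
    constructor
    · rintro ⟨g, rfl⟩
      exact ⟨rfl, rfl⟩
    · rintro ⟨h1, h2⟩
      exact ⟨p.2, Prod.ext (Prod.ext h1 h2) rfl⟩

theorem Hom.IsEssentialEquiv.compIso {K G H : TopGroupoid.{u}} {Φ : Hom K G}
    (hΦ : Φ.IsEssentialEquiv) (e : Iso G H) : (Φ.compIso e).IsEssentialEquiv where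
  local_sections y := by
    obtain ⟨U, hU, hyU, σ, hσ, hσ'⟩ := hΦ.local_sections (e.obj.symm y)
    refine ⟨e.obj.symm ⁻¹' U, hU.preimage e.obj.symm.continuous, hyU,
      fun z => ⟨(e.arr (σ ⟨e.obj.symm z.1, z.2⟩).1.1, (σ ⟨e.obj.symm z.1, z.2⟩).1.2), ?_⟩, ?_, ?_⟩
    · exact (e.map_src _).trans (congrArg e.obj (σ _).2)
    · have h1 : Continuous fun z : e.obj.symm ⁻¹' U => σ ⟨e.obj.symm z.1, z.2⟩ :=
        hσ.comp ((e.obj.symm.continuous.comp continuous_subtype_val).subtype_mk _)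
      have h2 := continuous_subtype_val.comp h1
      exact ((e.arr.continuous.comp (continuous_fst.comp h2)).prodMk
        (continuous_snd.comp h2)).subtype_mk _
    · intro z
      refine (e.map_tgt _).trans ?_
      rw [hσ', e.obj.apply_symm_apply]
  isEmbedding := by
    have h := ((Homeomorph.refl (K.Obj × K.Obj)).prodCongr e.arr).isEmbedding.comp hΦ.isEmbedding
    exact h
  range_eq := by
    ext p
    have h := Set.ext_iff.1 hΦ.range_eq (p.1, e.arr.symm p.2)
    constructor
    · rintro ⟨g, rfl⟩
      exact ⟨(Φ.compIso e).map_src g, (Φ.compIso e).map_tgt g⟩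
    · rintro ⟨h1, h2⟩
      obtain ⟨g, hg⟩ := h.2 ⟨by
          refine (e.symm.map_src p.2).trans ?_
          rw [h1]
          exact e.obj.symm_apply_apply _, by
          refine (e.symm.map_tgt p.2).trans ?_
          rw [h2]
          exact e.obj.symm_apply_apply _⟩
      have h3 : Φ.arr g = e.arr.symm p.2 := congrArg (fun q => q.2) hg
      have h4 : (K.src g, K.tgt g) = p.1 := congrArg (fun q => q.1) hg
      refine ⟨g, Prod.ext h4 ?_⟩
      change e.arr (Φ.arr g) = p.2
      rw [h3, e.arr.apply_symm_apply]

theorem MoritaEquiv.symm {G H : TopGroupoid.{u}} (h : G.MoritaEquiv H) : H.MoritaEquiv G := by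
  obtain ⟨K, Φ, Ψ, h1, h2⟩ := h
  exact ⟨K, Ψ, Φ, h2, h1⟩

/-- Composition with isomorphisms is the only transitivity needed, so no fibred products of
groupoids have to be formed. -/
theorem MoritaEquiv.trans_iso {G H H' : TopGroupoid.{u}} (h : G.MoritaEquiv H) (e : Iso H H') :
    G.MoritaEquiv H' := by
  obtain ⟨K, Φ, Ψ, h1, h2⟩ := h
  exact ⟨K, Φ, Ψ.compIso e, h1, h2.compIso e⟩

theorem MoritaEquiv.iso_trans {G G' H : TopGroupoid.{u}} (e : Iso G G') (h : G'.MoritaEquiv H) :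
    G.MoritaEquiv H :=
  (h.symm.trans_iso e.symm).symm

theorem Iso.moritaEquiv {G H : TopGroupoid.{u}} (e : Iso G H) : G.MoritaEquiv H :=
  ⟨G, Hom.id G, (Hom.id G).compIso e, Hom.isEssentialEquiv_id G,
    (Hom.isEssentialEquiv_id G).compIso e⟩

/-! ### Essential equivalences: restriction to saturated sets and effect on orbit spaces. -/

/-- The restriction of a homomorphism to sets of objects. -/
def Hom.restrict {K G : TopGroupoid.{u}} (Φ : Hom K G) (A : Set G.Obj) (B : Set K.Obj)
    (hB : ∀ x, x ∈ B ↔ Φ.obj x ∈ A) : Hom (K.restrict B) (G.restrict A) where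
  obj x := ⟨Φ.obj x.1, (hB _).1 x.2⟩
  arr g := ⟨Φ.arr g.1, (Φ.map_src g.1).symm ▸ (hB _).1 g.2.1,
    (Φ.map_tgt g.1).symm ▸ (hB _).1 g.2.2⟩
  continuous_obj := (Φ.continuous_obj.comp continuous_subtype_val).subtype_mk _
  continuous_arr := (Φ.continuous_arr.comp continuous_subtype_val).subtype_mk _
  map_src g := Subtype.ext (Φ.map_src g.1)
  map_tgt g := Subtype.ext (Φ.map_tgt g.1)
  map_unit x := Subtype.ext (Φ.map_unit x.1)
  map_inv g := Subtype.ext (Φ.map_inv g.1)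
  map_mul g h _ := Subtype.ext (Φ.map_mul g.1 h.1 _)

/-- As `A` is saturated, an arrow ending in `A` also starts in `A`; the local sections of `Φ` over
points of `A` therefore stay in the restricted groupoids. -/
theorem Hom.IsEssentialEquiv.restrict {K G : TopGroupoid.{u}} {Φ : Hom K G}
    (hΦ : Φ.IsEssentialEquiv) {A : Set G.Obj} {B : Set K.Obj}
    (hB : ∀ x, x ∈ B ↔ Φ.obj x ∈ A) (hA : ∀ g, G.tgt g ∈ A → G.src g ∈ A) :
    (Φ.restrict A B hB).IsEssentialEquiv where
  local_sections y := by
    obtain ⟨U, hU, hyU, σ, hσ, hσ'⟩ := hΦ.local_sections y.1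
    have h1 : ∀ z : (Subtype.val ⁻¹' U : Set A), G.tgt (σ ⟨z.1.1, z.2⟩).1.1 ∈ A := fun z => by
      rw [hσ']
      exact z.1.2
    have h2 : ∀ z : (Subtype.val ⁻¹' U : Set A), (σ ⟨z.1.1, z.2⟩).1.2 ∈ B := fun z => by
      rw [hB, ← (σ ⟨z.1.1, z.2⟩).2]
      exact hA _ (h1 z)
    refine ⟨Subtype.val ⁻¹' U, hU.preimage continuous_subtype_val, hyU,
      fun z => ⟨(⟨(σ ⟨z.1.1, z.2⟩).1.1, hA _ (h1 z), h1 z⟩, ⟨(σ ⟨z.1.1, z.2⟩).1.2, h2 z⟩),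
        Subtype.ext (σ ⟨z.1.1, z.2⟩).2⟩, ?_, fun z => Subtype.ext (hσ' _)⟩
    have h3 : Continuous fun z : (Subtype.val ⁻¹' U : Set A) => σ ⟨z.1.1, z.2⟩ :=
      hσ.comp ((continuous_subtype_val.comp continuous_subtype_val).subtype_mk _)
    have h4 := continuous_subtype_val.comp h3
    exact (((continuous_fst.comp h4).subtype_mk _).prodMk
      ((continuous_snd.comp h4).subtype_mk _)).subtype_mk _
  isEmbedding := by
    refine IsEmbedding.of_comp (g := fun p : ((K.restrict B).Obj × (K.restrict B).Obj) ×
      (G.restrict A).Arr => ((p.1.1.1, p.1.2.1), p.2.1)) ?_ ?_ ?_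
    · exact ((K.restrict B).continuous_src.prodMk (K.restrict B).continuous_tgt).prodMk
        (Φ.restrict A B hB).continuous_arr
    · exact (((continuous_subtype_val.comp continuous_fst).comp continuous_fst).prodMk
        ((continuous_subtype_val.comp continuous_snd).comp continuous_fst)).prodMk
          (continuous_subtype_val.comp continuous_snd)
    · exact hΦ.isEmbedding.comp IsEmbedding.subtypeVal
  range_eq := by
    ext p
    constructor
    · rintro ⟨g, rfl⟩
      exact ⟨(Φ.restrict A B hB).map_src g, (Φ.restrict A B hB).map_tgt g⟩
    · rintro ⟨h1, h2⟩
      obtain ⟨g, hg⟩ := (Set.ext_iff.1 hΦ.range_eq ((p.1.1.1, p.1.2.1), p.2.1)).2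
        ⟨congrArg Subtype.val h1, congrArg Subtype.val h2⟩
      have h3 : K.src g = p.1.1.1 := congrArg (fun q => q.1.1) hg
      have h4 : K.tgt g = p.1.2.1 := congrArg (fun q => q.1.2) hg
      have h5 : Φ.arr g = p.2.1 := congrArg (fun q => q.2) hg
      exact ⟨⟨g, h3.symm ▸ p.1.1.2, h4.symm ▸ p.1.2.2⟩,
        Prod.ext (Prod.ext (Subtype.ext h3) (Subtype.ext h4)) (Subtype.ext h5)⟩

/-- The map of orbit spaces induced by a homomorphism. -/
def Hom.orbit {K G : TopGroupoid.{u}} (Φ : Hom K G) : K.OrbitSpace → G.OrbitSpace :=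
  Quotient.lift (fun x => G.orbitMap (Φ.obj x)) fun _ _ ⟨g, hg, hg'⟩ =>
    G.orbitMap_eq_iff.2 ⟨Φ.arr g, by rw [Φ.map_src, hg], by rw [Φ.map_tgt, hg']⟩

/-- The fibred product description of the arrows gives injectivity. Local sections give surjectivity
and openness: near `y` the orbit map of `G` factors continuously through the orbit space of `K`. -/
theorem Hom.IsEssentialEquiv.isHomeomorph_orbit {K G : TopGroupoid.{u}} {Φ : Hom K G}
    (hΦ : Φ.IsEssentialEquiv) : IsHomeomorph Φ.orbit := by
  have hinj : Function.Injective Φ.orbit := by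
    intro a b hab
    obtain ⟨x, rfl⟩ := K.surjective_orbitMap a
    obtain ⟨y, rfl⟩ := K.surjective_orbitMap b
    obtain ⟨g, hg, hg'⟩ := G.orbitMap_eq_iff.1 hab
    obtain ⟨k, hk⟩ := (Set.ext_iff.1 hΦ.range_eq ((x, y), g)).2 ⟨hg, hg'⟩
    exact K.orbitMap_eq_iff.2 ⟨k, congrArg (fun q => q.1.1) hk, congrArg (fun q => q.1.2) hk⟩
  have hsec : ∀ (y : G.Obj) (p : {p : G.Arr × K.Obj // G.src p.1 = Φ.obj p.2}),
      G.tgt p.1.1 = y → Φ.orbit (K.orbitMap p.1.2) = G.orbitMap y := fun y p hp =>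
    G.orbitMap_eq_iff.2 ⟨p.1.1, p.2, hp⟩
  refine ⟨Continuous.quotient_lift (G.isQuotientMap_orbitMap.continuous.comp Φ.continuous_obj) _,
    ?_, hinj, ?_⟩
  · intro W hW
    rw [← G.isQuotientMap_orbitMap.isOpen_preimage, isOpen_iff_mem_nhds]
    intro y hy
    obtain ⟨U, hU, hyU, σ, hσ, hσ'⟩ := hΦ.local_sections y
    have key : ∀ z : U, G.orbitMap z.1 ∈ Φ.orbit '' W ↔ K.orbitMap (σ z).1.2 ∈ W := by
      intro z
      rw [← hsec z (σ z) (hσ' z)]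
      exact hinj.mem_set_image
    have ho : IsOpen {z : U | K.orbitMap (σ z).1.2 ∈ W} :=
      hW.preimage (K.isQuotientMap_orbitMap.continuous.comp
        (continuous_snd.comp (continuous_subtype_val.comp hσ)))
    refine Filter.mem_of_superset ((hU.isOpenMap_subtype_val _ ho).mem_nhds
      ⟨⟨y, hyU⟩, (key _).1 hy, rfl⟩) ?_
    rintro _ ⟨z, hz, rfl⟩
    exact (key z).2 hz
  · intro b
    obtain ⟨y, rfl⟩ := G.surjective_orbitMap b
    obtain ⟨U, hU, hyU, σ, hσ, hσ'⟩ := hΦ.local_sections y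
    exact ⟨_, hsec y (σ ⟨y, hyU⟩) (hσ' _)⟩

section TrivialAction

variable {K K' X X' : Type u} [Group K] [TopologicalSpace K] [IsTopologicalGroup K] [T2Space K]
  [Group K'] [TopologicalSpace K'] [IsTopologicalGroup K'] [T2Space K']
  [TopologicalSpace X] [T2Space X] [TopologicalSpace X'] [T2Space X']

theorem isHomeomorph_orbitMap_trivialAction :
    IsHomeomorph (trivialAction K X).orbitMap := by
  refine isHomeomorph_iff_isQuotientMap_injective.2 ⟨isQuotientMap_orbitMap _, fun x y h => ?_⟩
  obtain ⟨g, hg, hg'⟩ := (trivialAction K X).orbitMap_eq_iff.1 h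
  exact hg.symm.trans hg'

/-- Trivial actions of isomorphic groups on homeomorphic spaces. -/
def trivialActionIso (f : K ≃ₜ* K') (e : X ≃ₜ X') :
    Iso (trivialAction K X) (trivialAction K' X') where
  obj := e
  arr := f.toHomeomorph.prodCongr e
  map_src _ := rfl
  map_tgt _ := rfl
  map_unit _ := Prod.ext (map_one f) rfl
  map_inv _ := Prod.ext (map_inv f _) rfl
  map_mul _ _ _ := Prod.ext (map_mul f _ _) rfl

/-- The restriction of a trivial action. -/
def trivialActionRestrictIso (B : Set X) :
    Iso ((trivialAction K X).restrict B) (trivialAction K B) where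
  obj := Homeomorph.refl B
  arr := Homeomorph.subtypeProdRight (Z := K) (W := X) (q := (· ∈ B))
    (r := fun g => g.2 ∈ B ∧ g.2 ∈ B) fun _ => and_self_iff
  map_src _ := rfl
  map_tgt _ := rfl
  map_unit _ := rfl
  map_inv _ := rfl
  map_mul _ _ _ := rfl

/-- The product of trivial actions. -/
def trivialActionProdIso : Iso ((trivialAction K X).prod (trivialAction K' X'))
    (trivialAction (K × K') (X × X')) where
  obj := Homeomorph.refl _
  arr := Homeomorph.prodProdProdComm K X K' X'
  map_src _ := rfl
  map_tgt _ := rfl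
  map_unit _ := rfl
  map_inv _ := rfl
  map_mul _ _ _ := rfl

/-- The isotropy groups of a trivial action. -/
def trivialActionIsotropy (x : (trivialAction K X).Obj) : (trivialAction K X).Isotropy x ≃ₜ* K where
  toFun g := g.1.1
  invFun k := ⟨(k, x), rfl, rfl⟩
  left_inv g := Subtype.ext (Prod.ext rfl g.2.1.symm)
  right_inv _ := rfl
  map_mul' _ _ := rfl
  continuous_toFun := continuous_fst.comp (continuous_subtype_val (p := fun g : K × X =>
    g.2 = x ∧ g.2 = x))
  continuous_invFun := Continuous.subtype_mk (p := fun g : K × X => g.2 = x ∧ g.2 = x)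
    (continuous_id.prodMk continuous_const) _

/-- A groupoid that is Morita equivalent to a trivial action restricts to such groupoids. -/
theorem MoritaEquiv.restrict_trivialAction {G : TopGroupoid.{u}} [T2Space G.OrbitSpace]
    (h : G.MoritaEquiv (trivialAction K X)) (Y : Set G.OrbitSpace) :
    (G.restrict (G.orbitMap ⁻¹' Y)).MoritaEquiv (trivialAction K Y) := by
  obtain ⟨L, Φ, Ψ, hΦ, hΨ⟩ := h
  let π : X ≃ₜ (trivialAction K X).OrbitSpace := isHomeomorph_orbitMap_trivialAction.homeomorph _
  -- Both legs of the span induce homeomorphisms of orbit spaces. They identify `X` with `|G|`, and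
  -- the objects over `Y` correspond to `ζ ⁻¹' Y`.
  let ζ : X ≃ₜ G.OrbitSpace := (π.trans (hΨ.isHomeomorph_orbit.homeomorph _).symm).trans
    (hΦ.isHomeomorph_orbit.homeomorph _)
  have hζ : ∀ x : L.Obj, ζ (Ψ.obj x) = G.orbitMap (Φ.obj x) := by
    intro x
    have h1 : (hΨ.isHomeomorph_orbit.homeomorph _).symm (π (Ψ.obj x)) = L.orbitMap x := by
      rw [Homeomorph.symm_apply_eq]
      rfl
    change (hΦ.isHomeomorph_orbit.homeomorph _)
      ((hΨ.isHomeomorph_orbit.homeomorph _).symm (π (Ψ.obj x))) = _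
    rw [h1]
    rfl
  have h1 : (G.restrict (G.orbitMap ⁻¹' Y)).MoritaEquiv ((trivialAction K X).restrict (ζ ⁻¹' Y)) := by
    refine ⟨L.restrict {x | G.orbitMap (Φ.obj x) ∈ Y}, Φ.restrict _ _ fun x => Iff.rfl,
      Ψ.restrict _ _ fun x => ?_, hΦ.restrict _ fun g hg => ?_, hΨ.restrict _ fun g hg => hg⟩
    · change G.orbitMap (Φ.obj x) ∈ Y ↔ ζ (Ψ.obj x) ∈ Y
      rw [hζ]
    · rwa [mem_preimage, G.orbitMap_eq_iff.2 ⟨g, rfl, rfl⟩]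
  exact (h1.trans_iso (trivialActionRestrictIso _)).trans_iso
    (trivialActionIso (ContinuousMulEquiv.refl K)
      (ζ.sets (s := ζ ⁻¹' Y) (t := Y) rfl))

end TrivialAction

/-! ### Iterated restrictions and products of groupoids. -/

/-- Restricting twice. -/
def restrictRestrictIso (G : TopGroupoid.{u}) (A : Set G.Obj) (B : Set (G.restrict A).Obj)
    (A' : Set G.Obj) (h : ∀ x, x ∈ A' ↔ ∃ hx : x ∈ A, (⟨x, hx⟩ : (G.restrict A).Obj) ∈ B) :
    Iso ((G.restrict A).restrict B) (G.restrict A') where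
  obj := Homeomorph.subtypeSubtype (Z := G.Obj) (p := (· ∈ A)) (q := (· ∈ B)) (r := (· ∈ A')) h
  arr := Homeomorph.subtypeSubtype (Z := G.Arr) (p := fun g => G.src g ∈ A ∧ G.tgt g ∈ A)
    (q := fun g => (G.restrict A).src g ∈ B ∧ (G.restrict A).tgt g ∈ B)
    (r := fun g => G.src g ∈ A' ∧ G.tgt g ∈ A') fun g => by
      rw [h, h]
      exact ⟨fun ⟨⟨h1, h2⟩, h3, h4⟩ => ⟨⟨h1, h3⟩, h2, h4⟩, fun ⟨⟨h1, h3⟩, h2, h4⟩ =>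
        ⟨⟨h1, h2⟩, h3, h4⟩⟩
  map_src _ := rfl
  map_tgt _ := rfl
  map_unit _ := rfl
  map_inv _ := rfl
  map_mul _ _ _ := rfl

/-- Restricting a product to a product set. -/
def prodRestrictIso (G H : TopGroupoid.{u}) (A : Set G.Obj) (B : Set H.Obj)
    (C : Set (G.prod H).Obj) (h : ∀ x, x ∈ C ↔ x.1 ∈ A ∧ x.2 ∈ B) :
    Iso ((G.prod H).restrict C) ((G.restrict A).prod (H.restrict B)) where
  obj := Homeomorph.subtypeProd (Z := G.Obj) (W := H.Obj) (p := (· ∈ A)) (q := (· ∈ B))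
    (r := (· ∈ C)) h
  arr := Homeomorph.subtypeProd (Z := G.Arr) (W := H.Arr) (p := fun g => G.src g ∈ A ∧ G.tgt g ∈ A)
    (q := fun g => H.src g ∈ B ∧ H.tgt g ∈ B)
    (r := fun g => (G.prod H).src g ∈ C ∧ (G.prod H).tgt g ∈ C) fun g => by
      rw [h, h]
      exact and_and_and_comm
  map_src _ := rfl
  map_tgt _ := rfl
  map_unit _ := rfl
  map_inv _ := rfl
  map_mul _ _ _ := rfl

/-- The product of homomorphisms. -/
def Hom.prod {K G K' G' : TopGroupoid.{u}} (Φ : Hom K G) (Φ' : Hom K' G') :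
    Hom (K.prod K') (G.prod G') where
  obj x := (Φ.obj x.1, Φ'.obj x.2)
  arr g := (Φ.arr g.1, Φ'.arr g.2)
  continuous_obj := Φ.continuous_obj.prodMap Φ'.continuous_obj
  continuous_arr := Φ.continuous_arr.prodMap Φ'.continuous_arr
  map_src _ := Prod.ext (Φ.map_src _) (Φ'.map_src _)
  map_tgt _ := Prod.ext (Φ.map_tgt _) (Φ'.map_tgt _)
  map_unit _ := Prod.ext (Φ.map_unit _) (Φ'.map_unit _)
  map_inv _ := Prod.ext (Φ.map_inv _) (Φ'.map_inv _)
  map_mul _ _ _ := Prod.ext (Φ.map_mul _ _ _) (Φ'.map_mul _ _ _)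

theorem Hom.IsEssentialEquiv.prod {K G K' G' : TopGroupoid.{u}} {Φ : Hom K G} {Φ' : Hom K' G'}
    (hΦ : Φ.IsEssentialEquiv) (hΦ' : Φ'.IsEssentialEquiv) : (Φ.prod Φ').IsEssentialEquiv where
  local_sections y := by
    obtain ⟨U, hU, hyU, σ, hσ, hσt⟩ := hΦ.local_sections y.1
    obtain ⟨U', hU', hyU', σ', hσ', hσt'⟩ := hΦ'.local_sections y.2
    refine ⟨U ×ˢ U', hU.prod hU', ⟨hyU, hyU'⟩, fun z =>
      ⟨(((σ ⟨z.1.1, z.2.1⟩).1.1, (σ' ⟨z.1.2, z.2.2⟩).1.1),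
        ((σ ⟨z.1.1, z.2.1⟩).1.2, (σ' ⟨z.1.2, z.2.2⟩).1.2)),
        Prod.ext (σ ⟨z.1.1, z.2.1⟩).2 (σ' ⟨z.1.2, z.2.2⟩).2⟩, ?_,
        fun z => Prod.ext (hσt _) (hσt' _)⟩
    have h1 : Continuous fun z : U ×ˢ U' => (σ ⟨z.1.1, z.2.1⟩).1 :=
      continuous_subtype_val.comp (hσ.comp
        ((continuous_fst.comp continuous_subtype_val).subtype_mk _))
    have h2 : Continuous fun z : U ×ˢ U' => (σ' ⟨z.1.2, z.2.2⟩).1 :=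
      continuous_subtype_val.comp (hσ'.comp
        ((continuous_snd.comp continuous_subtype_val).subtype_mk _))
    exact (((continuous_fst.comp h1).prodMk (continuous_fst.comp h2)).prodMk
      ((continuous_snd.comp h1).prodMk (continuous_snd.comp h2))).subtype_mk _
  isEmbedding := by
    refine IsEmbedding.of_comp
      (g := fun p : ((K.Obj × K'.Obj) × (K.Obj × K'.Obj)) × (G.Arr × G'.Arr) =>
        (((p.1.1.1, p.1.2.1), p.2.1), ((p.1.1.2, p.1.2.2), p.2.2))) ?_ (by fun_prop) ?_
    · exact ((K.prod K').continuous_src.prodMk (K.prod K').continuous_tgt).prodMk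
        (Φ.prod Φ').continuous_arr
    · exact hΦ.isEmbedding.prodMap hΦ'.isEmbedding
  range_eq := by
    ext p
    constructor
    · rintro ⟨g, rfl⟩
      exact ⟨(Φ.prod Φ').map_src g, (Φ.prod Φ').map_tgt g⟩
    · rintro ⟨h1, h2⟩
      obtain ⟨g, hg⟩ := (Set.ext_iff.1 hΦ.range_eq ((p.1.1.1, p.1.2.1), p.2.1)).2
        ⟨congrArg Prod.fst h1, congrArg Prod.fst h2⟩
      obtain ⟨g', hg'⟩ := (Set.ext_iff.1 hΦ'.range_eq ((p.1.1.2, p.1.2.2), p.2.2)).2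
        ⟨congrArg Prod.snd h1, congrArg Prod.snd h2⟩
      refine ⟨(g, g'), Prod.ext (Prod.ext (Prod.ext ?_ ?_) (Prod.ext ?_ ?_)) (Prod.ext ?_ ?_)⟩
      · exact congrArg (fun q => q.1.1) hg
      · exact congrArg (fun q => q.1.1) hg'
      · exact congrArg (fun q => q.1.2) hg
      · exact congrArg (fun q => q.1.2) hg'
      · exact congrArg (fun q => q.2) hg
      · exact congrArg (fun q => q.2) hg'

theorem MoritaEquiv.prod {G H G' H' : TopGroupoid.{u}} (h : G.MoritaEquiv H)
    (h' : G'.MoritaEquiv H') : (G.prod G').MoritaEquiv (H.prod H') := by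
  obtain ⟨K, Φ, Ψ, h1, h2⟩ := h
  obtain ⟨K', Φ', Ψ', h1', h2'⟩ := h'
  exact ⟨K.prod K', Φ.prod Φ', Ψ.prod Ψ', h1.prod h1', h2.prod h2'⟩

/-! ### Cancellation laws and conjugation of isotropy groups. -/

theorem inv_mul_cancel_left (G : TopGroupoid.{u}) (k g : G.Arr) (e : G.src k = G.tgt g) :
    G.mul (G.inv k) (G.mul k g e) ((G.src_inv k).trans (G.tgt_mul k g e).symm) = g := by
  rw [← G.assoc _ _ _ (G.src_inv k) e]
  exact (G.mul_congr ((G.inv_mul k).trans (congrArg G.unit e)) rfl _ _).trans (G.unit_mul g)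

theorem mul_inv_cancel_right (G : TopGroupoid.{u}) (g k : G.Arr) (e : G.src g = G.tgt k) :
    G.mul (G.mul g k e) (G.inv k) ((G.src_mul g k e).trans (G.tgt_inv k).symm) = g := by
  rw [G.assoc _ _ _ e (G.tgt_inv k).symm]
  exact (G.mul_congr rfl ((G.mul_inv k).trans (congrArg G.unit e.symm)) _ _).trans (G.mul_unit g)

theorem inv_mul_cancel_right (G : TopGroupoid.{u}) (g k : G.Arr) (e : G.src g = G.src k) :
    G.mul (G.mul g (G.inv k) (e.trans (G.tgt_inv k).symm)) k
      ((G.src_mul _ _ _).trans (G.src_inv k)) = g := by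
  rw [G.assoc _ _ _ (e.trans (G.tgt_inv k).symm) (G.src_inv k)]
  exact (G.mul_congr rfl ((G.inv_mul k).trans (congrArg G.unit e.symm)) _ _).trans (G.mul_unit g)

theorem inv_inv (G : TopGroupoid.{u}) (k : G.Arr) : G.inv (G.inv k) = k := by
  have h := G.inv_mul_cancel_left (G.inv k) k (G.src_inv k)
  refine Eq.trans ?_ h
  refine (G.mul_unit _).symm.trans (G.mul_congr rfl ?_ _ _)
  rw [G.inv_mul, G.src_inv, G.tgt_inv]

/-- Conjugation by an arrow. -/
def isotropyConj (G : TopGroupoid.{u}) (k : G.Arr) {x y : G.Obj} (hx : G.src k = x)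
    (hy : G.tgt k = y) (g : G.Isotropy x) : G.Isotropy y :=
  ⟨G.mul (G.mul k g.1 (hx.trans g.2.2.symm)) (G.inv k) ((G.src_mul _ _ _).trans
      (g.2.1.trans (hx.symm.trans (G.tgt_inv k).symm))),
    (G.src_mul _ _ _).trans ((G.src_inv k).trans hy),
    (G.tgt_mul _ _ _).trans ((G.tgt_mul _ _ _).trans hy)⟩

theorem continuous_isotropyConj (G : TopGroupoid.{u}) (k : G.Arr) {x y : G.Obj}
    (hx : G.src k = x) (hy : G.tgt k = y) : Continuous (G.isotropyConj k hx hy) := by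
  have h0 : Continuous fun g : G.Isotropy x => g.1 := continuous_subtype_val
  have h1 : Continuous fun g : G.Isotropy x => G.mul k g.1 (hx.trans g.2.2.symm) :=
    G.continuous_mul.comp ((continuous_const.prodMk h0).subtype_mk fun g => hx.trans g.2.2.symm)
  refine Continuous.subtype_mk (f := fun g : G.Isotropy x =>
    G.mul (G.mul k g.1 (hx.trans g.2.2.symm)) (G.inv k) ((G.src_mul _ _ _).trans
      (g.2.1.trans (hx.symm.trans (G.tgt_inv k).symm)))) ?_ _
  exact G.continuous_mul.comp ((h1.prodMk continuous_const).subtype_mk fun g =>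
    (G.src_mul _ _ _).trans (g.2.1.trans (hx.symm.trans (G.tgt_inv k).symm)))

theorem isotropyConj_inv (G : TopGroupoid.{u}) (k : G.Arr) {x y : G.Obj} (hx : G.src k = x)
    (hy : G.tgt k = y) (g : G.Isotropy x) :
    G.isotropyConj (G.inv k) ((G.src_inv k).trans hy) ((G.tgt_inv k).trans hx)
      (G.isotropyConj k hx hy g) = g := by
  have e : G.src k = G.tgt g.1 := hx.trans g.2.2.symm
  have e' : G.src g.1 = G.tgt (G.inv k) := g.2.1.trans (hx.symm.trans (G.tgt_inv k).symm)
  refine Subtype.ext ?_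
  refine (G.mul_congr ?_ rfl ((G.src_mul _ _ _).trans ((G.src_mul _ _ _).trans (G.tgt_inv _).symm))
    ((G.src_mul g.1 (G.inv k) e').trans (G.tgt_inv _).symm)).trans
      (G.mul_inv_cancel_right g.1 (G.inv k) e')
  refine (G.assoc _ _ _ ((G.src_inv k).trans (G.tgt_mul k g.1 e).symm)
    ((G.src_mul _ _ _).trans e')).symm.trans ?_
  exact G.mul_congr (G.inv_mul_cancel_left k g.1 e) rfl _ _

/-- Objects in the same orbit have isomorphic isotropy groups. -/
def isotropyConjEquiv (G : TopGroupoid.{u}) (k : G.Arr) {x y : G.Obj} (hx : G.src k = x)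
    (hy : G.tgt k = y) : G.Isotropy x ≃ₜ* G.Isotropy y where
  toFun := G.isotropyConj k hx hy
  invFun := G.isotropyConj (G.inv k) ((G.src_inv k).trans hy) ((G.tgt_inv k).trans hx)
  left_inv g := G.isotropyConj_inv k hx hy g
  right_inv g := by
    have h := G.isotropyConj_inv (G.inv k) ((G.src_inv k).trans hy) ((G.tgt_inv k).trans hx) g
    refine Eq.trans ?_ h
    congr 1
    exact (G.inv_inv k).symm
  map_mul' g h := by
    refine Subtype.ext ?_
    have e : G.src k = G.tgt g.1 := hx.trans g.2.2.symm
    have e' : G.src k = G.tgt h.1 := hx.trans h.2.2.symm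
    have e'' : G.src g.1 = G.tgt h.1 := g.2.1.trans h.2.2.symm
    have e₃ : G.src (G.mul k g.1 e) = G.src k := (G.src_mul _ _ _).trans (g.2.1.trans hx.symm)
    have e₄ : G.src (G.mul k h.1 e') = G.tgt (G.inv k) :=
      (G.src_mul _ _ _).trans (h.2.1.trans (hx.symm.trans (G.tgt_inv k).symm))
    have e₅ : G.src (G.mul (G.mul k g.1 e) (G.inv k) (e₃.trans (G.tgt_inv k).symm)) =
        G.tgt (G.mul k h.1 e') :=
      (G.src_mul _ _ _).trans ((G.src_inv k).trans (G.tgt_mul _ _ _).symm)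
    refine Eq.trans ?_ (G.assoc _ _ _ e₅ e₄)
    refine G.mul_congr ?_ rfl _ _
    refine Eq.trans ?_ (G.assoc _ _ _ ((G.src_mul _ _ _).trans (G.src_inv k)) e')
    refine (G.assoc _ _ _ e e'').symm.trans (G.mul_congr ?_ rfl _ _)
    exact (G.inv_mul_cancel_right _ k e₃).symm
  continuous_toFun := G.continuous_isotropyConj k hx hy
  continuous_invFun := G.continuous_isotropyConj _ _ _

end TopGroupoid

/-! ### Isotropy local triviality of restrictions and products -/

/-- The product of sets in `ℝᵐ` and `ℝⁿ` as a set in `ℝᵐ⁺ⁿ`. -/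
def prodSetHomeomorph {m n : ℕ} (A : Set (Fin m → ℝ)) (B : Set (Fin n → ℝ)) :
    A × B ≃ₜ OMinimalStructure.prodSet A B where
  toFun p := ⟨Fin.append p.1.1 p.2.1, by
    constructor
    · simp
    · simp⟩
  invFun x := (⟨_, x.2.1⟩, ⟨_, x.2.2⟩)
  left_inv p := by
    refine Prod.ext (Subtype.ext ?_) (Subtype.ext ?_)
    · funext i
      simp
    · funext i
      simp
  right_inv x := Subtype.ext Fin.append_castAdd_natAdd
  continuous_toFun := by
    refine Continuous.subtype_mk (continuous_pi fun i => ?_) _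
    refine Fin.addCases (fun i => ?_) (fun i => ?_) i
    · simp only [Fin.append_left]
      exact (continuous_apply i).comp (continuous_subtype_val.comp continuous_fst)
    · simp only [Fin.append_right]
      exact (continuous_apply i).comp (continuous_subtype_val.comp continuous_snd)
  continuous_invFun :=
    Continuous.prodMk
      (Continuous.subtype_mk (f := fun (x : OMinimalStructure.prodSet A B) i =>
        x.1 (Fin.castAdd n i)) (continuous_pi fun i =>
          (continuous_apply (Fin.castAdd n i)).comp continuous_subtype_val) _)
      (Continuous.subtype_mk (f := fun (x : OMinimalStructure.prodSet A B) i =>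
        x.1 (Fin.natAdd m i)) (continuous_pi fun i =>
          (continuous_apply (Fin.natAdd m i)).comp continuous_subtype_val) _)

namespace OrbitDefGroupoid

variable {S : OMinimalStructure}

instance (G : OrbitDefGroupoid.{u} S) : T2Space G.OrbitSpace := G.isEmbedding_emb.t2Space

theorem isoClass_eq_of_orbitMap_eq (G : OrbitDefGroupoid.{u} S) {x y : G.Obj}
    (h : G.orbitMap x = G.orbitMap y) : G.isoClass x = G.isoClass y := by
  obtain ⟨k, hx, hy⟩ := G.orbitMap_eq_iff.1 h
  exact G.isoClass_eq_iff.2 ⟨G.isotropyConjEquiv k hx hy⟩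

/-- Conjugation makes the isotropy class constant along an orbit, so it can be tested at any
representative. -/
theorem orbitMap_mem_orbitType (G : OrbitDefGroupoid.{u} S) {x : G.Obj} {c : LieClass.{u}} :
    G.orbitMap x ∈ G.orbitType c ↔ G.isoClass x = c := by
  constructor
  · rintro ⟨y, hy, hxy⟩
    exact (G.isoClass_eq_of_orbitMap_eq hxy).symm.trans hy
  · exact fun h => ⟨x, h, rfl⟩

/-- The condition on the cells in the definition of isotropy local triviality. -/
def LocTrivOn (G : OrbitDefGroupoid.{u} S) (C : Set (Fin G.dim → ℝ)) : Prop :=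
  ∀ x : G.Obj, G.orbitMap x ∈ G.emb ⁻¹' C →
    G.emb ⁻¹' C ⊆ G.orbitType (G.isoClass x) ∧
    (G.toTopGroupoid.restrict (G.orbitMap ⁻¹' (G.emb ⁻¹' C))).MoritaEquiv
      (TopGroupoid.trivialAction (G.Isotropy x) (G.emb ⁻¹' C))

theorem isIsotropyLocallyTrivial_iff (G : OrbitDefGroupoid.{u} S) : G.IsIsotropyLocallyTrivial ↔
    ∃ D : S.CellDecomposition (range G.emb), ∀ i, G.LocTrivOn (D.cell i) := Iff.rfl

theorem isIsotropyLocallyTrivial_of_partCells (G : OrbitDefGroupoid.{u} S)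
    (h : S.PartCells G.LocTrivOn (range G.emb)) : G.IsIsotropyLocallyTrivial :=
  h.exists_decomposition

/-- Cells are nonempty, so each one can be labelled by the isotropy group of a point over it. -/
theorem IsIsotropyLocallyTrivial.exists_classes {G : OrbitDefGroupoid.{u} S}
    (hG : G.IsIsotropyLocallyTrivial) : ∃ (D : S.CellDecomposition (range G.emb))
      (x : Fin D.card → G.Obj), ∀ i, G.LocTrivOn (D.cell i) ∧ G.emb (G.orbitMap (x i)) ∈ D.cell i ∧
        G.emb ⁻¹' D.cell i ⊆ G.orbitType (G.isoClass (x i)) := by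
  obtain ⟨D, hD⟩ := G.isIsotropyLocallyTrivial_iff.1 hG
  have h1 : ∀ i, ∃ x : G.Obj, G.emb (G.orbitMap x) ∈ D.cell i := by
    intro i
    obtain ⟨z, hz⟩ := (D.isCell i).nonempty
    have h2 : z ∈ range G.emb := D.iUnion_cell ▸ mem_iUnion_of_mem i hz
    obtain ⟨y, rfl⟩ := h2
    obtain ⟨x, rfl⟩ := G.surjective_orbitMap y
    exact ⟨x, hz⟩
  choose x hx using h1
  exact ⟨D, x, fun i => ⟨hD i, hx i, (hD i (x i) (hx i)).1⟩⟩

/-- The universal Euler characteristic computed from a partition into cells subordinate to the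
weak orbit types. -/
theorem univEuler_eq (G : OrbitDefGroupoid.{u} S) {ι : Type} [Fintype ι]
    {C : ι → Set (Fin G.dim → ℝ)} {d : ι → ℕ} {c : ι → LieClass.{u}}
    (hC : ∀ i, S.IsCell (d i) (C i)) (hd : Pairwise fun i j => Disjoint (C i) (C j))
    (hU : ⋃ i, C i = range G.emb) (hc : ∀ i, G.emb ⁻¹' C i ⊆ G.orbitType (c i)) :
    G.univEuler = ∑ i, ((-1) ^ d i : ℤ) • univT (c i) := by
  classical
  have hsub : ∀ i, C i ⊆ range G.emb := fun i => hU ▸ subset_iUnion C i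
  have h1 : ∀ e : LieClass.{u}, G.emb '' G.orbitType e = ⋃ i : {i // c i = e}, C i.1 := by
    intro e
    ext z
    constructor
    · rintro ⟨_, ⟨x, hx, rfl⟩, rfl⟩
      have h2 : G.emb (G.orbitMap x) ∈ ⋃ i, C i := hU ▸ mem_range_self _
      obtain ⟨i, hi⟩ := mem_iUnion.1 h2
      refine mem_iUnion.2 ⟨⟨i, ?_⟩, hi⟩
      exact (G.orbitMap_mem_orbitType.1 (hc i hi)).symm.trans hx
    · intro hz
      obtain ⟨⟨i, rfl⟩, hi⟩ := mem_iUnion.1 hz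
      obtain ⟨y, rfl⟩ := hsub i hi
      exact ⟨y, hc i hi, rfl⟩
  have h2 : ∀ e : LieClass.{u}, S.eulerChar (G.emb '' G.orbitType e) =
      ∑ i with c i = e, (-1) ^ d i := by
    intro e
    rw [h1, OMinimalStructure.eulerChar_iUnion (fun i : {i // c i = e} => hC i.1)
      fun i j hij => hd fun h => hij (Subtype.ext h)]
    exact (Finset.sum_subtype _ (by simp) fun i => (-1 : ℤ) ^ d i).symm
  -- Because cells are nonempty, every label really occurs as an isotropy class, so the sum over
  -- cells can be grouped by labels.
  have h3 : ∀ i ∈ (Finset.univ : Finset ι), c i ∈ G.finite_range_isoClass.toFinset := by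
    intro i _
    obtain ⟨z, hz⟩ := (hC i).nonempty
    obtain ⟨y, rfl⟩ := hsub i hz
    obtain ⟨x, rfl⟩ := G.surjective_orbitMap y
    simp only [Set.Finite.mem_toFinset]
    exact ⟨x, G.orbitMap_mem_orbitType.1 (hc i hz)⟩
  rw [univEuler, ← Finset.sum_fiberwise_of_maps_to h3]
  refine Finset.sum_congr rfl fun e _ => ?_
  rw [h2, Finset.sum_smul]
  refine Finset.sum_congr rfl fun i hi => ?_
  rw [(Finset.mem_filter.1 hi).2]

theorem restrict_isoClass (G : OrbitDefGroupoid.{u} S) {Y : Set G.OrbitSpace}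
    (hY : S.IsDef (G.emb '' Y)) (x : (G.restrict Y hY).Obj) :
    (G.restrict Y hY).isoClass x = G.isoClass x.1 :=
  Quotient.sound (s := CompactLieGrp.setoid) ⟨G.restrictIsotropy _ x⟩

theorem range_restrict_emb (G : OrbitDefGroupoid.{u} S) {Y : Set G.OrbitSpace}
    (hY : S.IsDef (G.emb '' Y)) : range (G.restrict Y hY).emb = G.emb '' Y := by
  change range (G.emb ∘ G.restrictOrbit Y) = G.emb '' Y
  rw [range_comp, G.range_restrictOrbit]

/-- The isotropy groups of a restriction. -/
def restrictIsotropyEquiv (G : OrbitDefGroupoid.{u} S) {Y : Set G.OrbitSpace}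
    (hY : S.IsDef (G.emb '' Y)) (x : (G.restrict Y hY).Obj) :
    (G.restrict Y hY).Isotropy x ≃ₜ* G.Isotropy x.1 := G.restrictIsotropy _ x

/-- Restricting to `Y` and then to `C'`, or to `C` and then to `C'`, gives the part of `G` over `C'`
either way. The second route is covered by the Morita triviality over `C`. -/
theorem LocTrivOn.restrict {G : OrbitDefGroupoid.{u} S} {C : Set (Fin G.dim → ℝ)}
    (hC : G.LocTrivOn C) {Y : Set G.OrbitSpace} (hY : S.IsDef (G.emb '' Y))
    {C' : Set (Fin G.dim → ℝ)} (hC' : C' ⊆ C) (hC'Y : C' ⊆ G.emb '' Y) :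
    (G.restrict Y hY).LocTrivOn C' := by
  intro x hx
  obtain ⟨h1, h2⟩ := hC x.1 (hC' hx)
  have hmemY : ∀ y, G.emb y ∈ C' → y ∈ Y := fun y hy => by
    obtain ⟨z, hz, hzy⟩ := hC'Y hy
    rwa [← G.isEmbedding_emb.injective hzy]
  constructor
  · intro y hy
    obtain ⟨z, rfl⟩ := TopGroupoid.surjective_orbitMap _ y
    have h3 := G.orbitMap_mem_orbitType.1 (h1 (hC' hy : G.emb (G.orbitMap z.1) ∈ C))
    refine (G.restrict Y hY).orbitMap_mem_orbitType.2 ?_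
    rw [restrict_isoClass, restrict_isoClass, h3]
  · have := G.isEmbedding_emb.isInducing.firstCountableTopology
    have hemb := G.isEmbedding_restrictOrbit (G.emb ⁻¹' C)
    have : T2Space (G.toTopGroupoid.restrict (G.orbitMap ⁻¹' (G.emb ⁻¹' C))).OrbitSpace :=
      hemb.t2Space
    have h3 := h2.restrict_trivialAction ((G.emb ∘ G.restrictOrbit (G.emb ⁻¹' C)) ⁻¹' C')
    have a := G.restrictRestrictIso (G.orbitMap ⁻¹' (G.emb ⁻¹' C)) (TopGroupoid.orbitMap _ ⁻¹'
      ((G.emb ∘ G.restrictOrbit (G.emb ⁻¹' C)) ⁻¹' C')) (G.orbitMap ⁻¹' (G.emb ⁻¹' C'))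
      fun x => ⟨fun hx => ⟨hC' hx, hx⟩, fun hx => hx.2⟩
    have b := G.restrictRestrictIso (G.orbitMap ⁻¹' Y) ((G.restrict Y hY).orbitMap ⁻¹'
      ((G.restrict Y hY).emb ⁻¹' C')) (G.orbitMap ⁻¹' (G.emb ⁻¹' C'))
      fun x => ⟨fun hx => ⟨hmemY _ hx, hx⟩, fun hx => hx.2⟩
    have h4 := TopGroupoid.MoritaEquiv.iso_trans b (TopGroupoid.MoritaEquiv.iso_trans a.symm h3)
    refine h4.trans_iso (TopGroupoid.trivialActionIso (G.restrictIsotropyEquiv hY x).symm ?_)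
    refine ((G.isEmbedding_emb.comp hemb).homeomorphOfSubsetRange ?_).trans
      ((G.restrict Y hY).isEmbedding_emb.homeomorphOfSubsetRange ?_).symm
    · rw [range_comp, G.range_restrictOrbit]
      intro z hz
      obtain ⟨y, hy, rfl⟩ := hC'Y hz
      exact ⟨y, hC' hz, rfl⟩
    · rw [range_restrict_emb]
      exact hC'Y

/-- The trace of `Y` on a cell need not be a cell. The cell decomposition theorem cuts it into
cells, which inherit local triviality from the larger cell. -/
theorem IsIsotropyLocallyTrivial.restrict {G : OrbitDefGroupoid.{u} S}
    (hG : G.IsIsotropyLocallyTrivial) (Y : Set G.OrbitSpace) (hY : S.IsDef (G.emb '' Y)) :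
    (G.restrict Y hY).IsIsotropyLocallyTrivial := by
  obtain ⟨D, hD⟩ := G.isIsotropyLocallyTrivial_iff.1 hG
  refine isIsotropyLocallyTrivial_of_partCells _ ?_
  have h1 : range (G.restrict Y hY).emb = ⋃ i, G.emb '' Y ∩ D.cell i := by
    rw [range_restrict_emb, ← inter_iUnion, D.iUnion_cell,
      inter_eq_left.2 (image_subset_range _ _)]
  rw [h1]
  refine OMinimalStructure.PartCells.iUnion (fun i j hij =>
    (D.disjoint hij).mono inter_subset_right inter_subset_right) fun i => ?_
  refine (OMinimalStructure.partCells_of_isDef (S.inter hY (D.isCell i).isDef)).bind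
    fun C hC d hd _ => OMinimalStructure.PartCells.of_isCell hd ?_
  exact (hD i).restrict hY (hC.trans inter_subset_right) (hC.trans inter_subset_left)

theorem prod_isoClass (G H : OrbitDefGroupoid.{u} S) (h : IsEmbedding (G.prodEmb H))
    (x : (G.prod H h).Obj) :
    (G.prod H h).isoClass x = (G.isoClass x.1).prod (H.isoClass x.2) :=
  Quotient.sound (s := CompactLieGrp.setoid) ⟨G.toTopGroupoid.prodIsotropy H.toTopGroupoid x⟩

/-- The isotropy groups of a product. -/
def prodIsotropyEquiv (G H : OrbitDefGroupoid.{u} S) (h : IsEmbedding (G.prodEmb H))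
    (x : (G.prod H h).Obj) :
    (G.prod H h).Isotropy x ≃ₜ* G.Isotropy x.1 × H.Isotropy x.2 :=
  G.toTopGroupoid.prodIsotropy H.toTopGroupoid x

theorem prod_emb_mem (G H : OrbitDefGroupoid.{u} S) (h : IsEmbedding (G.prodEmb H))
    (x : (G.prod H h).Obj) (A : Set (Fin G.dim → ℝ)) (B : Set (Fin H.dim → ℝ)) :
    (G.prod H h).emb ((G.prod H h).orbitMap x) ∈ OMinimalStructure.prodSet A B ↔
      G.emb (G.orbitMap x.1) ∈ A ∧ H.emb (H.orbitMap x.2) ∈ B := by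
  change Fin.append _ _ ∈ OMinimalStructure.prodSet A B ↔ _
  simp [OMinimalStructure.prodSet]

theorem range_prod_emb (G H : OrbitDefGroupoid.{u} S) (h : IsEmbedding (G.prodEmb H)) :
    range (G.prod H h).emb = OMinimalStructure.prodSet (range G.emb) (range H.emb) := by
  have h2 := G.prodEmb_image H univ univ
  rw [image_univ_of_surjective G.surjective_orbitMap,
    image_univ_of_surjective H.surjective_orbitMap, image_univ, image_univ] at h2
  rw [← h2, univ_prod_univ]
  refine image_univ.symm.trans ?_
  congr 1
  exact (image_univ_of_surjective (TopGroupoid.surjective_orbitMap _)).symm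

/-- Morita equivalences can be multiplied, and the product of `K ⋉ A` and `L ⋉ B` is `(K × L) ⋉ (A ×
B)`. -/
theorem LocTrivOn.prod {G H : OrbitDefGroupoid.{u} S} (h : IsEmbedding (G.prodEmb H))
    {A : Set (Fin G.dim → ℝ)} {B : Set (Fin H.dim → ℝ)} (hA : G.LocTrivOn A)
    (hB : H.LocTrivOn B) (hA' : A ⊆ range G.emb) (hB' : B ⊆ range H.emb) :
    (G.prod H h).LocTrivOn (OMinimalStructure.prodSet A B) := by
  intro x hx
  have hx' := (G.prod_emb_mem H h x A B).1 hx
  obtain ⟨h1, h2⟩ := hA x.1 hx'.1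
  obtain ⟨h3, h4⟩ := hB x.2 hx'.2
  constructor
  · intro y hy
    obtain ⟨z, rfl⟩ := TopGroupoid.surjective_orbitMap _ y
    have hz := (G.prod_emb_mem H h z A B).1 hy
    refine (G.prod H h).orbitMap_mem_orbitType.2 ?_
    rw [prod_isoClass, prod_isoClass, G.orbitMap_mem_orbitType.1 (h1 hz.1),
      H.orbitMap_mem_orbitType.1 (h3 hz.2)]
  · have a := G.toTopGroupoid.prodRestrictIso H.toTopGroupoid (G.orbitMap ⁻¹' (G.emb ⁻¹' A))
      (H.orbitMap ⁻¹' (H.emb ⁻¹' B)) ((G.prod H h).orbitMap ⁻¹' ((G.prod H h).emb ⁻¹'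
        OMinimalStructure.prodSet A B)) fun x => G.prod_emb_mem H h x A B
    refine ((TopGroupoid.MoritaEquiv.iso_trans a (h2.prod h4)).trans_iso
      TopGroupoid.trivialActionProdIso).trans_iso (TopGroupoid.trivialActionIso
        (G.prodIsotropyEquiv H h x).symm ?_)
    refine (((G.isEmbedding_emb.homeomorphOfSubsetRange hA').prodCongr
      (H.isEmbedding_emb.homeomorphOfSubsetRange hB')).trans (prodSetHomeomorph A B)).trans
        ((G.prod H h).isEmbedding_emb.homeomorphOfSubsetRange ?_).symm
    rw [range_prod_emb]
    exact fun z hz => ⟨hA' hz.1, hB' hz.2⟩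

theorem disjoint_prodSet {m n : ℕ} {A A' : Set (Fin m → ℝ)} {B B' : Set (Fin n → ℝ)}
    (h : Disjoint A A' ∨ Disjoint B B') :
    Disjoint (OMinimalStructure.prodSet A B) (OMinimalStructure.prodSet A' B') := by
  rw [Set.disjoint_left]
  rintro x ⟨h1, h2⟩ ⟨h3, h4⟩
  rcases h with h | h
  · exact Set.disjoint_left.1 h h1 h3
  · exact Set.disjoint_left.1 h h2 h4

theorem iUnion_prodSet {m n : ℕ} {ι κ : Type} {A : ι → Set (Fin m → ℝ)}
    {B : κ → Set (Fin n → ℝ)} : ⋃ p : ι × κ, OMinimalStructure.prodSet (A p.1) (B p.2) =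
      OMinimalStructure.prodSet (⋃ i, A i) (⋃ j, B j) := by
  ext x
  simp [OMinimalStructure.prodSet, exists_and_left, exists_and_right]

theorem pairwise_disjoint_prodSet {m n : ℕ} {ι κ : Type} {A : ι → Set (Fin m → ℝ)}
    {B : κ → Set (Fin n → ℝ)} (hA : Pairwise fun i j => Disjoint (A i) (A j))
    (hB : Pairwise fun i j => Disjoint (B i) (B j)) : Pairwise fun p q : ι × κ =>
      Disjoint (OMinimalStructure.prodSet (A p.1) (B p.2))
        (OMinimalStructure.prodSet (A q.1) (B q.2)) := by
  intro p q hpq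
  refine disjoint_prodSet ?_
  by_cases h : p.1 = q.1
  · exact Or.inr (hB fun h' => hpq (Prod.ext h h'))
  · exact Or.inl (hA h)

theorem univT_mul (c d : LieClass.{u}) : univT c * univT d = univT (c.prod d) := by
  rw [univT, univT, univT, ← map_mul]
  refine Ideal.Quotient.eq.2 (Ideal.subset_span (Or.inl ⟨c, d, rfl⟩))

theorem univT_trivial : univT LieClass.trivial.{u} = 1 :=
  Ideal.Quotient.eq.2 (Ideal.subset_span (Or.inr rfl))

/-- Products of isotropy locally trivial groupoids are isotropy locally trivial, and the universal
Euler characteristic is multiplicative on them. -/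
theorem IsIsotropyLocallyTrivial.prod {G H : OrbitDefGroupoid.{u} S}
    (hG : G.IsIsotropyLocallyTrivial) (hH : H.IsIsotropyLocallyTrivial)
    (h : IsEmbedding (G.prodEmb H)) : (G.prod H h).IsIsotropyLocallyTrivial ∧
      (G.prod H h).univEuler = G.univEuler * H.univEuler := by
  obtain ⟨D, x, hD⟩ := hG.exists_classes
  obtain ⟨D', x', hD'⟩ := hH.exists_classes
  have hsub : ∀ i, D.cell i ⊆ range G.emb := fun i => by
    conv_rhs => rw [← D.iUnion_cell]
    exact subset_iUnion _ i
  have hsub' : ∀ i, D'.cell i ⊆ range H.emb := fun i => by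
    conv_rhs => rw [← D'.iUnion_cell]
    exact subset_iUnion _ i
  have hU : ⋃ p : Fin D.card × Fin D'.card, OMinimalStructure.prodSet (D.cell p.1) (D'.cell p.2) =
      range (G.prod H h).emb := by
    rw [range_prod_emb, iUnion_prodSet, D.iUnion_cell, D'.iUnion_cell]
  have hdisj := pairwise_disjoint_prodSet D.disjoint D'.disjoint
  have hlt : ∀ p : Fin D.card × Fin D'.card, (G.prod H h).LocTrivOn
      (OMinimalStructure.prodSet (D.cell p.1) (D'.cell p.2)) := fun p =>
    LocTrivOn.prod h (hD p.1).1 (hD' p.2).1 (hsub p.1) (hsub' p.2)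
  have hcell : ∀ p : Fin D.card × Fin D'.card, S.IsCell (D.dim p.1 + D'.dim p.2)
      (OMinimalStructure.prodSet (D.cell p.1) (D'.cell p.2)) := fun p =>
    OMinimalStructure.isCell_prodSet (D.isCell p.1) (D'.isCell p.2)
  constructor
  · refine isIsotropyLocallyTrivial_of_partCells _ ?_
    rw [← hU]
    exact OMinimalStructure.PartCells.iUnion hdisj fun p =>
      OMinimalStructure.PartCells.of_isCell (hcell p) (hlt p)
  · rw [univEuler_eq (G.prod H h) (c := fun p => (G.isoClass (x p.1)).prod (H.isoClass (x' p.2)))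
        hcell hdisj hU fun p => ?_,
      univEuler_eq G D.isCell D.disjoint D.iUnion_cell fun i => (hD i).2.2,
      univEuler_eq H D'.isCell D'.disjoint D'.iUnion_cell fun i => (hD' i).2.2,
      Finset.sum_mul_sum, Fintype.sum_prod_type]
    · refine Finset.sum_congr rfl fun i _ => Finset.sum_congr rfl fun j _ => ?_
      rw [smul_mul_smul_comm, univT_mul, pow_add]
    · let z : (G.prod H h).Obj := (x p.1, x' p.2)
      have h1 := (hlt p z ((G.prod_emb_mem H h z _ _).2 ⟨(hD p.1).2.1, (hD' p.2).2.1⟩)).1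
      rwa [prod_isoClass] at h1

/-- The universal Euler characteristic is additive. -/
theorem IsIsotropyLocallyTrivial.univEuler_add {G : OrbitDefGroupoid.{u} S}
    (hG : G.IsIsotropyLocallyTrivial) (Y : Set G.OrbitSpace) (hY : S.IsDef (G.emb '' Y)) :
    G.univEuler = (G.restrict Y hY).univEuler +
      (G.restrict Yᶜ (G.isDef_compl hY)).univEuler := by
  obtain ⟨D, x, hD⟩ := (hG.restrict Y hY).exists_classes
  obtain ⟨D', x', hD'⟩ := (hG.restrict Yᶜ (G.isDef_compl hY)).exists_classes
  have hDU := D.iUnion_cell.trans (G.range_restrict_emb hY)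
  have hDU' := D'.iUnion_cell.trans (G.range_restrict_emb (G.isDef_compl hY))
  have hdd : Disjoint (G.emb '' Y) (G.emb '' Yᶜ) :=
    disjoint_image_of_injective G.isEmbedding_emb.injective disjoint_compl_right
  have hsub : ∀ i, D.cell i ⊆ G.emb '' Y := fun i => hDU ▸ subset_iUnion D.cell i
  have hsub' : ∀ i, D'.cell i ⊆ G.emb '' Yᶜ := fun i => hDU' ▸ subset_iUnion D'.cell i
  have key : ∀ (Z : Set G.OrbitSpace) (hZ : S.IsDef (G.emb '' Z)) (C : Set (Fin G.dim → ℝ))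
      (c : LieClass.{u}), C ⊆ G.emb '' Z → (G.restrict Z hZ).emb ⁻¹' C ⊆
        (G.restrict Z hZ).orbitType c → G.emb ⁻¹' C ⊆ G.orbitType c := by
    intro Z hZ C c hCZ hC y hy
    obtain ⟨y', hy', hyy'⟩ := hCZ hy
    obtain rfl := G.isEmbedding_emb.injective hyy'
    obtain ⟨z, rfl⟩ := G.surjective_orbitMap y'
    let w : (G.restrict Z hZ).Obj := ⟨z, hy'⟩
    have h1 := (G.restrict Z hZ).orbitMap_mem_orbitType.1
      (hC (show (G.restrict Z hZ).orbitMap w ∈ (G.restrict Z hZ).emb ⁻¹' C from hy))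
    rw [restrict_isoClass] at h1
    exact G.orbitMap_mem_orbitType.2 h1
  rw [univEuler_eq G (ι := Fin D.card ⊕ Fin D'.card) (C := Sum.elim D.cell D'.cell)
      (d := Sum.elim D.dim D'.dim) (c := Sum.elim (fun i => (G.restrict Y hY).isoClass (x i))
        fun i => (G.restrict Yᶜ (G.isDef_compl hY)).isoClass (x' i)) ?_ ?_ ?_ ?_,
    univEuler_eq (G.restrict Y hY) D.isCell D.disjoint D.iUnion_cell fun i => (hD i).2.2,
    univEuler_eq (G.restrict Yᶜ (G.isDef_compl hY)) D'.isCell D'.disjoint D'.iUnion_cell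
      fun i => (hD' i).2.2, Fintype.sum_sum_type]
  · rfl
  · rintro (i | i)
    exacts [D.isCell i, D'.isCell i]
  · rintro (i | i) (j | j) hij
    · exact D.disjoint fun h => hij (congrArg Sum.inl h)
    · exact hdd.mono (hsub i) (hsub' j)
    · exact (hdd.mono (hsub j) (hsub' i)).symm
    · exact D'.disjoint fun h => hij (congrArg Sum.inr h)
  · rw [iUnion_sum]
    have h1 : G.emb '' Y ∪ G.emb '' Yᶜ = range G.emb := by
      rw [← image_union, union_compl_self, image_univ]
    exact (congrArg₂ (· ∪ ·) hDU hDU').trans h1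
  · rintro (i | i)
    · exact key Y hY _ _ (hsub i) (hD i).2.2
    · exact key Yᶜ (G.isDef_compl hY) _ _ (hsub' i) (hD' i).2.2

end OrbitDefGroupoid

/-! ### Trivial actions on definable sets -/

namespace TopGroupoid

/-- Groupoids with one object and one arrow are isomorphic. -/
def Iso.ofUnique (G H : TopGroupoid.{u}) [Unique G.Obj] [Unique H.Obj] [Unique G.Arr]
    [Unique H.Arr] : Iso G H where
  obj := Homeomorph.homeomorphOfUnique _ _
  arr := Homeomorph.homeomorphOfUnique _ _
  map_src _ := Subsingleton.elim _ _
  map_tgt _ := Subsingleton.elim _ _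
  map_unit _ := Subsingleton.elim _ _
  map_inv _ := Subsingleton.elim _ _
  map_mul _ _ _ := Subsingleton.elim _ _

/-- The orbit space of a trivial action. -/
noncomputable def trivialActionOrbit (K X : Type u) [Group K] [TopologicalSpace K]
    [IsTopologicalGroup K] [T2Space K] [TopologicalSpace X] [T2Space X] :
    (trivialAction K X).OrbitSpace ≃ₜ X :=
  (isHomeomorph_orbitMap_trivialAction.homeomorph (trivialAction K X).orbitMap).symm

theorem nonempty_trivialAction_isotropy_equiv {K X : Type u} [Group K] [TopologicalSpace K]
    [IsTopologicalGroup K] [T2Space K] [TopologicalSpace X] [T2Space X]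
    (x y : (trivialAction K X).Obj) :
    Nonempty ((trivialAction K X).Isotropy x ≃ₜ* (trivialAction K X).Isotropy y) :=
  ⟨(trivialActionIsotropy x).trans (trivialActionIsotropy y).symm⟩

end TopGroupoid

namespace OMinimalStructure

variable {S : OMinimalStructure}

theorem isCell_univ (n : ℕ) : S.IsCell n (univ : Set (Fin n → ℝ)) := by
  induction n with
  | zero => exact IsCell.point
  | succ n ih =>
    have h := IsCell.band (f := fun _ => ⊥) (g := fun _ => ⊤) ih (Or.inr fun _ _ => rfl)
      (Or.inr fun _ _ => rfl) fun _ _ => bot_lt_top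
    convert h
    ext x
    simp [bandOver]

theorem defContOn_zero (n : ℕ) : S.DefContOn (univ : Set (Fin n → ℝ)) fun _ => 0 :=
  ⟨continuousOn_const, (DefP.eq (defMap_apply (Fin.last n)) (defMap_const 0)).isDef
    fun x => by simp [graphOver]⟩

end OMinimalStructure

namespace OrbitDefGroupoid

variable {S : OMinimalStructure}

/-- The map `|K ⋉ A| → ℝⁿ` given by the inclusion of `A`. -/
noncomputable def trivialEmb (K : CompactLieGrp.{u}) {n : ℕ} (A : Set (Fin n → ℝ)) :
    (TopGroupoid.trivialAction K.carrier (ULift.{u} A)).OrbitSpace → Fin n → ℝ :=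
  fun y => (TopGroupoid.trivialActionOrbit _ _ y).down.1

theorem isEmbedding_trivialEmb (K : CompactLieGrp.{u}) {n : ℕ} (A : Set (Fin n → ℝ)) :
    IsEmbedding (trivialEmb K A) :=
  IsEmbedding.subtypeVal.comp
    (Homeomorph.ulift.isEmbedding.comp (TopGroupoid.trivialActionOrbit _ _).isEmbedding)

theorem range_trivialEmb (K : CompactLieGrp.{u}) {n : ℕ} (A : Set (Fin n → ℝ)) :
    range (trivialEmb K A) = A := by
  have h : Function.Surjective fun y =>
      (TopGroupoid.trivialActionOrbit K.carrier (ULift.{u} A) y).down :=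
    ULift.down_surjective.comp (TopGroupoid.trivialActionOrbit _ _).surjective
  exact (h.range_comp (Subtype.val : A → Fin n → ℝ)).trans Subtype.range_coe

/-- The groupoid `K ⋉ A` of the trivial action of a compact Lie group on a definable set. -/
noncomputable def trivialDef (K : CompactLieGrp.{u}) {n : ℕ} {A : Set (Fin n → ℝ)}
    (hA : S.IsDef A) : OrbitDefGroupoid.{u} S where
  toTopGroupoid := TopGroupoid.trivialAction K.carrier (ULift.{u} A)
  dim := n
  emb := trivialEmb K A
  isEmbedding_emb := isEmbedding_trivialEmb K A
  isDef_range := (range_trivialEmb K A).symm ▸ hA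
  compact_isotropy x := (TopGroupoid.trivialActionIsotropy x).toHomeomorph.symm.compactSpace
  lie_isotropy x := K.lie.congr (TopGroupoid.trivialActionIsotropy x).symm
  finite_types := by
    rcases isEmpty_or_nonempty (ULift.{u} A) with h | ⟨⟨a⟩⟩
    · exact ⟨∅, finite_empty, fun x => (h.false x).elim⟩
    · exact ⟨{a}, finite_singleton _, fun x =>
        ⟨a, rfl, TopGroupoid.nonempty_trivialAction_isotropy_equiv x _⟩⟩
  isDef_type x := by
    have h : {y | Nonempty ((TopGroupoid.trivialAction K.carrier (ULift.{u} A)).Isotropy y ≃ₜ*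
        (TopGroupoid.trivialAction K.carrier (ULift.{u} A)).Isotropy x)} = univ :=
      eq_univ_of_forall fun y => TopGroupoid.nonempty_trivialAction_isotropy_equiv y x
    rw [h, image_univ_of_surjective (TopGroupoid.surjective_orbitMap _), image_univ,
      range_trivialEmb]
    exact hA

theorem isoClass_trivialDef (K : CompactLieGrp.{u}) {n : ℕ} {A : Set (Fin n → ℝ)}
    (hA : S.IsDef A) (x : (trivialDef K hA).Obj) : (trivialDef K hA).isoClass x = ⟦K⟧ :=
  Quotient.sound (s := CompactLieGrp.setoid) ⟨TopGroupoid.trivialActionIsotropy x⟩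

theorem restrict_trivialDef (K : CompactLieGrp.{u}) {n : ℕ} {A : Set (Fin n → ℝ)}
    (hA : S.IsDef A) (Y : Set (trivialDef K hA).OrbitSpace) :
    ((trivialDef K hA).toTopGroupoid.restrict ((trivialDef K hA).orbitMap ⁻¹' Y)).MoritaEquiv
      (TopGroupoid.trivialAction K.carrier Y) :=
  ((TopGroupoid.trivialActionRestrictIso _).moritaEquiv).trans_iso
    (TopGroupoid.trivialActionIso (ContinuousMulEquiv.refl _)
      ((TopGroupoid.isHomeomorph_orbitMap_trivialAction.homeomorph
        (TopGroupoid.trivialAction K.carrier (ULift.{u} A)).orbitMap).sets rfl))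

/-- All points have isotropy group `K`, so any partition into cells works. -/
theorem isIsotropyLocallyTrivial_trivialDef (K : CompactLieGrp.{u}) {n : ℕ} {A : Set (Fin n → ℝ)}
    (hA : S.IsDef A) : (trivialDef K hA).IsIsotropyLocallyTrivial := by
  refine isIsotropyLocallyTrivial_of_partCells _ ?_
  refine (OMinimalStructure.partCells_of_isDef (trivialDef K hA).isDef_range).bind
    fun C _ d hd _ => OMinimalStructure.PartCells.of_isCell hd fun x _ => ⟨fun y _ => ?_, ?_⟩
  · obtain ⟨z, rfl⟩ := TopGroupoid.surjective_orbitMap _ y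
    refine (trivialDef K hA).orbitMap_mem_orbitType.2 ?_
    rw [isoClass_trivialDef, isoClass_trivialDef]
  · let e : (trivialDef K hA).Isotropy x ≃ₜ* K.carrier := TopGroupoid.trivialActionIsotropy x
    exact (restrict_trivialDef K hA _).trans_iso
      (TopGroupoid.trivialActionIso e.symm (Homeomorph.refl _))

/-- Every generator of the universal ring is thus attained, which makes the homomorphism in the
theorem unique. -/
theorem univEuler_trivialDef_point (K : CompactLieGrp.{u}) :
    (trivialDef K (S.isCell_univ 0).isDef).univEuler = univT ⟦K⟧ := by
  rw [univEuler_eq (trivialDef K (S.isCell_univ 0).isDef) (ι := Unit) (C := fun _ => univ)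
    (d := fun _ => 0) (c := fun _ => ⟦K⟧) (fun _ => S.isCell_univ 0)
    (fun i j hij => (hij (Subsingleton.elim i j)).elim) ?_ ?_]
  · simp
  · rw [iUnion_const]
    exact (range_trivialEmb K univ).symm
  · intro _ y _
    obtain ⟨z, rfl⟩ := TopGroupoid.surjective_orbitMap _ y
    exact (trivialDef K (S.isCell_univ 0).isDef).orbitMap_mem_orbitType.2
      (isoClass_trivialDef K _ z)

/-! ### Values of additive invariants -/

section Invariant

variable {R : Type v} {I : OrbitDefGroupoid.{u} S → R}

/-- Morita invariance ignores the embedding of the orbit space: only `K` and the homeomorphism type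
of the base matter. -/
theorem IsTopInvariant.eq_trivialDef (hI : IsTopInvariant I) {G : OrbitDefGroupoid.{u} S}
    {K : CompactLieGrp.{u}} {X : Type u} [TopologicalSpace X] [T2Space X]
    (h : G.MoritaEquiv (TopGroupoid.trivialAction K.carrier X)) {n : ℕ} {A : Set (Fin n → ℝ)}
    (hA : S.IsDef A) (e : X ≃ₜ A) : I G = I (trivialDef K hA) :=
  hI _ _ (h.trans_iso (TopGroupoid.trivialActionIso (ContinuousMulEquiv.refl _)
    (e.trans Homeomorph.ulift.symm)))

theorem IsTopInvariant.trivialDef_congr (hI : IsTopInvariant I) {K K' : CompactLieGrp.{u}}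
    (f : K.carrier ≃ₜ* K'.carrier) {m n : ℕ} {A : Set (Fin m → ℝ)} {B : Set (Fin n → ℝ)}
    (hA : S.IsDef A) (hB : S.IsDef B) (e : A ≃ₜ B) : I (trivialDef K hA) = I (trivialDef K' hB) :=
  hI _ _ (TopGroupoid.trivialActionIso f
    ((Homeomorph.ulift.trans e).trans Homeomorph.ulift.symm)).moritaEquiv

theorem restrict_congr (G : OrbitDefGroupoid.{u} S) {Y Z : Set G.OrbitSpace}
    (hY : S.IsDef (G.emb '' Y)) (hZ : S.IsDef (G.emb '' Z)) (h : Y = Z) :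
    G.restrict Y hY = G.restrict Z hZ := by
  subst h
  rfl

theorem isDef_union (G : OrbitDefGroupoid.{u} S) {Y Z : Set G.OrbitSpace}
    (hY : S.IsDef (G.emb '' Y)) (hZ : S.IsDef (G.emb '' Z)) : S.IsDef (G.emb '' (Y ∪ Z)) := by
  rw [image_union]
  exact S.union hY hZ

theorem isDef_empty (G : OrbitDefGroupoid.{u} S) : S.IsDef (G.emb '' ∅) := by
  rw [image_empty]
  exact S.empty _

/-- The restriction of a restriction. -/
theorem restrict_restrict_moritaEquiv (G : OrbitDefGroupoid.{u} S) {Y Z : Set G.OrbitSpace}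
    (hY : S.IsDef (G.emb '' Y)) (hZ : S.IsDef (G.emb '' Z)) (hZY : Z ⊆ Y)
    {W : Set (G.restrict Y hY).OrbitSpace} (hW : S.IsDef ((G.restrict Y hY).emb '' W))
    (h : ∀ x, x ∈ W ↔ G.restrictOrbit Y x ∈ Z) :
    ((G.restrict Y hY).restrict W hW).MoritaEquiv (G.restrict Z hZ).toTopGroupoid :=
  (G.restrictRestrictIso (G.orbitMap ⁻¹' Y) ((G.restrict Y hY).orbitMap ⁻¹' W) (G.orbitMap ⁻¹' Z)
    fun _ => ⟨fun hx => ⟨hZY hx, (h _).2 hx⟩, fun ⟨_, hx⟩ => (h _).1 hx⟩).moritaEquiv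

/-- Additivity splits a whole groupoid only, so it is applied to the restriction to `Y ∪ Z`, and the
double restrictions are identified by Morita invariance. -/
theorem restrict_union [AddCommGroup R] (hI : IsTopInvariant I) (ha : IsAdditiveOnILT I)
    {G : OrbitDefGroupoid.{u} S} (hG : G.IsIsotropyLocallyTrivial) {Y Z : Set G.OrbitSpace}
    (hY : S.IsDef (G.emb '' Y)) (hZ : S.IsDef (G.emb '' Z)) (hd : Disjoint Y Z) :
    I (G.restrict (Y ∪ Z) (G.isDef_union hY hZ)) = I (G.restrict Y hY) + I (G.restrict Z hZ) := by
  have hU := G.isDef_union hY hZ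
  let W : Set (G.restrict (Y ∪ Z) hU).OrbitSpace := G.restrictOrbit (Y ∪ Z) ⁻¹' Y
  have hW : S.IsDef ((G.restrict (Y ∪ Z) hU).emb '' W) := by
    have h : (G.emb ∘ G.restrictOrbit (Y ∪ Z)) '' (G.restrictOrbit (Y ∪ Z) ⁻¹' Y) = G.emb '' Y := by
      rw [image_comp, image_preimage_eq_inter_range, G.range_restrictOrbit,
        inter_eq_left.2 subset_union_left]
    exact h.symm ▸ hY
  rw [ha _ (hG.restrict (Y ∪ Z) hU) W hW]
  congr 1
  · exact hI _ _ (G.restrict_restrict_moritaEquiv hU hY subset_union_left hW fun _ => Iff.rfl)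
  · refine hI _ _ (G.restrict_restrict_moritaEquiv hU hZ subset_union_right _ fun x => ?_)
    have h1 : G.restrictOrbit (Y ∪ Z) x ∈ Y ∪ Z :=
      (G.range_restrictOrbit (Y ∪ Z)).subset (mem_range_self x)
    exact ⟨fun h => h1.resolve_left h, fun h h' => Set.disjoint_left.1 hd h' h⟩

/-- From `∅ = ∅ ∪ ∅` the value equals twice itself. -/
theorem restrict_empty [AddCommGroup R] (hI : IsTopInvariant I) (ha : IsAdditiveOnILT I)
    {G : OrbitDefGroupoid.{u} S} (hG : G.IsIsotropyLocallyTrivial) :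
    I (G.restrict ∅ G.isDef_empty) = 0 := by
  have h := restrict_union hI ha hG G.isDef_empty G.isDef_empty disjoint_bot_left
  rw [G.restrict_congr _ G.isDef_empty (union_self ∅)] at h
  exact left_eq_add.1 h

theorem isDef_biUnion (G : OrbitDefGroupoid.{u} S) {ι : Type*} (s : Finset ι)
    {Y : ι → Set G.OrbitSpace} (hY : ∀ i, S.IsDef (G.emb '' Y i)) :
    S.IsDef (G.emb '' ⋃ i ∈ s, Y i) := by
  rw [image_iUnion₂]
  exact S.biUnion s.finite_toSet fun i _ => hY i

theorem restrict_biUnion [AddCommGroup R] (hI : IsTopInvariant I) (ha : IsAdditiveOnILT I)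
    {G : OrbitDefGroupoid.{u} S} (hG : G.IsIsotropyLocallyTrivial) {ι : Type*} (s : Finset ι)
    {Y : ι → Set G.OrbitSpace} (hY : ∀ i, S.IsDef (G.emb '' Y i))
    (hd : Pairwise fun i j => Disjoint (Y i) (Y j)) :
    I (G.restrict (⋃ i ∈ s, Y i) (G.isDef_biUnion s hY)) = ∑ i ∈ s, I (G.restrict (Y i) (hY i)) := by
  classical
  induction s using Finset.induction_on with
  | empty =>
    rw [Finset.sum_empty, G.restrict_congr _ G.isDef_empty (by simp)]
    exact restrict_empty hI ha hG
  | insert a s has ih =>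
    rw [Finset.sum_insert has, ← ih, ← restrict_union hI ha hG (hY a) (G.isDef_biUnion s hY)]
    · exact congrArg I (G.restrict_congr _ _ (Finset.set_biUnion_insert a s Y))
    · refine Set.disjoint_iUnion₂_right.2 fun i hi => hd ?_
      rintro rfl
      exact has hi

theorem eq_sum_restrict [AddCommGroup R] (hI : IsTopInvariant I) (ha : IsAdditiveOnILT I)
    {G : OrbitDefGroupoid.{u} S} (hG : G.IsIsotropyLocallyTrivial) {ι : Type*} [Fintype ι]
    {Y : ι → Set G.OrbitSpace} (hY : ∀ i, S.IsDef (G.emb '' Y i))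
    (hd : Pairwise fun i j => Disjoint (Y i) (Y j)) (hU : ⋃ i, Y i = univ) :
    I G = ∑ i, I (G.restrict (Y i) (hY i)) := by
  -- Splitting off the empty set replaces `G` by its restriction to the whole orbit space, which has
  -- the form of the right side.
  rw [← restrict_biUnion hI ha hG Finset.univ hY hd, ha G hG ∅ G.isDef_empty,
    restrict_empty hI ha hG, zero_add]
  exact congrArg I (G.restrict_congr _ _ (by simp [hU]))

theorem trivialDef_add [AddCommGroup R] (hI : IsTopInvariant I) (ha : IsAdditiveOnILT I)
    (K : CompactLieGrp.{u}) {n : ℕ} {A B C : Set (Fin n → ℝ)} (hA : S.IsDef A) (hB : S.IsDef B)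
    (hC : S.IsDef C) (hU : B ∪ C = A) (hd : Disjoint B C) :
    I (trivialDef K hA) = I (trivialDef K hB) + I (trivialDef K hC) := by
  have hr : range (trivialDef K hA).emb = A := range_trivialEmb K A
  have key : ∀ (D : Set (Fin n → ℝ)) (hD : S.IsDef D), D ⊆ A →
      ∀ (Y : Set (trivialDef K hA).OrbitSpace) (hY : S.IsDef ((trivialDef K hA).emb '' Y)),
        Y = (trivialDef K hA).emb ⁻¹' D →
          I ((trivialDef K hA).restrict Y hY) = I (trivialDef K hD) := by
    rintro D hD hDA _ hY rfl
    exact hI.eq_trivialDef (restrict_trivialDef K hA _) hD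
      ((trivialDef K hA).isEmbedding_emb.homeomorphOfSubsetRange (hr.symm ▸ hDA))
  have hBA : B ⊆ A := hU ▸ subset_union_left
  have hCA : C ⊆ A := hU ▸ subset_union_right
  have hY : S.IsDef ((trivialDef K hA).emb '' ((trivialDef K hA).emb ⁻¹' B)) := by
    have h : trivialEmb K A '' (trivialEmb K A ⁻¹' B) = B := by
      rw [image_preimage_eq_inter_range, range_trivialEmb, inter_eq_left.2 hBA]
    exact h.symm ▸ hB
  rw [ha _ (isIsotropyLocallyTrivial_trivialDef K hA) _ hY, key B hB hBA _ _ rfl,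
    key C hC hCA _ _ ?_]
  ext y
  have hy : trivialEmb K A y ∈ B ∪ C := by
    rw [hU]
    exact (range_trivialEmb K A).subset (mem_range_self y)
  exact ⟨fun h => hy.resolve_left h, fun h h' => Set.disjoint_left.1 hd h' h⟩

/-- Both cells are homeomorphic to `ℝᵈ`; the homeomorphism need not be definable. -/
theorem trivialDef_isCell_congr (hI : IsTopInvariant I) (K : CompactLieGrp.{u}) {m n d : ℕ}
    {A : Set (Fin m → ℝ)} {B : Set (Fin n → ℝ)} (hA : S.IsCell d A) (hB : S.IsCell d B) :
    I (trivialDef K hA.isDef) = I (trivialDef K hB.isDef) := by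
  obtain ⟨e⟩ := hA.nonempty_homeomorph
  obtain ⟨f⟩ := hB.nonempty_homeomorph
  exact hI.trivialDef_congr (ContinuousMulEquiv.refl _) _ _ (e.trans f.symm)

/-- Splitting `ℝⁿ⁺¹` into a hyperplane and two half spaces. -/
theorem trivialDef_univ_succ [AddCommGroup R] (hI : IsTopInvariant I) (ha : IsAdditiveOnILT I)
    (K : CompactLieGrp.{u}) (n : ℕ) : I (trivialDef K (S.isCell_univ (n + 1)).isDef) =
      -I (trivialDef K (S.isCell_univ n).isDef) := by
  have h0 := OMinimalStructure.IsCell.graph (S.isCell_univ n) (S.defContOn_zero n)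
  have hz : S.DefContOn (univ : Set (Fin n → ℝ)) fun _ => 0 := S.defContOn_zero n
  have h1 := OMinimalStructure.IsCell.band (f := fun _ => ⊥) (g := fun _ => 0) (S.isCell_univ n)
    (Or.inr fun _ _ => rfl) (Or.inl ⟨_, hz, fun _ _ => rfl⟩) fun _ _ => EReal.bot_lt_zero
  have h2 := OMinimalStructure.IsCell.band (f := fun _ => 0) (g := fun _ => ⊤) (S.isCell_univ n)
    (Or.inl ⟨_, hz, fun _ _ => rfl⟩) (Or.inr fun _ _ => rfl) fun _ _ => EReal.zero_lt_top
  have hu := S.isCell_univ (n + 1)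
  have e1 := trivialDef_add hI ha K hu.isDef h0.isDef (S.union h1.isDef h2.isDef) (by
    ext x
    simp only [OMinimalStructure.graphOver, OMinimalStructure.bandOver, mem_union, mem_ofPred_eq,
      mem_univ, true_and, EReal.bot_lt_coe, EReal.coe_lt_top, and_true, iff_true]
    norm_cast
    grind) (by
    rw [Set.disjoint_left]
    rintro x ⟨_, hx⟩ (⟨_, _, h⟩ | ⟨_, h, _⟩)
    · rw [hx] at h
      exact lt_irrefl _ h
    · rw [hx] at h
      exact lt_irrefl _ h)
  have e2 := trivialDef_add hI ha K (S.union h1.isDef h2.isDef) h1.isDef h2.isDef rfl (by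
    rw [Set.disjoint_left]
    rintro x ⟨_, _, h⟩ ⟨_, h', _⟩
    exact lt_asymm h h')
  -- The hyperplane has the value `b` of `ℝⁿ` and each open half space the value `a` of `ℝⁿ⁺¹`, so
  -- `a = b + (a + a)`.
  rw [e2, trivialDef_isCell_congr hI K h0 (S.isCell_univ n), trivialDef_isCell_congr hI K h1 hu,
    trivialDef_isCell_congr hI K h2 hu] at e1
  generalize I (trivialDef K hu.isDef) = a at e1 ⊢
  generalize I (trivialDef K (S.isCell_univ n).isDef) = b at e1 ⊢
  rw [← add_assoc] at e1
  exact eq_neg_of_add_eq_zero_right (right_eq_add.1 e1)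

theorem trivialDef_isCell [AddCommGroup R] (hI : IsTopInvariant I) (ha : IsAdditiveOnILT I)
    (K : CompactLieGrp.{u}) {n d : ℕ} {A : Set (Fin n → ℝ)} (hA : S.IsCell d A) :
    I (trivialDef K hA.isDef) = ((-1) ^ d : ℤ) • I (trivialDef K (S.isCell_univ 0).isDef) := by
  rw [trivialDef_isCell_congr hI K hA (S.isCell_univ d)]
  clear hA
  induction d with
  | zero => simp
  | succ d ih => rw [trivialDef_univ_succ hI ha, ih, pow_succ, mul_neg_one, neg_smul]

/-- The value of an additive invariant on `K ⋉ pt`, as a function of the class of `K`. -/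
noncomputable def pointValue (hI : IsTopInvariant I) : LieClass.{u} → R :=
  Quotient.lift (fun K => I (trivialDef K (S.isCell_univ 0).isDef)) fun _ _ ⟨f⟩ =>
    hI.trivialDef_congr f _ _ (Homeomorph.refl _)

/-- The same cells, signs and labels compute both quantities, so a homomorphism from `T^[K]` to the
point values matches them term by term. -/
theorem exists_eq_sum_pointValue [AddCommGroup R] (hI : IsTopInvariant I) (ha : IsAdditiveOnILT I)
    {G : OrbitDefGroupoid.{u} S} (hG : G.IsIsotropyLocallyTrivial) :
    ∃ (k : ℕ) (d : Fin k → ℕ) (c : Fin k → LieClass.{u}),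
      I G = ∑ i, ((-1) ^ d i : ℤ) • pointValue hI (c i) ∧
      G.univEuler = ∑ i, ((-1) ^ d i : ℤ) • univT (c i) := by
  obtain ⟨D, x, hD⟩ := hG.exists_classes
  have hsub : ∀ i, D.cell i ⊆ range G.emb := fun i => by
    conv_rhs => rw [← D.iUnion_cell]
    exact subset_iUnion _ i
  refine ⟨D.card, D.dim, fun i => G.isoClass (x i), ?_,
    univEuler_eq G D.isCell D.disjoint D.iUnion_cell fun i => (hD i).2.2⟩
  have hY : ∀ i, S.IsDef (G.emb '' (G.emb ⁻¹' D.cell i)) := fun i => by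
    rw [image_preimage_eq_of_subset (hsub i)]
    exact (D.isCell i).isDef
  rw [eq_sum_restrict hI ha hG hY (fun i j hij => (D.disjoint hij).preimage _) ?_]
  · refine Finset.sum_congr rfl fun i _ => ?_
    refine (hI.eq_trivialDef (K := G.isotropyGrp (x i)) ((hD i).1 (x i) (hD i).2.1).2
      (D.isCell i).isDef (G.isEmbedding_emb.homeomorphOfSubsetRange (hsub i))).trans ?_
    exact trivialDef_isCell hI ha _ (D.isCell i)
  · rw [← preimage_iUnion, D.iUnion_cell, preimage_range]

end Invariant

end OrbitDefGroupoid

/-! ### Homomorphisms from the universal ring -/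

namespace LieClass

/-- Isomorphism classes of compact Lie groups form a commutative monoid under products. -/
instance : CommMonoid LieClass.{u} where
  mul := prod
  one := trivial
  mul_assoc := by
    rintro ⟨G⟩ ⟨H⟩ ⟨K⟩
    exact Quotient.sound (s := CompactLieGrp.setoid)
      ⟨{ (MulEquiv.prodAssoc : (G.carrier × H.carrier) × K.carrier ≃* _) with
        continuous_toFun := (Homeomorph.prodAssoc _ _ _).continuous
        continuous_invFun := (Homeomorph.prodAssoc _ _ _).symm.continuous }⟩
  mul_comm := by
    rintro ⟨G⟩ ⟨H⟩
    exact Quotient.sound (s := CompactLieGrp.setoid)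
      ⟨{ (MulEquiv.prodComm : G.carrier × H.carrier ≃* _) with
        continuous_toFun := continuous_swap
        continuous_invFun := continuous_swap }⟩
  one_mul := by
    rintro ⟨G⟩
    exact Quotient.sound (s := CompactLieGrp.setoid)
      ⟨{ (MulEquiv.uniqueProd : PUnit.{u + 1} × G.carrier ≃* _) with
        continuous_toFun := continuous_snd
        continuous_invFun := continuous_const.prodMk continuous_id }⟩
  mul_one := by
    rintro ⟨G⟩
    exact Quotient.sound (s := CompactLieGrp.setoid)
      ⟨{ (MulEquiv.prodUnique : G.carrier × PUnit.{u + 1} ≃* _) with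
        continuous_toFun := continuous_fst
        continuous_invFun := continuous_id.prodMk continuous_const }⟩

theorem mul_def (c d : LieClass.{u}) : c * d = c.prod d := rfl

end LieClass

namespace UnivRing

/-- The map from the universal ring to the monoid ring of isomorphism classes. -/
noncomputable def toMonoidAlgebra : UnivRing.{u} →+* MonoidAlgebra ℤ LieClass.{u} :=
  Ideal.Quotient.lift univIdeal
    (MvPolynomial.eval₂Hom (Int.castRingHom _) fun c => MonoidAlgebra.of ℤ _ c) (by
      intro a ha
      rw [← RingHom.mem_ker]
      refine (Ideal.span_le.2 ?_ : univIdeal ≤ RingHom.ker _) ha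
      rintro _ (⟨c, d, rfl⟩ | rfl)
      · rw [SetLike.mem_coe, RingHom.mem_ker, map_sub, map_mul, MvPolynomial.eval₂Hom_X',
          MvPolynomial.eval₂Hom_X', MvPolynomial.eval₂Hom_X', ← map_mul, LieClass.mul_def, sub_self]
      · rw [SetLike.mem_coe, RingHom.mem_ker, map_sub, MvPolynomial.eval₂Hom_X', map_one, sub_eq_zero]
        exact map_one (MonoidAlgebra.of ℤ LieClass.{u}))

theorem toMonoidAlgebra_univT (c : LieClass.{u}) :
    toMonoidAlgebra (univT c) = MonoidAlgebra.of ℤ _ c :=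
  (Ideal.Quotient.lift_mk _ _ _).trans (MvPolynomial.eval₂Hom_X' _ _ _)

/-- The homomorphism determined by a multiplicative function of isomorphism classes. -/
noncomputable def lift {R : Type v} [Ring R] (f : LieClass.{u} →ₙ* R) : UnivRing.{u} →ₙ+* R :=
  -- Neither is `R` assumed commutative nor does `f` have to preserve the unit, so evaluation of
  -- polynomials in `R` is not available; the non-unital universal property of the monoid ring is.
  (MonoidAlgebra.liftMagma ℤ f : MonoidAlgebra ℤ LieClass.{u} →ₙ+* R).comp
    (toMonoidAlgebra : UnivRing.{u} →ₙ+* MonoidAlgebra ℤ LieClass.{u})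

theorem lift_univT {R : Type v} [Ring R] (f : LieClass.{u} →ₙ* R) (c : LieClass.{u}) :
    lift f (univT c) = f c := by
  change MonoidAlgebra.liftMagma ℤ f (toMonoidAlgebra (univT c)) = f c
  rw [toMonoidAlgebra_univT]
  exact DFunLike.congr_fun ((MonoidAlgebra.liftMagma ℤ).symm_apply_apply f) c

/-- A product of generators is a generator and constants are multiples of `T^[e] = 1`, so every
polynomial reduces to an integer combination of generators. -/
theorem closure_range_univT : AddSubgroup.closure (range univT.{u}) = ⊤ := by
  have hmul : ∀ (c : LieClass.{u}) (x : UnivRing.{u}), x ∈ AddSubgroup.closure (range univT.{u}) →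
      x * univT c ∈ AddSubgroup.closure (range univT.{u}) := by
    intro c x hx
    induction hx using AddSubgroup.closure_induction with
    | mem x hx =>
      obtain ⟨d, rfl⟩ := hx
      rw [OrbitDefGroupoid.univT_mul]
      exact AddSubgroup.subset_closure ⟨_, rfl⟩
    | zero =>
      rw [zero_mul]
      exact zero_mem _
    | add x y _ _ h h' =>
      rw [add_mul]
      exact add_mem h h'
    | neg x _ h => exact Eq.mpr (congrArg (· ∈ _) (neg_mul x (univT c))) (neg_mem h)
  refine (AddSubgroup.eq_top_iff' _).2 fun x => ?_
  obtain ⟨p, rfl⟩ := Ideal.Quotient.mk_surjective x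
  induction p using MvPolynomial.induction_on with
  | C a =>
    have h : Ideal.Quotient.mk univIdeal.{u} (MvPolynomial.C a) = a • univT LieClass.trivial := by
      rw [OrbitDefGroupoid.univT_trivial]
      simp
    rw [h]
    exact zsmul_mem (AddSubgroup.subset_closure (mem_range_self _)) a
  | add p q hp hq =>
    rw [map_add]
    exact add_mem hp hq
  | mul_X p c hp =>
    rw [map_mul]
    exact hmul c _ hp

theorem hom_ext {R : Type v} [Ring R] {r r' : UnivRing.{u} →ₙ+* R}
    (h : ∀ c, r (univT c) = r' (univT c)) : r = r' := by
  have h1 : (r : UnivRing.{u} →+ R) = r' :=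
    AddMonoidHom.eq_of_eqOn_dense closure_range_univT (by
      rintro _ ⟨c, rfl⟩
      exact h c)
  exact NonUnitalRingHom.ext fun x => DFunLike.congr_fun h1 x

end UnivRing

/-! ### Factorization of invariants through the universal Euler characteristic. -/

namespace OrbitDefGroupoid

variable {S : OMinimalStructure} {R : Type v} [Ring R] {I : OrbitDefGroupoid.{u} S → R}

/-- The one-point space. -/
instance : Unique (ULift.{u} (univ : Set (Fin 0 → ℝ))) :=
  (Equiv.ulift.trans (Equiv.Set.univ (Fin 0 → ℝ))).unique

/-- The product of `K ⋉ pt` and `L ⋉ pt` is `(K × L) ⋉ pt`. Its orbit space is one point, so the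
embedding condition in multiplicativity is automatic. -/
theorem pointValue_mul (hI : IsTopInvariant I) (hm : IsMultiplicativeOnILT I)
    (c d : LieClass.{u}) : pointValue hI (c * d) = pointValue hI c * pointValue hI d := by
  obtain ⟨K⟩ := c
  obtain ⟨L⟩ := d
  have hp := (S.isCell_univ 0).isDef
  have hsub : Subsingleton ((trivialDef K hp).toTopGroupoid.prod
      (trivialDef L hp).toTopGroupoid).OrbitSpace := by
    refine ⟨fun x y => ?_⟩
    obtain ⟨⟨⟨a⟩, ⟨b⟩⟩, rfl⟩ := TopGroupoid.surjective_orbitMap _ x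
    obtain ⟨⟨⟨a'⟩, ⟨b'⟩⟩, rfl⟩ := TopGroupoid.surjective_orbitMap _ y
    rw [Subsingleton.elim a a', Subsingleton.elim b b']
  have he : IsEmbedding ((trivialDef K hp).prodEmb (trivialDef L hp)) := .of_subsingleton _
  refine Eq.trans ?_ (hm _ _ (isIsotropyLocallyTrivial_trivialDef K hp)
    (isIsotropyLocallyTrivial_trivialDef L hp) he)
  symm
  have : Unique (ULift.{u} (univ : Set (Fin 0 → ℝ)) × ULift.{u} (univ : Set (Fin 0 → ℝ))) :=
    Unique.mk' _
  exact hI.eq_trivialDef (K := K.prod L) TopGroupoid.trivialActionProdIso.moritaEquiv hp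
    ((Homeomorph.homeomorphOfUnique (ULift.{u} (univ : Set (Fin 0 → ℝ)) ×
      ULift.{u} (univ : Set (Fin 0 → ℝ))) (ULift.{u} (univ : Set (Fin 0 → ℝ)))).trans
        Homeomorph.ulift)

/-- An additive and multiplicative invariant factors through the universal Euler characteristic. -/
theorem exists_hom (hI : IsTopInvariant I) (ha : IsAdditiveOnILT I)
    (hm : IsMultiplicativeOnILT I) : ∃ r : UnivRing.{u} →ₙ+* R, ∀ G : OrbitDefGroupoid.{u} S,
      G.IsIsotropyLocallyTrivial → I G = r G.univEuler := by
  refine ⟨UnivRing.lift ⟨pointValue hI, pointValue_mul hI hm⟩, fun G hG => ?_⟩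
  obtain ⟨k, d, c, h1, h2⟩ := exists_eq_sum_pointValue hI ha hG
  rw [h1, h2, map_sum]
  refine Finset.sum_congr rfl fun i _ => ?_
  rw [map_zsmul, UnivRing.lift_univT]
  rfl

theorem hom_univT {r : UnivRing.{u} →ₙ+* R} (h : ∀ G : OrbitDefGroupoid.{u} S,
    G.IsIsotropyLocallyTrivial → I G = r G.univEuler) (K : CompactLieGrp.{u}) :
    r (univT ⟦K⟧) = I (trivialDef K (S.isCell_univ 0).isDef) := by
  rw [h _ (isIsotropyLocallyTrivial_trivialDef _ _), univEuler_trivialDef_point]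

theorem hom_unique {r r' : UnivRing.{u} →ₙ+* R} (h : ∀ G : OrbitDefGroupoid.{u} S,
    G.IsIsotropyLocallyTrivial → I G = r G.univEuler) (h' : ∀ G : OrbitDefGroupoid.{u} S,
    G.IsIsotropyLocallyTrivial → I G = r' G.univEuler) : r = r' := by
  refine UnivRing.hom_ext fun c => ?_
  obtain ⟨K⟩ := c
  exact (hom_univT h K).trans (hom_univT h' K).symm

/-- The formula also applies to pieces and products, since these are again isotropy locally trivial;
the rest is inherited from the universal Euler characteristic. -/
theorem additive_and_multiplicative_of_hom {r : UnivRing.{u} →ₙ+* R}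
    (h : ∀ G : OrbitDefGroupoid.{u} S, G.IsIsotropyLocallyTrivial → I G = r G.univEuler) :
    IsAdditiveOnILT I ∧ IsMultiplicativeOnILT I := by
  constructor
  · intro G hG Y hY
    rw [h G hG, h _ (hG.restrict Y hY), h _ (hG.restrict Yᶜ _), ← map_add,
      ← hG.univEuler_add Y hY]
  · intro G H hG hH hGH
    rw [h G hG, h H hH, h _ (hG.prod hH hGH).1, (hG.prod hH hGH).2, map_mul]

instance : Unique (trivialDef CompactLieGrp.trivial.{u} (S.isCell_univ 0).isDef).Obj :=
  inferInstanceAs (Unique (ULift.{u} (univ : Set (Fin 0 → ℝ))))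

instance : Unique (trivialDef CompactLieGrp.trivial.{u} (S.isCell_univ 0).isDef).Arr :=
  Unique.mk' (PUnit.{u + 1} × ULift.{u} (univ : Set (Fin 0 → ℝ)))

theorem isNormalized_iff (hI : IsTopInvariant I) : IsNormalized I ↔
    I (trivialDef CompactLieGrp.trivial.{u} (S.isCell_univ 0).isDef) = 1 := by
  constructor
  · exact fun h => h _ ⟨inferInstance⟩
  · rintro h G ⟨_⟩
    -- Objects embed into arrows by their units, so a single arrow forces a single object.
    have : Unique G.Obj :=
      { default := G.src default
        uniq := fun x => by rw [← G.src_unit x, Subsingleton.elim (G.unit x) default] }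
    rw [← h]
    exact hI _ _ (TopGroupoid.Iso.ofUnique _ _).moritaEquiv

end OrbitDefGroupoid

theorem theorem3 (S : OMinimalStructure) {R : Type v} [Ring R]
    (I : OrbitDefGroupoid.{u} S → R) (hI : OrbitDefGroupoid.IsTopInvariant I) :
    ((OrbitDefGroupoid.IsAdditiveOnILT I ∧ OrbitDefGroupoid.IsMultiplicativeOnILT I) ↔
      ∃! r : UnivRing.{u} →ₙ+* R, ∀ G : OrbitDefGroupoid.{u} S,
        G.IsIsotropyLocallyTrivial → I G = r G.univEuler) ∧
    ((OrbitDefGroupoid.IsAdditiveOnILT I ∧ OrbitDefGroupoid.IsMultiplicativeOnILT I ∧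
        OrbitDefGroupoid.IsNormalized I) ↔
      ∃! r : UnivRing.{u} →+* R, ∀ G : OrbitDefGroupoid.{u} S,
        G.IsIsotropyLocallyTrivial → I G = r G.univEuler) := by
  refine ⟨⟨fun ⟨ha, hm⟩ => ?_, fun ⟨r, hr, _⟩ =>
    OrbitDefGroupoid.additive_and_multiplicative_of_hom hr⟩, fun ⟨ha, hm, hn⟩ => ?_,
    fun ⟨r, hr, _⟩ => ?_⟩
  · obtain ⟨r, hr⟩ := OrbitDefGroupoid.exists_hom hI ha hm
    exact ⟨r, hr, fun r' hr' => OrbitDefGroupoid.hom_unique hr' hr⟩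
  · obtain ⟨r, hr⟩ := OrbitDefGroupoid.exists_hom hI ha hm
    -- The unit is `T^[e]`, whose image under `r` is the value of `I` on the one-point groupoid.
    have h1 : r 1 = 1 := by
      rw [← OrbitDefGroupoid.univT_trivial]
      exact (OrbitDefGroupoid.hom_univT hr _).trans ((OrbitDefGroupoid.isNormalized_iff hI).1 hn)
    refine ⟨{ r with map_one' := h1 }, hr, fun r' hr' => ?_⟩
    -- Uniqueness already holds among non-unital homomorphisms.
    have h2 : (r' : UnivRing.{u} →ₙ+* R) = r := OrbitDefGroupoid.hom_unique hr' hr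
    exact RingHom.ext fun x => DFunLike.congr_fun h2 x
  · have h : ∀ G : OrbitDefGroupoid.{u} S, G.IsIsotropyLocallyTrivial →
      I G = (r : UnivRing.{u} →ₙ+* R) G.univEuler := hr
    obtain ⟨ha, hm⟩ := OrbitDefGroupoid.additive_and_multiplicative_of_hom h
    refine ⟨ha, hm, (OrbitDefGroupoid.isNormalized_iff hI).2 ?_⟩
    rw [← OrbitDefGroupoid.hom_univT h]
    exact (congrArg r OrbitDefGroupoid.univT_trivial).trans (map_one r)
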